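/- **Setting.** Let $n\ge 1$, $p\ge 0$, and $f=\frac1n\sum_{i=1}^n f_i$ with $f_i:\mathbb R^p\to\mathbb R$ differentiable. Write $F(X)$ for the $n\times p$ matrix with rows $\nabla f_i(x_i)$, where $x_i$ are the rows of $X$. *Network.* $R,C\in\mathbb R^{n\times n}$ are nonnegative, $R\mathbf 1=\mathbf 1$, $\mathbf 1^TC=\mathbf 1^T$; the digraphs of $R$ and $C$ (edge $j\to i$ iff the $(i,j)$ entry is positive) are contained in a strongly connected digraph on $\{1,\dots,n\}$, and some node is the root of a spanning tree both of the digraph of $R$ and of the digraph of $C^T$. *Objective.* $\nabla f_i$ is $L_i$-Lipschitz, $L=\max_iL_i$; $x^*$ minimizes $f$, and $\|\nabla f(x)\|^2\ge2\mu(f(x)-f(x^*))$ for all $x$, with $\mu>0$. *Compressor.* $\mathcal C$ is a (measurable) random operator on $\mathbb R^p$ such that for all $x$, $\mathbb E\|\mathcal C(x)-x\|^2\le C_0\|x\|^2+\sigma^2$ and $\mathbb E\|\mathcal C(x)/r-x\|^2\le(1-\delta)\|x\|^2+\sigma_r^2$, with constants $C_0,\sigma^2,\sigma_r^2\ge0$,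 $r>0$, $\delta\in(0,1]$. Different compression steps use independent randomness. *Algorithm (RCPP).* Let $\Lambda=\mathrm{diag}(\lambda_1,\dots,\lambda_n)$, $\lambda_i\ge0$, $\hat\lambda=\max_i\lambda_i$, and $Q_k(V)=s_k\,\mathcal C(V/s_k)$ row by row. Start at any $X^0$, $Y^0=F(X^0)$, $H_x^0=H_y^0=H_R^0=H_C^0=0$. For $k\ge0$: $\tilde X^k=X^k-\Lambda Y^k$, $Q_x^k=Q_k(\tilde X^k-H_x^k)$, $\hat X^k=H_x^k+Q_x^k$, $\hat X_R^k=H_R^k+RQ_x^k$, $H_x^{k+1}=(1-\alpha_x)H_x^k+\alpha_x\hat X^k$, $H_R^{k+1}=(1-\alpha_x)H_R^k+\alpha_x\hat X^k_R$, $X^{k+1}=\tilde X^k-\gamma_x(\hat X^k-\hat X_R^k)$; then $\tilde Y^k=Y^k+F(X^{k+1})-F(X^k)$, $Q_y^k=Q_k(\tilde Y^k-H_y^k)$, $\hat Y^k=H_y^k+Q_y^k$, $\hat Y_C^k=H_C^k+CQ_y^k$, $H_y^{k+1}=(1-\alpha_y)H_y^k+\alpha_y\hat Y^k$, $H_C^{k+1}=(1-\alpha_y)H_C^k+\alpha_y\hat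 Y_C^k$, $Y^{k+1}=\tilde Y^k-\gamma_y(\hat Y^k-\hat Y_C^k)$. *Norms.* Let $u_R,u_C\ge0$ satisfy $u_R^TR=u_R^T$, $Cu_C=u_C$, $u_R^T\mathbf 1=u_C^T\mathbf 1=n$, and put $\Pi_R=I-\frac1n\mathbf 1u_R^T$, $\Pi_C=I-\frac1nu_C\mathbf 1^T$, $R_\gamma=I-\gamma_x(I-R)$, $C_\gamma=I-\gamma_y(I-C)$, $\bar X^k=\frac1nu_R^TX^k$, $\bar\lambda=\frac1nu_R^T\Lambda u_C$. For invertible $\tilde R,\tilde C$ let $\|v\|_R=\|\tilde Rv\|$, $\|v\|_C=\|\tilde Cv\|$, with induced matrix norms, and $\|X\|_R=\|\tilde RX\|_F$ for $X\in\mathbb R^{n\times p}$. Call $(u_R,u_C,\tilde R,\tilde C,\theta_R,\theta_C)$ *admissible* for $(\gamma_x,\gamma_y)$ if $\|v\|\le\|v\|_R$ and $\|v\|\le\|v\|_C$ for all $v$, $\|\Pi_R\|_R\le1$, $\|\Pi_C\|_C\le1$, $\theta_R,\theta_C\in(0,1]$, $\|\Pi_RR_\gamma\|_R\le1-\theta_R\gamma_x$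 and $\|\Pi_CC_\gamma\|_C\le1-\theta_C\gamma_y$. Let $\delta_R,\delta_C$ be the least constants with $\|v\|_R\le\delta_R\|v\|$, $\|v\|_C\le\delta_C\|v\|$. *Constants.* $a_R=\|I-R\|_R$, $a_C=\|I-C\|_C$, $b_R=\|R_\gamma\|_R$; $c_2=\delta_R^2$, $c_{24}=2\delta_R^2a_R^2$, $c_3=c_5=3b_R^2$, $c_4=12b_R^2$, $c_{32}=c_{34}=d_{52}=d_{54}=3a_R^2$, $d_{42}=d_{44}=36a_R^2$, $c_{35}=4\delta_C^2a_C^2$, $c_{43}=18a_C^2$, $c_{45}=36a_C^2$, $d_{53}=d_{55}=12a_C^2$, $e_1=2\delta_C^2+4\delta_C^2a_C^2C_0$, $e_2=12a_C^2(C_0+1)+4$, $E=\frac{\|u_R\|\|u_C\|}{n^2M}$. **Theorem.** (i) For every $\gamma_{\max}\in(0,1)$ there are $u_R,u_C,\tilde R,\tilde C,\theta_R,\theta_C$ that are admissible for all $\gamma_x,\gamma_y\in(0,\gamma_{\max}]$, with $u_R^Tu_C>0$. (ii) Let $\gamma_x,\gamma_y>0$ and let $(u_R,u_C,\tilde R,\tilde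 C,\theta_R,\theta_C)$ be admissible for $(\gamma_x,\gamma_y)$. Suppose $\alpha_x,\alpha_y\in(0,\frac1r]$, $\bar\lambda\ge M\hat\lambda$ for some $M>0$, and (each bound with a vanishing denominator being void; bounds $a/b$ are read as $b\cdot(\text{left side})\le a$) $$\hat\lambda\le\min\Big\{\tfrac1{6L},\ \tfrac1{6\sqrt{C_0}L},\ \tfrac1{ML},\ \tfrac{\sqrt{d_{42}}}{2\sqrt{e_1c_{32}c_{43}}}\tfrac{\theta_C}L,$$ $$\min\Big\{\tfrac1{2\sqrt{c_2}}\tfrac{\theta_R}{1-\theta_R\gamma_x},\tfrac{\sqrt{c_{32}}}{\sqrt{c_3}},\tfrac{\sqrt{d_{42}}}{\sqrt{c_4}},\tfrac{\sqrt{d_{52}}}{\sqrt{c_5}}\Big\}\tfrac1{\sqrt{96E}\|u_C\|}\tfrac{\gamma_x}L,$$ $$\min\Big\{\tfrac1{2\sqrt{c_2c_{32}}}\tfrac{\theta_R}{1-\theta_R\gamma_x},\tfrac1{\sqrt{c_3}},\tfrac{\sqrt{d_{42}}}{\sqrt{c_4c_{32}}},\tfrac{\sqrt{d_{52}}}{\sqrt{c_5c_{32}}}\Big\}\tfrac{\theta_C\gamma_y}{\sqrt{48e_1}L}\Big\},$$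 $$\gamma_x\le\min\Big\{1,\ \tfrac{\theta_R\alpha_xr\delta}{8\sqrt{C_0d_{42}c_{24}}},\ \tfrac{\sqrt{c_{32}}\alpha_xr\delta}{4\sqrt{C_0d_{42}c_{34}}},\ \tfrac{\alpha_xr\delta}{4\sqrt{C_0d_{44}}},\ \tfrac{\sqrt{d_{52}}\alpha_xr\delta}{4\sqrt{C_0d_{42}d_{54}}},\ \tfrac{\sqrt{M\|u_C\|}}{2\sqrt{\|u_R\|e_1c_{32}}}\theta_C\gamma_y\Big\},$$ $$\gamma_y\le\min\Big\{1,\ \tfrac{\theta_Ce_2d_{52}}{4e_1c_{32}d_{53}},\ \tfrac{\theta_C(\alpha_yr\delta)^2e_1c_{32}}{16C_0e_2d_{52}c_{35}},\ \tfrac{\theta_C(\alpha_yr\delta)^2d_{42}}{16C_0e_2d_{52}c_{45}},\ \tfrac{\alpha_yr\delta}{4\sqrt{C_0d_{55}}}\Big\}.$$ Let $\tilde\rho=\max\{1-\frac12M\hat\lambda\mu,\,1-\frac{\theta_R\gamma_x}{16},\,1-\frac{\theta_C\gamma_y}8,\,1-\frac{\alpha_xr\delta}4,\,1-\frac{\alpha_yr\delta}{16}\}$,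 $c\in(\tilde\rho,1)$, and $s_k^2=c_0c^k$ with $c_0>0$. Then for every $X^0$ the quantities $f(\bar X^k)-f(x^*)$ and $\|\Pi_RX^k\|_R^2$ are integrable for every $k$, and $\mathbb E[f(\bar X^k)-f(x^*)]$ and $\mathbb E\|\Pi_RX^k\|_R^2$ converge to $0$ and are $\mathcal O(c^k)$ as $k\to\infty$. -/

import Mathlib

open MeasureTheory ProbabilityTheory Filter Topology Asymptotics
open scoped NNReal BigOperators

namespace RCPP

noncomputable section

/-! ### Directed graphs and mixing matrices -/

/-- The edge relation of the digraph induced by a nonnegative matrix `B`: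
there is an edge from `i` to `j` iff `B j i > 0`. -/
def inducedEdge {n : ℕ} (B : Matrix (Fin n) (Fin n) ℝ) (i j : Fin n) : Prop := 0 < B j i

/-- `t` is the root of a spanning tree of the digraph with edge relation `E`: every node other
than `t` has a parent along an edge of `E`, and following parents leads from every node to `t`. -/
def IsSpanningTreeRoot {n : ℕ} (E : Fin n → Fin n → Prop) (t : Fin n) : Prop :=
  ∃ parent : Fin n → Fin n,
    (∀ i, i ≠ t → E (parent i) i) ∧ ∀ i, ∃ m : ℕ, parent^[m] i = t

/-- The set of roots of all spanning trees of the digraph induced by `B`. -/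
def rootSet {n : ℕ} (B : Matrix (Fin n) (Fin n) ℝ) : Set (Fin n) :=
  {t | IsSpanningTreeRoot (inducedEdge B) t}

/-- The assumption on the communication network with edge relation `E` and on the mixing
matrices `R` and `C`. -/
structure NetworkAssumption {n : ℕ} (E : Fin n → Fin n → Prop)
    (R C : Matrix (Fin n) (Fin n) ℝ) : Prop where
  stronglyConnected : ∀ i j, Relation.ReflTransGen E i j
  supportR : ∀ i j, inducedEdge R i j → E i j
  supportC : ∀ i j, inducedEdge C i j → E i j
  rowStochastic : R ∈ Matrix.rowStochastic ℝ (Fin n)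
  colStochastic : C ∈ Matrix.colStochastic ℝ (Fin n)
  commonRoot : (rootSet R ∩ rootSet C.transpose).Nonempty

/-! ### Vectors, stacked vectors, norms -/

/-- The decision space `ℝ^p` with its Euclidean norm. -/
abbrev Dec (p : ℕ) := EuclideanSpace ℝ (Fin p)

/-- An `n × p` matrix, given by its rows (one for each agent). -/
abbrev Rows (n p : ℕ) := Fin n → Dec p

/-- The product `A X` of an `n × n` matrix and an `n × p` matrix. -/
def mix {n p : ℕ} (A : Matrix (Fin n) (Fin n) ℝ) (X : Rows n p) : Rows n p :=
  fun i => ∑ j, A i j • X j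

/-- The Euclidean norm of a vector in `ℝ^n`. -/
def vecNorm {n : ℕ} (v : Fin n → ℝ) : ℝ := Real.sqrt (∑ i, v i ^ 2)

/-- The spectral norm of a matrix. -/
def specNorm {n : ℕ} (A : Matrix (Fin n) (Fin n) ℝ) : ℝ :=
  ‖Matrix.toEuclideanCLM (n := Fin n) (𝕜 := ℝ) A‖

/-- The matrix norm induced by the vector norm `v ↦ ‖T v‖`, for an invertible matrix `T`
(substitute `w = T v` in the supremum of `‖T A v‖ / ‖T v‖`). -/
def inducedNorm {n : ℕ} (T A : Matrix (Fin n) (Fin n) ℝ) : ℝ := specNorm (T * A * T⁻¹)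

/-- The square of the norm on `n × p` matrices that belongs to the vector norm `v ↦ ‖T v‖`,
i.e. the squared Frobenius norm of `T X`. -/
def rowsNormSq {n p : ℕ} (T : Matrix (Fin n) (Fin n) ℝ) (X : Rows n p) : ℝ :=
  ∑ i, ‖mix T X i‖ ^ 2

/-- `I - γ (I - A)`. -/
def relaxed {n : ℕ} (A : Matrix (Fin n) (Fin n) ℝ) (γ : ℝ) : Matrix (Fin n) (Fin n) ℝ :=
  1 - γ • (1 - A)

/-- Eigenvectors `u_R, u_C`, the matrices defining the norms `‖·‖_R, ‖·‖_C`, and the contraction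
constants `θ_R, θ_C`. These are bare data; the properties are in `NormData.Admissible`. -/
structure NormData (n : ℕ) where
  uR : Fin n → ℝ
  uC : Fin n → ℝ
  TR : Matrix (Fin n) (Fin n) ℝ
  TC : Matrix (Fin n) (Fin n) ℝ
  θR : ℝ
  θC : ℝ

namespace NormData

variable {n : ℕ}

/-- `Π_R = I - 1 u_Rᵀ / n`. -/
def piR (D : NormData n) : Matrix (Fin n) (Fin n) ℝ :=
  1 - (n : ℝ)⁻¹ • Matrix.vecMulVec (fun _ => 1) D.uR

/-- `Π_C = I - u_C 1ᵀ / n`. -/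
def piC (D : NormData n) : Matrix (Fin n) (Fin n) ℝ :=
  1 - (n : ℝ)⁻¹ • Matrix.vecMulVec D.uC (fun _ => 1)

/-- `u_R` (`u_C`) is a nonnegative left (right) eigenvector of `R` (`C`) for the eigenvalue `1`
with entries adding up to `n`; the norms `‖v‖_R = ‖TR v‖`, `‖v‖_C = ‖TC v‖` dominate the Euclidean
norm; the projections `Π_R`, `Π_C` do not increase them, and `Π_R R_γ`, `Π_C C_γ` contract them
with factors `1 - θ_R γx` and `1 - θ_C γy`. -/
structure Admissible (D : NormData n) (R C : Matrix (Fin n) (Fin n) ℝ) (γx γy : ℝ) : Prop where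
  uR_nonneg : ∀ i, 0 ≤ D.uR i
  uR_eigen : Matrix.vecMul D.uR R = D.uR
  uR_sum : ∑ i, D.uR i = n
  uC_nonneg : ∀ i, 0 ≤ D.uC i
  uC_eigen : Matrix.mulVec C D.uC = D.uC
  uC_sum : ∑ i, D.uC i = n
  TR_unit : IsUnit D.TR
  TC_unit : IsUnit D.TC
  TR_ge : ∀ v : Fin n → ℝ, vecNorm v ≤ vecNorm (Matrix.mulVec D.TR v)
  TC_ge : ∀ v : Fin n → ℝ, vecNorm v ≤ vecNorm (Matrix.mulVec D.TC v)
  θR_pos : 0 < D.θR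
  θR_le : D.θR ≤ 1
  θC_pos : 0 < D.θC
  θC_le : D.θC ≤ 1
  piR_norm : inducedNorm D.TR D.piR ≤ 1
  piC_norm : inducedNorm D.TC D.piC ≤ 1
  contractR : inducedNorm D.TR (D.piR * relaxed R γx) ≤ 1 - D.θR * γx
  contractC : inducedNorm D.TC (D.piC * relaxed C γy) ≤ 1 - D.θC * γy

end NormData

/-! ### Objective functions and compressors -/

/-- The global objective: the average of the local ones. -/
def avgObj {n p : ℕ} (f : Fin n → Dec p → ℝ) (x : Dec p) : ℝ := (n : ℝ)⁻¹ * ∑ i, f i x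

/-- The local gradients are `L i`-Lipschitz, `xs` is a minimizer of the average objective, and the
average objective satisfies the Polyak-Lojasiewicz inequality with constant `μ`. -/
structure ObjectiveAssumption {n p : ℕ} (f : Fin n → Dec p → ℝ) (L : Fin n → ℝ≥0) (μ : ℝ)
    (xs : Dec p) : Prop where
  differentiable : ∀ i, Differentiable ℝ (f i)
  lipschitz : ∀ i, LipschitzWith (L i) (gradient (f i))
  minimizer : ∀ x, avgObj f xs ≤ avgObj f x
  μ_pos : 0 < μ
  pl : ∀ x, 2 * μ * (avgObj f x - avgObj f xs) ≤ ‖gradient (avgObj f) x‖ ^ 2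

/-- A random compression operator `comp ξ : ℝ^p → ℝ^p`, where the seed `ξ` has law `ν`, with
relative error constant `Cc` and absolute error constant `σsq`, whose `r`-scaling is a contraction
with factor `1 - δ` up to the absolute error `σrsq`. -/
structure CompressorAssumption {Ξ : Type*} [MeasurableSpace Ξ] (ν : Measure Ξ) {p : ℕ}
    (comp : Ξ → Dec p → Dec p) (Cc σsq r δ σrsq : ℝ) : Prop where
  measurable : Measurable (Function.uncurry comp)
  Cc_nonneg : 0 ≤ Cc
  σsq_nonneg : 0 ≤ σsq
  r_pos : 0 < r
  δ_pos : 0 < δ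
  δ_le : δ ≤ 1
  σrsq_nonneg : 0 ≤ σrsq
  integrable : ∀ x, Integrable (fun ξ => ‖comp ξ x - x‖ ^ 2) ν
  error : ∀ x, ∫ ξ, ‖comp ξ x - x‖ ^ 2 ∂ν ≤ Cc * ‖x‖ ^ 2 + σsq
  integrable_scaled : ∀ x, Integrable (fun ξ => ‖r⁻¹ • comp ξ x - x‖ ^ 2) ν
  error_scaled : ∀ x, ∫ ξ, ‖r⁻¹ • comp ξ x - x‖ ^ 2 ∂ν ≤ (1 - δ) * ‖x‖ ^ 2 + σrsq

/-! ### The algorithm -/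

/-- Mixing matrices, local step-sizes and scalar parameters of the algorithm. -/
structure Params (n : ℕ) where
  R : Matrix (Fin n) (Fin n) ℝ
  C : Matrix (Fin n) (Fin n) ℝ
  lam : Fin n → ℝ
  αx : ℝ
  αy : ℝ
  γx : ℝ
  γy : ℝ

/-- The variables kept from one iteration to the next. -/
structure State (n p : ℕ) where
  X : Rows n p
  Y : Rows n p
  Hx : Rows n p
  Hy : Rows n p
  HR : Rows n p
  HC : Rows n p

/-- The stacked local gradients. -/
def stackedGrad {n p : ℕ} (f : Fin n → Dec p → ℝ) (X : Rows n p) : Rows n p :=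
  fun i => gradient (f i) (X i)

/-- The dynamically scaled compressor `Q(V) = s · comp (V / s)`, applied row by row; agent `i` uses
the seed `ξ i`. -/
def scaledComp {Ξ : Type*} {n p : ℕ} (comp : Ξ → Dec p → Dec p) (s : ℝ) (ξ : Fin n → Ξ)
    (V : Rows n p) : Rows n p :=
  fun i => s • comp (ξ i) (s⁻¹ • V i)

/-- The local update `X - Λ Y` of the decision variables. -/
def localUpdate {n p : ℕ} (P : Params n) (S : State n p) : Rows n p :=
  fun i => S.X i - P.lam i • S.Y i

/-- One iteration; `ξx` and `ξy` are the seeds of the two compression steps. -/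
def step {Ξ : Type*} {n p : ℕ} (P : Params n) (f : Fin n → Dec p → ℝ)
    (comp : Ξ → Dec p → Dec p) (s : ℝ) (ξx ξy : Fin n → Ξ) (S : State n p) : State n p :=
  let Xt := localUpdate P S
  let Qx := scaledComp comp s ξx (Xt - S.Hx)
  let Xh := S.Hx + Qx
  let XhR := S.HR + mix P.R Qx
  let X' := Xt - P.γx • (Xh - XhR)
  let Yt := S.Y + stackedGrad f X' - stackedGrad f S.X
  let Qy := scaledComp comp s ξy (Yt - S.Hy)
  let Yh := S.Hy + Qy
  let YhC := S.HC + mix P.C Qy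
  { X := X'
    Y := Yt - P.γy • (Yh - YhC)
    Hx := (1 - P.αx) • S.Hx + P.αx • Xh
    Hy := (1 - P.αy) • S.Hy + P.αy • Yh
    HR := (1 - P.αx) • S.HR + P.αx • XhR
    HC := (1 - P.αy) • S.HC + P.αy • YhC }

/-- The iterates started at `X0`; `ξ (k, 0)` and `ξ (k, 1)` are the seeds that the agents use in
the first and in the second compression step of iteration `k`. -/
def iterate {Ξ : Type*} {n p : ℕ} (P : Params n) (f : Fin n → Dec p → ℝ)
    (comp : Ξ → Dec p → Dec p) (s : ℕ → ℝ) (X0 : Rows n p) (ξ : ℕ × Fin 2 → Fin n → Ξ) :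
    ℕ → State n p
  | 0 => { X := X0, Y := stackedGrad f X0, Hx := 0, Hy := 0, HR := 0, HC := 0 }
  | k + 1 => step P f comp (s k) (ξ (k, 0)) (ξ (k, 1)) (iterate P f comp s X0 ξ k)

/-- The seeds are measurable, have law `ν` for each agent, and different compression steps use
independent seeds. -/
structure SeedAssumption {Ω Ξ : Type*} [MeasurableSpace Ω] [MeasurableSpace Ξ] (Pr : Measure Ω)
    (ν : Measure Ξ) {n : ℕ} (ξ : ℕ × Fin 2 → Ω → Fin n → Ξ) : Prop where
  measurable : ∀ j, Measurable (ξ j)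
  law : ∀ j i, Measure.map (fun ω => ξ j ω i) Pr = ν
  indep : iIndepFun ξ Pr

/-- The weighted average `u_Rᵀ X / n` of the rows. -/
def wavg {n p : ℕ} (D : NormData n) (X : Rows n p) : Dec p := (n : ℝ)⁻¹ • ∑ i, D.uR i • X i

/-! ### Step-size conditions -/

/-- The largest local step-size. -/
def lamHat {n : ℕ} (P : Params n) : ℝ := ⨆ i, P.lam i

/-- The mean step-size `u_Rᵀ Λ u_C / n`. -/
def lamBar {n : ℕ} (D : NormData n) (P : Params n) : ℝ :=
  (n : ℝ)⁻¹ * ∑ i, D.uR i * P.lam i * D.uC i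

/-- The largest of the Lipschitz constants. -/
def Lmax {n : ℕ} (L : Fin n → ℝ≥0) : ℝ := ⨆ i, (L i : ℝ)

namespace NormData

variable {n : ℕ} (D : NormData n)

/-- The least constant with `‖v‖_R ≤ δ_R ‖v‖` for all `v`. -/
def δR : ℝ := specNorm D.TR
/-- The least constant with `‖v‖_C ≤ δ_C ‖v‖` for all `v`. -/
def δC : ℝ := specNorm D.TC
/-- `‖I - R‖_R`. -/
def aR (P : Params n) : ℝ := inducedNorm D.TR (1 - P.R)
/-- `‖I - C‖_C`. -/
def aC (P : Params n) : ℝ := inducedNorm D.TC (1 - P.C)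
/-- `‖R_γ‖_R`. -/
def bR (P : Params n) : ℝ := inducedNorm D.TR (relaxed P.R P.γx)

def c2 : ℝ := D.δR ^ 2
def c24 (P : Params n) : ℝ := 2 * D.δR ^ 2 * D.aR P ^ 2
def c3 (P : Params n) : ℝ := 3 * D.bR P ^ 2
def c32 (P : Params n) : ℝ := 3 * D.aR P ^ 2
def c34 (P : Params n) : ℝ := 3 * D.aR P ^ 2
def c35 (P : Params n) : ℝ := 4 * D.δC ^ 2 * D.aC P ^ 2
def c4 (P : Params n) : ℝ := 12 * D.bR P ^ 2
def c43 (P : Params n) : ℝ := 18 * D.aC P ^ 2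
def c45 (P : Params n) : ℝ := 36 * D.aC P ^ 2
def c5 (P : Params n) : ℝ := 3 * D.bR P ^ 2
def d1 : ℝ := 2 * D.δC ^ 2
def d2 (P : Params n) : ℝ := 4 * D.δC ^ 2 * D.aC P ^ 2
def d3 (P : Params n) : ℝ := 12 * D.aC P ^ 2
def d42 (P : Params n) : ℝ := 36 * D.aR P ^ 2
def d44 (P : Params n) : ℝ := 36 * D.aR P ^ 2
def d52 (P : Params n) : ℝ := 3 * D.aR P ^ 2
def d53 (P : Params n) : ℝ := 12 * D.aC P ^ 2
def d54 (P : Params n) : ℝ := 3 * D.aR P ^ 2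
def d55 (P : Params n) : ℝ := 12 * D.aC P ^ 2
def e1 (P : Params n) (Cc : ℝ) : ℝ := D.d1 + D.d2 P * Cc
def e2 (P : Params n) (Cc : ℝ) : ℝ := D.d3 P * (Cc + 1) + 4
/-- `‖u_R‖ ‖u_C‖ / (n² M)`. -/
def eE (M : ℝ) : ℝ := vecNorm D.uR * vecNorm D.uC / ((n : ℝ) ^ 2 * M)

end NormData

/-- The upper bounds on the largest step-size. Each bound `lamHat ≤ a / b` is written as
`b * lamHat ≤ a`, so that a vanishing denominator means that there is no restriction. -/
structure StepSizeBound {n : ℕ} (D : NormData n) (P : Params n) (L M Cc : ℝ) : Prop where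
  b1 : 6 * L * lamHat P ≤ 1
  b2 : 6 * √Cc * L * lamHat P ≤ 1
  b3 : M * L * lamHat P ≤ 1
  b4 : 2 * √(D.e1 P Cc * D.c32 P * D.c43 P) * L * lamHat P ≤ √(D.d42 P) * D.θC
  b5a : 2 * √D.c2 * (1 - D.θR * P.γx) * (√(96 * D.eE M) * vecNorm D.uC * L) * lamHat P
    ≤ D.θR * P.γx
  b5b : √(D.c3 P) * (√(96 * D.eE M) * vecNorm D.uC * L) * lamHat P ≤ √(D.c32 P) * P.γx
  b5c : √(D.c4 P) * (√(96 * D.eE M) * vecNorm D.uC * L) * lamHat P ≤ √(D.d42 P) * P.γx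
  b5d : √(D.c5 P) * (√(96 * D.eE M) * vecNorm D.uC * L) * lamHat P ≤ √(D.d52 P) * P.γx
  b6a : 2 * √(D.c2 * D.c32 P) * (1 - D.θR * P.γx) * (√(48 * D.e1 P Cc) * L) * lamHat P
    ≤ D.θR * (D.θC * P.γy)
  b6b : √(D.c3 P) * (√(48 * D.e1 P Cc) * L) * lamHat P ≤ D.θC * P.γy
  b6c : √(D.c4 P * D.c32 P) * (√(48 * D.e1 P Cc) * L) * lamHat P
    ≤ √(D.d42 P) * (D.θC * P.γy)
  b6d : √(D.c5 P * D.c32 P) * (√(48 * D.e1 P Cc) * L) * lamHat P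
    ≤ √(D.d52 P) * (D.θC * P.γy)

/-- The upper bounds on `γx`, with denominators cleared. -/
structure GammaXBound {n : ℕ} (D : NormData n) (P : Params n) (M Cc r δ : ℝ) : Prop where
  b1 : P.γx ≤ 1
  b2 : 8 * √(Cc * D.d42 P * D.c24 P) * P.γx ≤ D.θR * (P.αx * r * δ)
  b3 : 4 * √(Cc * D.d42 P * D.c34 P) * P.γx ≤ √(D.c32 P) * (P.αx * r * δ)
  b4 : 4 * √(Cc * D.d44 P) * P.γx ≤ P.αx * r * δ
  b5 : 4 * √(Cc * D.d42 P * D.d54 P) * P.γx ≤ √(D.d52 P) * (P.αx * r * δ)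
  b6 : 2 * √(vecNorm D.uR * D.e1 P Cc * D.c32 P) * P.γx
    ≤ √(M * vecNorm D.uC) * D.θC * P.γy

/-- The upper bounds on `γy`, with denominators cleared. -/
structure GammaYBound {n : ℕ} (D : NormData n) (P : Params n) (Cc r δ : ℝ) : Prop where
  b1 : P.γy ≤ 1
  b2 : 4 * D.e1 P Cc * D.c32 P * D.d53 P * P.γy ≤ D.θC * D.e2 P Cc * D.d52 P
  b3 : 16 * Cc * D.e2 P Cc * D.d52 P * D.c35 P * P.γy
    ≤ D.θC * (P.αy * r * δ) ^ 2 * D.e1 P Cc * D.c32 P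
  b4 : 16 * Cc * D.e2 P Cc * D.d52 P * D.c45 P * P.γy
    ≤ D.θC * (P.αy * r * δ) ^ 2 * D.d42 P
  b5 : 4 * √(Cc * D.d55 P) * P.γy ≤ P.αy * r * δ

/-- The lower bound `ρ̃` on the admissible rates. -/
def rhoTilde {n : ℕ} (D : NormData n) (P : Params n) (M μ r δ : ℝ) : ℝ :=
  max (1 - M * lamHat P * μ / 2) <| max (1 - D.θR * P.γx / 16) <|
    max (1 - D.θC * P.γy / 8) <| max (1 - P.αx * r * δ / 4) (1 - P.αy * r * δ / 16)

end

end RCPP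

/-!
Part (i), the existence of admissible norms. Since some node is the root of a spanning tree, a lazy
random walk with transition matrix `R_γ`, `γ = γmax`, visits that node with positive probability at
all late times. By Doeblin's argument (`osc_mulVec_le`) the powers of `R_γ` converge to
`1 u_Rᵀ / n`, so some power of `Π_R R_γ` halves the Euclidean norm (`mixing_of_root`). A weighted sum
of squared norms of the first powers is the square of a norm for which `Π_R R_γ` contracts and `Π_R`
does not expand (`exists_adapted_norm`). For smaller `γ`, the matrix `R_γ` is a convex combination of
the identity and `R_γmax` (`exists_norm_relaxed`). The norm for `C` comes from the transpose, and
`u_Rᵀ u_C > 0` since both stationary vectors charge the common root.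

Part (ii), linear convergence. Five quantities are followed: the optimality gap at the weighted
average, the consensus error `‖Π_R X‖_R²`, the gradient tracking error `‖Π_C Y‖_C²`, and the two
compression errors `‖X̃ - H_x‖²`, `‖Y - H_y‖²`. Because `H_R = R H_x`, `H_C = C H_y` and
`∑ Y_i = ∑ ∇f_i(X_i)` at all times (`State.Consistent`), an iteration is an exact mixing step
perturbed by the compression errors (`State.Consistent.nextX_eq`, `State.Consistent.nextY_eq`), and
the weighted average makes an inexact gradient step whose direction is off by the consensus and the
tracking error (`gap_step`). This bounds each quantity by the others; in the bounds only the
displacement `‖X⁺ - X‖²`, the norm `‖Y‖²` of the trackers and the compression errors couple them.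

A weighted sum of the five quantities, `lyap`, then decreases by the factor `ρ̃` (`Regime.lyap_step`)
along every trajectory, up to the amounts by which the compression errors exceed their bounds in
mean. The scalar inequality behind this is `Rates.Valid.lyapunov_step`, with the smallness
conditions collected in `Rates.Valid`. They follow from the step-size bounds (`exists_rates_valid`)
once two things are known that the bounds do not say: the contraction rates are at most the norms of
the mixing steps, which needs at least two agents (`NormData.Admissible.θR_le_aR`), and the norm
equivalence constants are at least `‖u_R‖ / √n`, `‖u_C‖ / √n`, because an oblique projection is
nonexpansive for the norm (`vecNorm_mul_le_specNorm`).

The state at the beginning of an iteration is a function of the earlier seeds and therefore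
independent of the fresh ones, so that the excesses have means at most of the order of `s_k²`
(`integral_excess_le`). Integrability needs no separate argument, since the pathwise bound dominates
the Lyapunov function by integrable functions. Hence
`E V_{k+1} ≤ ρ̃ E V_k + K c^k`, which gives `E V_k = O(c^k)` because `ρ̃ < c`
(`le_geometric_of_recursion`). With a single agent `Π_R = 0`, and the step-size bounds force constant
gradients (`Lmax_eq_zero_of_one_agent`), so that the consensus error and the gap vanish.
-/

namespace RCPP

/-! ### Euclidean, induced and Frobenius norms -/

section Norms

variable {n p : ℕ}

lemma vecNorm_eq_norm (v : Fin n → ℝ) : vecNorm v = ‖WithLp.toLp 2 v‖ := by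
  simp [vecNorm, EuclideanSpace.norm_eq]

lemma vecNorm_nonneg (v : Fin n → ℝ) : 0 ≤ vecNorm v := Real.sqrt_nonneg _

lemma vecNorm_sq (v : Fin n → ℝ) : vecNorm v ^ 2 = ∑ i, v i ^ 2 :=
  Real.sq_sqrt (Finset.sum_nonneg fun _ _ => sq_nonneg _)

lemma vecNorm_add_le (v w : Fin n → ℝ) : vecNorm (v + w) ≤ vecNorm v + vecNorm w := by
  simp only [vecNorm_eq_norm, WithLp.toLp_add]
  exact norm_add_le _ _

lemma vecNorm_smul (c : ℝ) (v : Fin n → ℝ) : vecNorm (c • v) = |c| * vecNorm v := by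
  simp only [vecNorm_eq_norm, WithLp.toLp_smul, norm_smul, Real.norm_eq_abs]

lemma vecNorm_pos {v : Fin n → ℝ} (hv : v ≠ 0) : 0 < vecNorm v := by
  rw [vecNorm_eq_norm, norm_pos_iff]
  simpa using hv

lemma specNorm_nonneg (A : Matrix (Fin n) (Fin n) ℝ) : 0 ≤ specNorm A := norm_nonneg _

lemma inducedNorm_nonneg (T A : Matrix (Fin n) (Fin n) ℝ) : 0 ≤ inducedNorm T A :=
  specNorm_nonneg _

lemma vecNorm_mulVec_le (A : Matrix (Fin n) (Fin n) ℝ) (v : Fin n → ℝ) :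
    vecNorm (A.mulVec v) ≤ specNorm A * vecNorm v := by
  have h := (Matrix.toEuclideanCLM (n := Fin n) (𝕜 := ℝ) A).le_opNorm (WithLp.toLp 2 v)
  rw [Matrix.toEuclideanCLM_toLp] at h
  rw [vecNorm_eq_norm, vecNorm_eq_norm]
  exact h

lemma specNorm_le {A : Matrix (Fin n) (Fin n) ℝ} {c : ℝ} (hc : 0 ≤ c)
    (h : ∀ v, vecNorm (A.mulVec v) ≤ c * vecNorm v) : specNorm A ≤ c := by
  refine ContinuousLinearMap.opNorm_le_bound _ hc fun x => ?_
  have := h (WithLp.ofLp x)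
  rw [vecNorm_eq_norm, vecNorm_eq_norm, ← Matrix.toEuclideanCLM_toLp] at this
  exact this

lemma vecNorm_mulVec_le_inducedNorm {T : Matrix (Fin n) (Fin n) ℝ} (hT : IsUnit T)
    (A : Matrix (Fin n) (Fin n) ℝ) (v : Fin n → ℝ) :
    vecNorm (T.mulVec (A.mulVec v)) ≤ inducedNorm T A * vecNorm (T.mulVec v) := by
  have h := vecNorm_mulVec_le (T * A * T⁻¹) (T.mulVec v)
  rwa [Matrix.mulVec_mulVec, Matrix.mul_assoc, Matrix.nonsing_inv_mul _
    ((Matrix.isUnit_iff_isUnit_det T).1 hT), Matrix.mul_one, ← Matrix.mulVec_mulVec] at h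

lemma inducedNorm_le {T A : Matrix (Fin n) (Fin n) ℝ} (hT : IsUnit T) {c : ℝ} (hc : 0 ≤ c)
    (h : ∀ v, vecNorm (T.mulVec (A.mulVec v)) ≤ c * vecNorm (T.mulVec v)) :
    inducedNorm T A ≤ c := by
  refine specNorm_le hc fun v => ?_
  have hdet := (Matrix.isUnit_iff_isUnit_det T).1 hT
  have := h (T⁻¹.mulVec v)
  rw [Matrix.mulVec_mulVec v T, Matrix.mul_nonsing_inv _ hdet, Matrix.one_mulVec] at this
  rwa [← Matrix.mulVec_mulVec, ← Matrix.mulVec_mulVec]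

/-- The Frobenius norm of an `n × p` matrix. -/
noncomputable def frob (X : Rows n p) : ℝ := √(∑ i, ‖X i‖ ^ 2)

lemma frob_eq_norm (X : Rows n p) : frob X = ‖WithLp.toLp 2 X‖ := by
  simp [frob, PiLp.norm_eq_of_L2]

lemma frob_nonneg (X : Rows n p) : 0 ≤ frob X := Real.sqrt_nonneg _

lemma frob_sq (X : Rows n p) : frob X ^ 2 = ∑ i, ‖X i‖ ^ 2 :=
  Real.sq_sqrt (Finset.sum_nonneg fun _ _ => sq_nonneg _)

lemma frob_add_le (X Y : Rows n p) : frob (X + Y) ≤ frob X + frob Y := by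
  simp only [frob_eq_norm, WithLp.toLp_add]
  exact norm_add_le _ _

lemma frob_neg (X : Rows n p) : frob (-X) = frob X := by
  simp [frob]

lemma frob_sub_le (X Y : Rows n p) : frob (X - Y) ≤ frob X + frob Y := by
  rw [sub_eq_add_neg, ← frob_neg Y]
  exact frob_add_le _ _

lemma frob_smul (c : ℝ) (X : Rows n p) : frob (c • X) = |c| * frob X := by
  simp only [frob_eq_norm, WithLp.toLp_smul, norm_smul, Real.norm_eq_abs]

lemma frob_mono {X Y : Rows n p} (h : ∀ i, ‖X i‖ ≤ ‖Y i‖) : frob X ≤ frob Y :=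
  Real.sqrt_le_sqrt (Finset.sum_le_sum fun i _ => by gcongr; exact h i)

lemma frob_le_mul {X Y : Rows n p} {c : ℝ} (hc : 0 ≤ c) (h : ∀ i, ‖X i‖ ≤ c * ‖Y i‖) :
    frob X ≤ c * frob Y := by
  rw [← abs_of_nonneg hc, ← frob_smul]
  refine frob_mono fun i => ?_
  simpa [norm_smul, abs_of_nonneg hc] using h i

lemma rowsNormSq_eq (T : Matrix (Fin n) (Fin n) ℝ) (X : Rows n p) :
    rowsNormSq T X = frob (mix T X) ^ 2 := (frob_sq _).symm

lemma mix_add (A : Matrix (Fin n) (Fin n) ℝ) (X Y : Rows n p) :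
    mix A (X + Y) = mix A X + mix A Y := by
  funext i
  simp [mix, Finset.sum_add_distrib]

lemma mix_sub (A : Matrix (Fin n) (Fin n) ℝ) (X Y : Rows n p) :
    mix A (X - Y) = mix A X - mix A Y := by
  funext i
  simp [mix, smul_sub]

lemma mix_smul (A : Matrix (Fin n) (Fin n) ℝ) (c : ℝ) (X : Rows n p) :
    mix A (c • X) = c • mix A X := by
  funext i
  simp [mix, Finset.smul_sum, smul_comm c]

lemma mix_zero (A : Matrix (Fin n) (Fin n) ℝ) : mix A (0 : Rows n p) = 0 := by
  funext i
  simp [mix]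

lemma sub_mix (A B : Matrix (Fin n) (Fin n) ℝ) (X : Rows n p) :
    mix (A - B) X = mix A X - mix B X := by
  funext i
  simp [mix, sub_smul]

lemma smul_mix (c : ℝ) (A : Matrix (Fin n) (Fin n) ℝ) (X : Rows n p) :
    mix (c • A) X = c • mix A X := by
  funext i
  simp [mix, Finset.smul_sum, smul_smul]

lemma one_mix (X : Rows n p) : mix 1 X = X := by
  funext i
  simp [mix, Matrix.one_apply]

lemma mul_mix (A B : Matrix (Fin n) (Fin n) ℝ) (X : Rows n p) :
    mix (A * B) X = mix A (mix B X) := by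
  funext i
  simp only [mix, Matrix.mul_apply, Finset.sum_smul, Finset.smul_sum, smul_smul]
  exact Finset.sum_comm

/-- Bounds between norms of vectors carry over to `n × p` matrices, column by column. -/
lemma frob_mix_le_of_vecNorm_le {A B : Matrix (Fin n) (Fin n) ℝ} {c : ℝ} (hc : 0 ≤ c)
    (h : ∀ v, vecNorm (A.mulVec v) ≤ c * vecNorm (B.mulVec v)) (X : Rows n p) :
    frob (mix A X) ≤ c * frob (mix B X) := by
  have key : ∀ A : Matrix (Fin n) (Fin n) ℝ,
      frob (mix A X) ^ 2 = ∑ j, vecNorm (A.mulVec fun k => X k j) ^ 2 := by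
    intro A
    simp only [frob_sq, vecNorm_sq, EuclideanSpace.norm_sq_eq, Real.norm_eq_abs, sq_abs]
    rw [Finset.sum_comm]
    refine Finset.sum_congr rfl fun j _ => Finset.sum_congr rfl fun i _ => ?_
    simp [mix, Matrix.mulVec, dotProduct]
  refine le_of_sq_le_sq ?_ (mul_nonneg hc (frob_nonneg _))
  rw [mul_pow, key, key, Finset.mul_sum]
  refine Finset.sum_le_sum fun j _ => ?_
  rw [← mul_pow]
  exact pow_le_pow_left₀ (vecNorm_nonneg _) (h _) 2

lemma frob_mix_le (A : Matrix (Fin n) (Fin n) ℝ) (X : Rows n p) :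
    frob (mix A X) ≤ specNorm A * frob X := by
  have := frob_mix_le_of_vecNorm_le (B := 1) (specNorm_nonneg A)
    (fun v => by simpa using vecNorm_mulVec_le A v) X
  rwa [one_mix] at this

lemma frob_mix_mix_le {T : Matrix (Fin n) (Fin n) ℝ} (hT : IsUnit T)
    (A : Matrix (Fin n) (Fin n) ℝ) (X : Rows n p) :
    frob (mix T (mix A X)) ≤ inducedNorm T A * frob (mix T X) := by
  rw [← mul_mix]
  refine frob_mix_le_of_vecNorm_le (inducedNorm_nonneg _ _) (fun v => ?_) X
  rw [← Matrix.mulVec_mulVec]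
  exact vecNorm_mulVec_le_inducedNorm hT A v

lemma frob_le_frob_mix {T : Matrix (Fin n) (Fin n) ℝ}
    (hT : ∀ v, vecNorm v ≤ vecNorm (T.mulVec v)) (X : Rows n p) : frob X ≤ frob (mix T X) := by
  have := frob_mix_le_of_vecNorm_le (A := 1) (B := T) zero_le_one
    (fun v => by simpa using hT v) X
  rwa [one_mix, one_mul] at this

end Norms

/-! ### Norms adapted to a convergent matrix -/

section AdaptedNorm

variable {n : ℕ}

lemma specNorm_transpose (A : Matrix (Fin n) (Fin n) ℝ) : specNorm A.transpose = specNorm A := by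
  have : Matrix.toEuclideanCLM (n := Fin n) (𝕜 := ℝ) A.transpose =
      star (Matrix.toEuclideanCLM (n := Fin n) (𝕜 := ℝ) A) := by
    rw [← map_star]
    congr 1
  rw [specNorm, this, ContinuousLinearMap.star_eq_adjoint, LinearIsometryEquiv.norm_map, specNorm]

lemma vecNorm_mulVec_sq (T : Matrix (Fin n) (Fin n) ℝ) (v : Fin n → ℝ) :
    vecNorm (T.mulVec v) ^ 2 = v ⬝ᵥ (T.transpose * T).mulVec v := by
  rw [← Matrix.mulVec_mulVec, Matrix.dotProduct_mulVec, Matrix.vecMul_transpose, vecNorm_sq]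
  simp [dotProduct, sq]

/-- A finite sum of squared seminorms `v ↦ ‖S i v‖²` is the square of a single `v ↦ ‖T v‖`. -/
lemma exists_vecNorm_sq_eq_sum {ι : Type*} (s : Finset ι)
    (S : ι → Matrix (Fin n) (Fin n) ℝ) :
    ∃ T : Matrix (Fin n) (Fin n) ℝ,
      ∀ v, vecNorm (T.mulVec v) ^ 2 = ∑ i ∈ s, vecNorm ((S i).mulVec v) ^ 2 := by
  have hpsd : (∑ i ∈ s, (S i).conjTranspose * S i).PosSemidef :=
    Matrix.posSemidef_sum s fun i _ => Matrix.posSemidef_conjTranspose_mul_self _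
  obtain ⟨T, hT⟩ : ∃ T : Matrix (Fin n) (Fin n) ℝ,
      (∑ i ∈ s, (S i).conjTranspose * S i) = T.conjTranspose * T := by
    open scoped MatrixOrder in
    exact CStarAlgebra.nonneg_iff_eq_star_mul_self.1 hpsd.nonneg
  refine ⟨T, fun v => ?_⟩
  simp only [Matrix.conjTranspose_eq_transpose_of_trivial] at hT
  rw [vecNorm_mulVec_sq, ← hT, Matrix.sum_mulVec, dotProduct_sum]
  simp only [vecNorm_mulVec_sq]

/-- If `W` commutes with the projection `Q`, vanishes on its kernel, and some power of `W` halves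
the Euclidean norm, then `Q` is nonexpansive and `W` is a contraction in a norm `v ↦ ‖T v‖`. With
`q < 1` such that `q ^ m ≥ 1 / 4`, the norm is given by
`‖T v‖² = 2 (‖(1 - Q) v‖² + ∑ k < m, q⁻ᵏ ‖W ^ k Q v‖²)`. -/
lemma exists_adapted_norm {Q W : Matrix (Fin n) (Fin n) ℝ} (hQ : Q * Q = Q) (hQW : Q * W = W)
    (hWQ : W * Q = W) {m : ℕ} (hm : 0 < m) (hW : specNorm (W ^ m) ≤ 1 / 2) :
    ∃ (T : Matrix (Fin n) (Fin n) ℝ) (ε : ℝ), IsUnit T ∧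
      (∀ v, vecNorm v ≤ vecNorm (T.mulVec v)) ∧ inducedNorm T Q ≤ 1 ∧
      0 < ε ∧ ε ≤ 1 ∧ inducedNorm T W ≤ 1 - ε := by
  have hm' : (1 : ℝ) ≤ m := by exact_mod_cast hm
  -- Bernoulli's inequality gives `q ^ m ≥ 1 / 4`
  set q : ℝ := 1 - 3 / (4 * m) with hq
  have hfrac : 3 / (4 * (m : ℝ)) ≤ 3 / 4 := by
    rw [div_le_div_iff₀ (by positivity) (by norm_num)]
    linarith
  have hq0 : 0 < q := by rw [hq]; linarith
  have hq1 : q < 1 := by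
    have : 0 < 3 / (4 * (m : ℝ)) := by positivity
    rw [hq]; linarith
  have hqm : 1 / 4 ≤ q ^ m := by
    have h := one_add_mul_le_pow (a := -(3 / (4 * (m : ℝ)))) (by linarith) m
    have h2 : 1 + (m : ℝ) * -(3 / (4 * (m : ℝ))) = 1 / 4 := by field_simp; norm_num
    rw [h2] at h
    simpa [hq, sub_eq_add_neg] using h
  obtain ⟨T₁, hT₁⟩ := exists_vecNorm_sq_eq_sum (Finset.range m)
    (fun k => √((q ^ k)⁻¹) • (W ^ k * Q))
  obtain ⟨T, hT⟩ := exists_vecNorm_sq_eq_sum (Finset.univ : Finset (Fin 2))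
    ![√2 • (1 - Q), √2 • T₁]
  replace hT₁ : ∀ v, vecNorm (T₁.mulVec v) ^ 2 =
      ∑ k ∈ Finset.range m, (q ^ k)⁻¹ * vecNorm ((W ^ k).mulVec (Q.mulVec v)) ^ 2 := by
    intro v
    rw [hT₁]
    refine Finset.sum_congr rfl fun k _ => ?_
    rw [Matrix.smul_mulVec, vecNorm_smul, mul_pow, sq_abs, Real.sq_sqrt (by positivity),
      Matrix.mulVec_mulVec]
  replace hT : ∀ v, vecNorm (T.mulVec v) ^ 2 =
      2 * (vecNorm ((1 - Q).mulVec v) ^ 2 + vecNorm (T₁.mulVec v) ^ 2) := by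
    intro v
    rw [hT]
    simp [Fin.sum_univ_two, Matrix.smul_mulVec, vecNorm_smul, mul_pow]
    ring
  have hQQ : ∀ v, Q.mulVec (Q.mulVec v) = Q.mulVec v := fun v => by
    rw [Matrix.mulVec_mulVec, hQ]
  have hT₁Q : ∀ v, vecNorm (T₁.mulVec (Q.mulVec v)) ^ 2 = vecNorm (T₁.mulVec v) ^ 2 := by
    intro v
    rw [hT₁, hT₁]
    simp only [hQQ]
  have hQ0 : ∀ v, (1 - Q).mulVec (Q.mulVec v) = 0 := by
    intro v
    rw [Matrix.mulVec_mulVec, Matrix.sub_mul, hQ, Matrix.one_mul, sub_self, Matrix.zero_mulVec]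
  have hzero : vecNorm (0 : Fin n → ℝ) = 0 := by simp [vecNorm]
  have hge₁ : ∀ v, vecNorm (Q.mulVec v) ^ 2 ≤ vecNorm (T₁.mulVec v) ^ 2 := by
    intro v
    rw [hT₁]
    have := Finset.single_le_sum (s := Finset.range m)
      (f := fun k => (q ^ k)⁻¹ * vecNorm ((W ^ k).mulVec (Q.mulVec v)) ^ 2)
      (fun k _ => by positivity) (Finset.mem_range.2 hm)
    simpa using this
  have hge : ∀ v, vecNorm v ≤ vecNorm (T.mulVec v) := by
    intro v
    refine le_of_sq_le_sq ?_ (vecNorm_nonneg _)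
    rw [hT]
    have h1 : vecNorm v ≤ vecNorm ((1 - Q).mulVec v) + vecNorm (Q.mulVec v) := by
      have := vecNorm_add_le ((1 - Q).mulVec v) (Q.mulVec v)
      rwa [← Matrix.add_mulVec, sub_add_cancel, Matrix.one_mulVec] at this
    have h2 := hge₁ v
    have h3 := vecNorm_nonneg v
    nlinarith [sq_nonneg (vecNorm ((1 - Q).mulVec v) - vecNorm (Q.mulVec v))]
  have hunit : IsUnit T := by
    rw [← Matrix.mulVec_injective_iff_isUnit]
    intro v w hvw
    by_contra hne
    have h1 := hge (v - w)
    rw [Matrix.mulVec_sub, show T.mulVec v = T.mulVec w from hvw, sub_self, hzero] at h1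
    exact absurd h1 (not_le.2 (vecNorm_pos (sub_ne_zero.2 hne)))
  have hQle : inducedNorm T Q ≤ 1 := by
    refine inducedNorm_le hunit zero_le_one fun v => ?_
    rw [one_mul]
    refine le_of_sq_le_sq ?_ (vecNorm_nonneg _)
    rw [hT, hT, hQ0, hT₁Q, hzero]
    have := sq_nonneg (vecNorm ((1 - Q).mulVec v))
    linarith
  have hWle : inducedNorm T W ≤ √q := by
    refine inducedNorm_le hunit (Real.sqrt_nonneg _) fun v => ?_
    refine le_of_sq_le_sq ?_ (mul_nonneg (Real.sqrt_nonneg _) (vecNorm_nonneg _))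
    rw [mul_pow, Real.sq_sqrt hq0.le, hT, hT]
    have hW0 : (1 - Q).mulVec (W.mulVec v) = 0 := by
      rw [Matrix.mulVec_mulVec, Matrix.sub_mul, hQW, Matrix.one_mul, sub_self, Matrix.zero_mulVec]
    have hWv : Q.mulVec (W.mulVec v) = W.mulVec (Q.mulVec v) := by
      rw [Matrix.mulVec_mulVec, Matrix.mulVec_mulVec, hQW, hWQ]
    set a : ℕ → ℝ := fun k => vecNorm ((W ^ k).mulVec (Q.mulVec v)) ^ 2 with ha
    have hsucc : ∀ k, vecNorm ((W ^ k).mulVec (Q.mulVec (W.mulVec v))) ^ 2 = a (k + 1) := by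
      intro k
      rw [hWv, Matrix.mulVec_mulVec _ (W ^ k) W, ← pow_succ]
    have hlast : (q ^ m)⁻¹ * a m ≤ a 0 := by
      have h1 : vecNorm ((W ^ m).mulVec (Q.mulVec v)) ≤ 1 / 2 * vecNorm (Q.mulVec v) :=
        (vecNorm_mulVec_le _ _).trans (by gcongr; exact vecNorm_nonneg _)
      have h2 : a m ≤ 1 / 4 * a 0 := by
        simp only [ha, pow_zero, Matrix.one_mulVec]
        calc _ ≤ (1 / 2 * vecNorm (Q.mulVec v)) ^ 2 :=
              pow_le_pow_left₀ (vecNorm_nonneg _) h1 2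
          _ = _ := by ring
      have h0 : 0 ≤ a 0 := sq_nonneg _
      rw [inv_mul_le_iff₀ (by positivity)]
      nlinarith
    have hshift : ∑ k ∈ Finset.range m, (q ^ k)⁻¹ * a (k + 1) =
        q * (∑ k ∈ Finset.range m, (q ^ k)⁻¹ * a k + (q ^ m)⁻¹ * a m - a 0) := by
      have h1 := Finset.sum_range_succ (fun k => (q ^ k)⁻¹ * a k) m
      rw [Finset.sum_range_succ'] at h1
      simp only [pow_zero, inv_one, one_mul] at h1
      rw [← h1, add_sub_cancel_right, Finset.mul_sum]
      refine Finset.sum_congr rfl fun k _ => ?_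
      rw [pow_succ]
      field_simp
    rw [hW0, hzero, hT₁, hT₁]
    simp only [hsucc]
    rw [hshift]
    have h3 := sq_nonneg (vecNorm ((1 - Q).mulVec v))
    change 2 * (0 ^ 2 + q * (_ + _ - _)) ≤ q * (2 * (_ + ∑ k ∈ Finset.range m, (q ^ k)⁻¹ * a k))
    nlinarith
  refine ⟨T, 1 - √q, hunit, hge, hQle, ?_, ?_, by linarith⟩
  · have : √q < 1 := by rw [Real.sqrt_lt' one_pos]; linarith
    linarith
  · linarith [Real.sqrt_nonneg q]

end AdaptedNorm

/-! ### Lazy random walks with a root -/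

section Mixing

variable {n : ℕ}

lemma relaxed_apply (R : Matrix (Fin n) (Fin n) ℝ) (γ : ℝ) (i j : Fin n) :
    relaxed R γ i j = (1 - γ) * (1 : Matrix (Fin n) (Fin n) ℝ) i j + γ * R i j := by
  simp [relaxed]
  ring

lemma relaxed_eq (R : Matrix (Fin n) (Fin n) ℝ) (γ : ℝ) :
    relaxed R γ = (1 - γ) • 1 + γ • R := by
  ext i j
  simp [relaxed_apply]

lemma relaxed_mem_rowStochastic {R : Matrix (Fin n) (Fin n) ℝ}
    (hR : R ∈ Matrix.rowStochastic ℝ (Fin n)) {γ : ℝ} (h0 : 0 ≤ γ) (h1 : γ ≤ 1) :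
    relaxed R γ ∈ Matrix.rowStochastic ℝ (Fin n) := by
  rw [relaxed_eq]
  exact Matrix.convex_rowStochastic (one_mem _) hR (by linarith) h0 (by ring)

/-- A lazy random walk started anywhere visits the root of a spanning tree with positive
probability at every sufficiently late time. -/
lemma exists_pow_relaxed_pos {R : Matrix (Fin n) (Fin n) ℝ}
    (hR : R ∈ Matrix.rowStochastic ℝ (Fin n)) {t : Fin n} (ht : t ∈ rootSet R) {γ : ℝ}
    (h0 : 0 < γ) (h1 : γ < 1) : ∃ N, ∀ i, 0 < (relaxed R γ ^ N) i t := by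
  obtain ⟨parent, hedge, hpath⟩ := ht
  have hA := relaxed_mem_rowStochastic hR h0.le h1.le
  have hdiag : ∀ i, 0 < relaxed R γ i i := fun i => by
    have := mul_nonneg h0.le (Matrix.nonneg_of_mem_rowStochastic hR (i := i) (j := i))
    rw [relaxed_apply, Matrix.one_apply_eq]
    linarith
  have hpar : ∀ i, i ≠ t → 0 < relaxed R γ i (parent i) := fun i hi => by
    have h2 : 0 < γ * R i (parent i) := mul_pos h0 (hedge i hi)
    have h3 : 0 ≤ (1 - γ) * (1 : Matrix (Fin n) (Fin n) ℝ) i (parent i) :=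
      mul_nonneg (by linarith) (by rw [Matrix.one_apply]; split_ifs <;> norm_num)
    rw [relaxed_apply]
    linarith
  have hstep : ∀ (k : ℕ) (i j : Fin n), 0 < relaxed R γ i j → 0 < (relaxed R γ ^ k) j t →
      0 < (relaxed R γ ^ (k + 1)) i t := by
    intro k i j hij hjt
    rw [pow_succ', Matrix.mul_apply]
    refine Finset.sum_pos' (fun l _ => mul_nonneg (Matrix.nonneg_of_mem_rowStochastic hA)
      (Matrix.nonneg_of_mem_rowStochastic (pow_mem hA k))) ⟨j, Finset.mem_univ _, mul_pos hij hjt⟩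
  have hroot : ∀ k : ℕ, 0 < (relaxed R γ ^ k) t t := by
    intro k
    induction k with
    | zero => simp
    | succ k ih => exact hstep k t t (hdiag t) ih
  have hall : ∀ (m : ℕ) (i : Fin n), parent^[m] i = t → ∀ k, m ≤ k →
      0 < (relaxed R γ ^ k) i t := by
    intro m
    induction m with
    | zero =>
      intro i hi k _
      rw [show i = t from hi]
      exact hroot k
    | succ m ih =>
      intro i hi k hk
      by_cases hit : i = t
      · rw [hit]
        exact hroot k
      · obtain ⟨k, rfl⟩ : ∃ k', k = k' + 1 := ⟨k - 1, by omega⟩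
        exact hstep k i _ (hpar i hit) (ih _ hi k (by omega))
  choose m hm using hpath
  exact ⟨Finset.univ.sup m, fun i => hall (m i) i (hm i) _ (Finset.le_sup (Finset.mem_univ i))⟩

/-- Doeblin's contraction: a stochastic matrix with a column bounded below by `ε` shrinks the
oscillation of every vector by the factor `1 - ε`. -/
lemma osc_mulVec_le {B : Matrix (Fin n) (Fin n) ℝ} (hB : B ∈ Matrix.rowStochastic ℝ (Fin n))
    {t : Fin n} {ε : ℝ} (hε : ∀ i, ε ≤ B i t) {v : Fin n → ℝ} {c : ℝ}
    (hv : ∀ i j, v i - v j ≤ c) (i j : Fin n) :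
    B.mulVec v i - B.mulVec v j ≤ (1 - ε) * c := by
  have : Nonempty (Fin n) := ⟨t⟩
  obtain ⟨a, ha⟩ := Finite.exists_max v
  obtain ⟨b, hb⟩ := Finite.exists_min v
  have hsum : ∀ i, ∑ k, (B i k - if k = t then ε else 0) = 1 - ε := fun i => by
    rw [Finset.sum_sub_distrib, Matrix.sum_row_of_mem_rowStochastic hB]
    simp
  have hnn : ∀ i k, 0 ≤ B i k - if k = t then ε else 0 := fun i k => by
    split_ifs with h
    · rw [h]; linarith [hε i]
    · rw [sub_zero]; exact Matrix.nonneg_of_mem_rowStochastic hB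
  have hrepr : ∀ i, B.mulVec v i = ε * v t + ∑ k, (B i k - if k = t then ε else 0) * v k := by
    intro i
    simp [Matrix.mulVec, dotProduct, sub_mul, Finset.sum_sub_distrib]
  have hupper : ∑ k, (B i k - if k = t then ε else 0) * v k ≤ (1 - ε) * v a := by
    rw [← hsum i, Finset.sum_mul]
    exact Finset.sum_le_sum fun k _ => mul_le_mul_of_nonneg_left (ha k) (hnn i k)
  have hlower : (1 - ε) * v b ≤ ∑ k, (B j k - if k = t then ε else 0) * v k := by
    rw [← hsum j, Finset.sum_mul]
    exact Finset.sum_le_sum fun k _ => mul_le_mul_of_nonneg_left (hb k) (hnn j k)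
  have hε1 : 0 ≤ 1 - ε := by
    rw [← hsum i]
    exact Finset.sum_nonneg fun k _ => hnn i k
  rw [hrepr, hrepr]
  nlinarith [mul_le_mul_of_nonneg_left (hv a b) hε1]

/-- A stochastic matrix has a nonnegative left eigenvector for the eigenvalue `1`: the entrywise
absolute value of any left eigenvector is one. -/
lemma exists_stationary [NeZero n] {R : Matrix (Fin n) (Fin n) ℝ}
    (hR : R ∈ Matrix.rowStochastic ℝ (Fin n)) :
    ∃ u : Fin n → ℝ, (∀ i, 0 ≤ u i) ∧ Matrix.vecMul u R = u ∧ ∑ i, u i = n := by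
  have hdet : (1 - R).det = 0 := by
    rw [← Matrix.exists_mulVec_eq_zero_iff]
    refine ⟨1, one_ne_zero, ?_⟩
    rw [Matrix.sub_mulVec, Matrix.one_mulVec, Matrix.one_vecMul_of_mem_rowStochastic hR, sub_self]
  obtain ⟨v, hv0, hv⟩ := Matrix.exists_vecMul_eq_zero_iff.2 hdet
  rw [Matrix.vecMul_sub, Matrix.vecMul_one, sub_eq_zero] at hv
  have hle : ∀ j, |v j| ≤ Matrix.vecMul (fun i => |v i|) R j := by
    intro j
    conv_lhs => rw [hv]
    simp only [Matrix.vecMul, dotProduct]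
    refine (Finset.abs_sum_le_sum_abs _ _).trans (le_of_eq ?_)
    refine Finset.sum_congr rfl fun i _ => ?_
    rw [abs_mul, abs_of_nonneg (Matrix.nonneg_of_mem_rowStochastic hR)]
  have hsum : ∑ j, |v j| = ∑ j, Matrix.vecMul (fun i => |v i|) R j := by
    simp only [Matrix.vecMul, dotProduct]
    rw [Finset.sum_comm]
    refine Finset.sum_congr rfl fun i _ => ?_
    rw [← Finset.mul_sum, Matrix.sum_row_of_mem_rowStochastic hR, mul_one]
  have heq : ∀ j, |v j| = Matrix.vecMul (fun i => |v i|) R j := fun j =>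
    (Finset.sum_eq_sum_iff_of_le fun j _ => hle j).1 hsum j (Finset.mem_univ j)
  have hpos : 0 < ∑ j, |v j| := by
    obtain ⟨i, hi⟩ := Function.ne_iff.1 hv0
    exact Finset.sum_pos' (fun j _ => abs_nonneg _) ⟨i, Finset.mem_univ i, abs_pos.2 hi⟩
  refine ⟨((n : ℝ) / ∑ j, |v j|) • fun i => |v i|, fun i => ?_, ?_, ?_⟩
  · simp only [Pi.smul_apply, smul_eq_mul]
    positivity
  · rw [Matrix.smul_vecMul]
    congr 1
    exact (funext heq).symm
  · simp only [Pi.smul_apply, smul_eq_mul, ← Finset.mul_sum]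
    field_simp

/-- The projection `1 - 1 uᵀ / n` annihilating the constant vectors. -/
noncomputable def consensusProj (u : Fin n → ℝ) : Matrix (Fin n) (Fin n) ℝ :=
  1 - (n : ℝ)⁻¹ • Matrix.vecMulVec (fun _ => 1) u

lemma consensusProj_mulVec (u v : Fin n → ℝ) (i : Fin n) :
    (consensusProj u).mulVec v i = v i - (n : ℝ)⁻¹ * ∑ j, u j * v j := by
  simp [consensusProj, Matrix.sub_mulVec, Matrix.smul_mulVec, Matrix.vecMulVec_mulVec, dotProduct]

lemma consensusProj_mul_self [NeZero n] {u : Fin n → ℝ} (hu : ∑ i, u i = n) :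
    consensusProj u * consensusProj u = consensusProj u := by
  have hn : (n : ℝ) ≠ 0 := Nat.cast_ne_zero.2 (NeZero.ne n)
  refine Matrix.ext_of_mulVec_single fun j => ?_
  funext i
  rw [← Matrix.mulVec_mulVec]
  simp only [consensusProj_mulVec, mul_sub, Finset.sum_sub_distrib, ← Finset.sum_mul, hu]
  field_simp
  ring

lemma consensusProj_mul_comm {u : Fin n → ℝ} {A : Matrix (Fin n) (Fin n) ℝ}
    (hA : A ∈ Matrix.rowStochastic ℝ (Fin n)) (hu : Matrix.vecMul u A = u) :
    consensusProj u * A = A * consensusProj u := by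
  have h1 : A.mulVec (fun _ => 1) = fun _ => 1 := Matrix.one_vecMul_of_mem_rowStochastic hA
  rw [consensusProj, Matrix.sub_mul, Matrix.mul_sub, Matrix.one_mul, Matrix.mul_one,
    Matrix.smul_mul, Matrix.mul_smul, Matrix.vecMulVec_mul, Matrix.mul_vecMulVec, hu, h1]

lemma vecMul_relaxed {R : Matrix (Fin n) (Fin n) ℝ} {u : Fin n → ℝ}
    (hu : Matrix.vecMul u R = u) (γ : ℝ) : Matrix.vecMul u (relaxed R γ) = u := by
  rw [relaxed, Matrix.vecMul_sub, Matrix.vecMul_smul, Matrix.vecMul_sub, hu]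
  simp

/-- The powers of a lazy stochastic matrix whose digraph has a root converge to `1 uᵀ / n`, so
that those of `Π A` tend to zero; and the root is charged by the stationary vector `u`. -/
lemma mixing_of_root [NeZero n] {R : Matrix (Fin n) (Fin n) ℝ}
    (hR : R ∈ Matrix.rowStochastic ℝ (Fin n)) {t : Fin n} (ht : t ∈ rootSet R) {γ : ℝ}
    (h0 : 0 < γ) (h1 : γ < 1) {u : Fin n → ℝ} (hu0 : ∀ i, 0 ≤ u i)
    (hu : Matrix.vecMul u R = u) (hun : ∑ i, u i = n) :
    0 < u t ∧ ∃ m : ℕ, 0 < m ∧ specNorm ((consensusProj u * relaxed R γ) ^ m) ≤ 1 / 2 := by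
  have hn : 0 < (n : ℝ) := Nat.cast_pos.2 (Nat.pos_of_ne_zero (NeZero.ne n))
  have hA := relaxed_mem_rowStochastic hR h0.le h1.le
  have huA := vecMul_relaxed hu γ
  set A := relaxed R γ with hAdef
  obtain ⟨N, hN⟩ := exists_pow_relaxed_pos hR ht h0 h1
  have hAN := pow_mem hA N
  have huAk : ∀ k : ℕ, Matrix.vecMul u (A ^ k) = u := by
    intro k
    induction k with
    | zero => simp
    | succ k ih => rw [pow_succ, ← Matrix.vecMul_vecMul, ih, huA]
  have : Nonempty (Fin n) := ⟨t⟩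
  obtain ⟨a, ha⟩ := Finite.exists_min fun i => (A ^ N) i t
  set ε := (A ^ N) a t with hε
  have hεpos : 0 < ε := hN a
  have hε1 : ε ≤ 1 := Matrix.le_one_of_mem_rowStochastic hAN
  constructor
  · have h2 : u t = ∑ i, u i * (A ^ N) i t := by
      conv_lhs => rw [← huAk N]
      rfl
    have h3 : (n : ℝ) * ε ≤ u t := by
      rw [h2, ← hun, Finset.sum_mul]
      exact Finset.sum_le_sum fun i _ => mul_le_mul_of_nonneg_left (ha i) (hu0 i)
    exact lt_of_lt_of_le (mul_pos hn hεpos) h3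
  set Q := consensusProj u with hQdef
  have hcomm : Q * A = A * Q := consensusProj_mul_comm hA huA
  have hidem : Q * Q = Q := consensusProj_mul_self hun
  have hpow : ∀ k : ℕ, Q * A ^ k = A ^ k * Q := fun k =>
    (show Commute Q A from hcomm).pow_right k
  have hW : ∀ k : ℕ, (Q * A) ^ (k + 1) = A ^ (k + 1) * Q := by
    intro k
    rw [(show Commute Q A from hcomm).mul_pow, ← hpow]
    congr 1
    induction k with
    | zero => simp
    | succ k ih => rw [pow_succ, ih, hidem]
  have hosc : ∀ (j : ℕ) (v : Fin n → ℝ) (c : ℝ), (∀ i l, v i - v l ≤ c) →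
      ∀ i l, (A ^ (N * j)).mulVec v i - (A ^ (N * j)).mulVec v l ≤ (1 - ε) ^ j * c := by
    intro j v c hv
    induction j with
    | zero => simpa using hv
    | succ j ih =>
      intro i l
      have := osc_mulVec_le hAN ha ih i l
      rw [Matrix.mulVec_mulVec, ← pow_add] at this
      rw [mul_add, mul_one, add_comm, pow_succ', mul_assoc]
      exact this
  -- a vector annihilated by `u` is bounded by its oscillation
  have hbd : ∀ (w : Fin n → ℝ) (c : ℝ), ∑ j, u j * w j = 0 → (∀ i l, w i - w l ≤ c) →
      ∀ i, |w i| ≤ c := by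
    intro w c hw hc i
    have h2 : (n : ℝ) * w i = ∑ j, u j * (w i - w j) := by
      simp only [mul_sub, Finset.sum_sub_distrib, hw, sub_zero, ← Finset.sum_mul, hun]
    have h3 : (n : ℝ) * w i ≤ n * c := by
      rw [h2, ← hun, Finset.sum_mul]
      exact Finset.sum_le_sum fun j _ => mul_le_mul_of_nonneg_left (hc i j) (hu0 j)
    have h4 : -(n * c) ≤ (n : ℝ) * w i := by
      rw [h2, ← hun, Finset.sum_mul, ← Finset.sum_neg_distrib]
      refine Finset.sum_le_sum fun j _ => ?_
      have := mul_le_mul_of_nonneg_left (hc j i) (hu0 j)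
      linarith
    rw [abs_le]
    exact ⟨by nlinarith, le_of_mul_le_mul_left h3 hn⟩
  set K := (n : ℝ) * (2 * specNorm Q) with hK
  have hK0 : 0 ≤ K := by have := specNorm_nonneg Q; positivity
  obtain ⟨j, hj⟩ := exists_pow_lt_of_lt_one (show 0 < 1 / (2 * (K + 1)) by positivity)
    (show 1 - ε < 1 by linarith)
  have hj' : (1 - ε) ^ (j + 1) * K ≤ 1 / 2 := by
    have h2 : (1 - ε) ^ (j + 1) ≤ 1 / (2 * (K + 1)) :=
      (pow_le_pow_of_le_one (by linarith) (by linarith) (Nat.le_succ j)).trans hj.le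
    calc _ ≤ 1 / (2 * (K + 1)) * K := by gcongr
      _ ≤ 1 / 2 := by
        rw [div_mul_eq_mul_div, div_le_div_iff₀ (by positivity) (by norm_num)]
        linarith
  -- one extra factor keeps the exponent positive
  refine ⟨N * (j + 1) + 1, Nat.succ_pos _, ?_⟩
  refine specNorm_le (by norm_num) fun v => ?_
  rw [hW, pow_succ', mul_assoc, ← Matrix.mulVec_mulVec, ← Matrix.mulVec_mulVec]
  set c := 2 * specNorm Q * vecNorm v with hc
  have habs : ∀ (w : Fin n → ℝ) i, |w i| ≤ vecNorm w := by
    intro w i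
    refine abs_le_of_sq_le_sq ?_ (vecNorm_nonneg _)
    rw [vecNorm_sq]
    exact Finset.single_le_sum (f := fun i => w i ^ 2) (fun i _ => sq_nonneg _)
      (Finset.mem_univ i)
  have hv : ∀ i l, Q.mulVec v i - Q.mulVec v l ≤ c := by
    intro i l
    have h2 := habs (Q.mulVec v) i
    have h3 := habs (Q.mulVec v) l
    have h4 := vecNorm_mulVec_le Q v
    have h5 := le_abs_self (Q.mulVec v i)
    have h6 := neg_abs_le (Q.mulVec v l)
    linarith
  have hosc' : ∀ i l, A.mulVec ((A ^ (N * (j + 1))).mulVec (Q.mulVec v)) i -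
      A.mulVec ((A ^ (N * (j + 1))).mulVec (Q.mulVec v)) l ≤ (1 - ε) ^ (j + 1) * c := by
    intro i l
    have := osc_mulVec_le hA (t := t) (ε := 0)
      (fun i => Matrix.nonneg_of_mem_rowStochastic hA) (hosc (j + 1) _ c hv) i l
    simpa using this
  have hzero : ∑ l, u l * A.mulVec ((A ^ (N * (j + 1))).mulVec (Q.mulVec v)) l = 0 := by
    change u ⬝ᵥ _ = 0
    rw [Matrix.dotProduct_mulVec, huA, Matrix.dotProduct_mulVec, huAk]
    simp only [dotProduct, hQdef, consensusProj_mulVec, mul_sub, Finset.sum_sub_distrib,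
      ← Finset.sum_mul, hun]
    field_simp
    ring
  have hent := hbd _ _ hzero hosc'
  have hfin : vecNorm (A.mulVec ((A ^ (N * (j + 1))).mulVec (Q.mulVec v))) ≤
      n * ((1 - ε) ^ (j + 1) * c) := by
    have hb0 : 0 ≤ (1 - ε) ^ (j + 1) * c := (abs_nonneg _).trans (hent t)
    refine le_of_sq_le_sq ?_ (mul_nonneg hn.le hb0)
    rw [vecNorm_sq]
    have hn1 : (1 : ℝ) ≤ n := by exact_mod_cast Nat.one_le_iff_ne_zero.2 (NeZero.ne n)
    calc _ ≤ ∑ _i : Fin n, ((1 - ε) ^ (j + 1) * c) ^ 2 :=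
          Finset.sum_le_sum fun i _ => sq_le_sq' (abs_le.1 (hent i)).1 (abs_le.1 (hent i)).2
      _ = n * ((1 - ε) ^ (j + 1) * c) ^ 2 := by simp
      _ ≤ _ := by
        rw [mul_pow (n : ℝ)]
        exact mul_le_mul_of_nonneg_right (by nlinarith) (sq_nonneg _)
  calc _ ≤ n * ((1 - ε) ^ (j + 1) * c) := hfin
    _ = ((1 - ε) ^ (j + 1) * K) * vecNorm v := by rw [hK, hc]; ring
    _ ≤ _ := mul_le_mul_of_nonneg_right hj' (vecNorm_nonneg _)

end Mixing

/-! ### Existence of admissible norms -/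

section Existence

variable {n : ℕ}

/-- A norm contracting `Q A_γ` for one `γ = γmax` does so for all smaller `γ > 0`, because `A_γ` is
a convex combination of the identity and `A_γmax`. -/
lemma exists_norm_relaxed {Q A : Matrix (Fin n) (Fin n) ℝ} {γmax : ℝ} (hγ : 0 < γmax)
    (hQ : Q * Q = Q) (hcomm : Q * relaxed A γmax = relaxed A γmax * Q) {m : ℕ} (hm : 0 < m)
    (hpow : specNorm ((Q * relaxed A γmax) ^ m) ≤ 1 / 2) :
    ∃ (T : Matrix (Fin n) (Fin n) ℝ) (θ : ℝ), IsUnit T ∧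
      (∀ v, vecNorm v ≤ vecNorm (T.mulVec v)) ∧ inducedNorm T Q ≤ 1 ∧ 0 < θ ∧ θ ≤ 1 ∧
      ∀ γ, 0 < γ → γ ≤ γmax → inducedNorm T (Q * relaxed A γ) ≤ 1 - θ * γ := by
  obtain ⟨T, ε, hT, hge, hQ1, hε0, hε1, hW⟩ := exists_adapted_norm (Q := Q) hQ
    (W := Q * relaxed A γmax) (by rw [← Matrix.mul_assoc, hQ])
    (by rw [Matrix.mul_assoc, ← hcomm, ← Matrix.mul_assoc, hQ]) hm hpow
  refine ⟨T, min (ε / γmax) 1, hT, hge, hQ1, lt_min (div_pos hε0 hγ) one_pos, min_le_right _ _,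
    fun γ h0 h1 => ?_⟩
  have hτ1 : γ / γmax ≤ 1 := (div_le_one hγ).2 h1
  have hτ0 : 0 < γ / γmax := div_pos h0 hγ
  have hconv : Q * relaxed A γ = (1 - γ / γmax) • Q + (γ / γmax) • (Q * relaxed A γmax) := by
    have : relaxed A γ = (1 - γ / γmax) • 1 + (γ / γmax) • relaxed A γmax := by
      ext i j
      simp only [relaxed_apply, Matrix.add_apply, Matrix.smul_apply, smul_eq_mul]
      field_simp
      ring
    rw [this, Matrix.mul_add, Matrix.mul_smul, Matrix.mul_smul, Matrix.mul_one]
  have hθ : min (ε / γmax) 1 * γ ≤ γ / γmax * ε := by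
    calc _ ≤ ε / γmax * γ := mul_le_mul_of_nonneg_right (min_le_left _ _) h0.le
      _ = _ := by ring
  have hle : γ / γmax * ε ≤ 1 := by nlinarith
  refine inducedNorm_le hT (by linarith) fun v => ?_
  rw [hconv, Matrix.add_mulVec, Matrix.smul_mulVec, Matrix.smul_mulVec, Matrix.mulVec_add,
    Matrix.mulVec_smul, Matrix.mulVec_smul]
  have hn := vecNorm_nonneg (T.mulVec v)
  have hq := (vecNorm_mulVec_le_inducedNorm hT Q v).trans (mul_le_mul_of_nonneg_right hQ1 hn)
  have hw := (vecNorm_mulVec_le_inducedNorm hT (Q * relaxed A γmax) v).trans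
    (mul_le_mul_of_nonneg_right hW hn)
  calc _ ≤ (1 - γ / γmax) * vecNorm (T.mulVec (Q.mulVec v)) +
        γ / γmax * vecNorm (T.mulVec ((Q * relaxed A γmax).mulVec v)) := by
        refine (vecNorm_add_le _ _).trans (le_of_eq ?_)
        rw [vecNorm_smul, vecNorm_smul, abs_of_nonneg (sub_nonneg.2 hτ1), abs_of_pos hτ0]
    _ ≤ (1 - γ / γmax) * (1 * vecNorm (T.mulVec v)) +
        γ / γmax * ((1 - ε) * vecNorm (T.mulVec v)) := by
        have := sub_nonneg.2 hτ1
        gcongr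
    _ = (1 - γ / γmax * ε) * vecNorm (T.mulVec v) := by ring
    _ ≤ _ := mul_le_mul_of_nonneg_right (by linarith) hn

lemma relaxed_transpose (A : Matrix (Fin n) (Fin n) ℝ) (γ : ℝ) :
    (relaxed A γ).transpose = relaxed A.transpose γ := by
  simp [relaxed]

theorem exists_admissible [NeZero n] {E : Fin n → Fin n → Prop}
    {R C : Matrix (Fin n) (Fin n) ℝ} (hnet : NetworkAssumption E R C) {γmax : ℝ}
    (h0 : 0 < γmax) (h1 : γmax < 1) :
    ∃ D : NormData n, 0 < ∑ i, D.uR i * D.uC i ∧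
      ∀ γx γy : ℝ, 0 < γx → γx ≤ γmax → 0 < γy → γy ≤ γmax → D.Admissible R C γx γy := by
  obtain ⟨t, htR, htC⟩ := hnet.commonRoot
  have hC := Matrix.transpose_mem_rowStochastic_iff_mem_colStochastic.2 hnet.colStochastic
  obtain ⟨uR, hR0, hReig, hRsum⟩ := exists_stationary hnet.rowStochastic
  obtain ⟨uC, hC0, hCeig, hCsum⟩ := exists_stationary hC
  obtain ⟨hRt, m, hm, hmR⟩ :=
    mixing_of_root hnet.rowStochastic htR h0 h1 hR0 hReig hRsum
  obtain ⟨hCt, k, hk, hkC⟩ := mixing_of_root hC htC h0 h1 hC0 hCeig hCsum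
  obtain ⟨TR, θR, hTR, hTRge, hTRQ, hθR0, hθR1, hTRc⟩ := exists_norm_relaxed h0
    (consensusProj_mul_self hRsum)
    (consensusProj_mul_comm (relaxed_mem_rowStochastic hnet.rowStochastic h0.le h1.le)
      (vecMul_relaxed hReig γmax)) hm hmR
  have hcommC := consensusProj_mul_comm (relaxed_mem_rowStochastic hC h0.le h1.le)
      (vecMul_relaxed hCeig γmax)
  obtain ⟨TC, θC, hTC, hTCge, hTCQ, hθC0, hθC1, hTCc⟩ := exists_norm_relaxed (A := C) h0
    (Q := (consensusProj uC).transpose)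
    (by rw [← Matrix.transpose_mul, consensusProj_mul_self hCsum])
    (by
      have := congrArg Matrix.transpose hcommC
      simpa only [Matrix.transpose_mul, relaxed_transpose, Matrix.transpose_transpose]
        using this.symm) hk
    (by
      have : (consensusProj uC).transpose * relaxed C γmax =
          (consensusProj uC * relaxed C.transpose γmax).transpose := by
        rw [hcommC, Matrix.transpose_mul, relaxed_transpose, Matrix.transpose_transpose]
      rwa [this, ← Matrix.transpose_pow, specNorm_transpose])
  refine ⟨⟨uR, uC, TR, TC, θR, θC⟩, ?_, fun γx γy hx0 hx1 hy0 hy1 => ?_⟩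
  · exact Finset.sum_pos' (fun i _ => mul_nonneg (hR0 i) (hC0 i))
      ⟨t, Finset.mem_univ t, mul_pos hRt hCt⟩
  have hpiC : (NormData.mk uR uC TR TC θR θC).piC = (consensusProj uC).transpose := by
    simp [NormData.piC, consensusProj, Matrix.transpose_vecMulVec]
  exact
    { uR_nonneg := hR0
      uR_eigen := hReig
      uR_sum := hRsum
      uC_nonneg := hC0
      uC_eigen := by rw [← Matrix.vecMul_transpose]; exact hCeig
      uC_sum := hCsum
      TR_unit := hTR
      TC_unit := hTC
      TR_ge := hTRge
      TC_ge := hTCge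
      θR_pos := hθR0
      θR_le := hθR1
      θC_pos := hθC0
      θC_le := hθC1
      piR_norm := hTRQ
      piC_norm := by rw [hpiC]; exact hTCQ
      contractR := hTRc γx hx0 hx1
      contractC := by rw [hpiC]; exact hTCc γy hy0 hy1 }

end Existence

/-! ### The linear system of inequalities -/

/-- The scalar constants in the recursion of the error quantities: `tR = θ_R γx`, `tC = θ_C γy`,
`A = ‖I - R‖_R γx`, `B = ‖I - C‖_C γy`, `bx = αx r δ`, `bY = αy r δ`, the largest step-size `l`,
a gradient Lipschitz constant `L`, `u = ‖u_C‖`, the norm equivalence constants `dR`, `dC`, the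
relative compression error `Cc`, `E = ‖u_R‖ ‖u_C‖ / (n² M)`, and `K = ‖u_R‖² / (n² M²)`. -/
structure Rates where
  tR : ℝ
  tC : ℝ
  A : ℝ
  B : ℝ
  bx : ℝ
  bY : ℝ
  l : ℝ
  L : ℝ
  u : ℝ
  dR : ℝ
  dC : ℝ
  Cc : ℝ
  e1 : ℝ
  e2 : ℝ
  E : ℝ
  K : ℝ
  M : ℝ
  μ : ℝ
  nn : ℝ

namespace Rates

/-- The consequences of the step-size conditions under which the Lyapunov function decreases. -/
structure Valid (c : Rates) : Prop where
  tR_pos : 0 < c.tR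
  tR_le_A : c.tR ≤ c.A
  tC_pos : 0 < c.tC
  tC_le : c.tC ≤ 1
  bx_pos : 0 < c.bx
  bx_le : c.bx ≤ 1
  by_pos : 0 < c.bY
  by_le : c.bY ≤ 1
  l_pos : 0 < c.l
  L_pos : 0 < c.L
  u_pos : 0 < c.u
  Cc_nonneg : 0 ≤ c.Cc
  e1_pos : 0 < c.e1
  e2_ge : 4 ≤ c.e2
  E_pos : 0 < c.E
  M_pos : 0 < c.M
  nn_pos : 0 < c.nn
  one_le_Ku : 1 ≤ c.K * c.u ^ 2
  one_le_En : 1 ≤ c.E * c.nn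
  K_le : 12 * c.e1 * c.A ^ 2 * c.K ≤ c.E * c.tC ^ 2
  lam_R : 384 * (c.dR ^ 2 * (1 - c.tR) ^ 2 * c.E * c.u ^ 2 * (c.L ^ 2 * c.l ^ 2)) ≤ c.tR ^ 2
  lam_R' : 240 * (c.dR ^ 2 * c.E * c.u ^ 2 * (c.L ^ 2 * c.l ^ 2)) ≤ c.tR ^ 2
  comp_x : 4608 * (c.Cc * c.dR ^ 2 * c.A ^ 4) ≤ c.tR ^ 2 * c.bx ^ 2
  lam_e1 : 6 * (c.e1 * c.B ^ 2 * (c.L ^ 2 * c.l ^ 2)) ≤ c.tC ^ 2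
  lam_L : 36 * (c.L ^ 2 * c.l ^ 2) ≤ 1
  lam_dC : 12 * (c.dC ^ 2 * (c.L ^ 2 * c.l ^ 2)) ≤ 1
  lam_dCB : 12 * (c.dC ^ 2 * c.B ^ 2 * (c.L ^ 2 * c.l ^ 2)) ≤ 1
  e1_B : 48 * (c.e1 * c.B ^ 2) ≤ c.tC * c.e2
  comp_y : 64 * (c.Cc * c.e2 * c.dC ^ 2 * c.B ^ 2) ≤ c.tC * c.bY ^ 2 * c.e1
  comp_y' : 48 * (c.Cc * c.e2 * c.B ^ 2) ≤ c.tC * c.bY ^ 2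
  comp_y'' : 3072 * (c.Cc * c.B ^ 2 * c.dC ^ 2) ≤ c.bY ^ 2
  dC_B : 96 * (c.dC ^ 2 * c.B ^ 2) ≤ c.e2
  e1_ge : 2 * c.dC ^ 2 + 4 * (c.dC ^ 2 * c.B ^ 2 * c.Cc) ≤ c.e1

variable (c : Rates)

/-- Weight of the optimality gap in the Lyapunov function. -/
noncomputable def w1 : ℝ := c.A ^ 2 / (c.E * c.M * c.l)
/-- Weight of the consensus error. -/
noncomputable def w2 : ℝ := 6 * c.L ^ 2 * c.A ^ 2 / c.tR
/-- Weight of the gradient tracking error. -/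
noncomputable def w3 : ℝ := c.tC / (2 * c.e1)
/-- Weight of the compression error of the decision variables. -/
noncomputable def w4 : ℝ := c.L ^ 2 * c.bx / 16
/-- Weight of the compression error of the trackers. -/
noncomputable def w5 : ℝ := c.bY * c.tC / (4 * c.e2)

/-- Total coefficient in the Lyapunov function of the squared displacement of the iterates. -/
noncomputable def cD : ℝ :=
  c.w3 * ((2 * c.dC ^ 2 * c.L ^ 2 + 4 * (c.dC ^ 2 * c.B ^ 2 * c.Cc) * c.L ^ 2) / c.tC) +
  c.w4 * (2 / c.bx * (2 + 8 * (c.L ^ 2 * c.l ^ 2) +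
    8 * (c.dC ^ 2 * c.B ^ 2 * (c.L ^ 2 * c.l ^ 2)) +
    16 * ((c.Cc * c.B ^ 2 * c.dC ^ 2) * (c.L ^ 2 * c.l ^ 2)))) +
  c.w5 * (c.L ^ 2 / c.bY * (4 + 6 * (c.dC ^ 2 * c.B ^ 2) + 12 * (c.Cc * c.B ^ 2 * c.dC ^ 2)))

/-- Total coefficient of the squared norm of the trackers. -/
noncomputable def cY : ℝ :=
  c.w2 * (2 * (1 - c.tR) ^ 2 * c.dR ^ 2 * c.l ^ 2 / c.tR) + c.cD * (75 / 16 * c.dR ^ 2 * c.l ^ 2)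

/-- Total coefficient of the squared compression error of the decision variables. -/
noncomputable def cex : ℝ :=
  c.w2 * (2 * c.A ^ 2 * c.dR ^ 2 / c.tR) + c.cD * (3 * c.A ^ 2 * c.dR ^ 2)

/-- Total coefficient of the squared compression error of the trackers. -/
noncomputable def cey : ℝ :=
  c.w3 * (2 * c.B ^ 2 * c.dC ^ 2 / c.tC) +
  c.w4 * (2 / c.bx * (8 * c.l ^ 2 * (c.B ^ 2 * c.dC ^ 2))) +
  c.w5 * (6 / c.bY * (c.B ^ 2 * c.dC ^ 2))

variable {c}

namespace Valid

variable (h : c.Valid)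
include h

lemma A_pos : 0 < c.A := h.tR_pos.trans_le h.tR_le_A

lemma e2_pos : 0 < c.e2 := by linarith [h.e2_ge]

lemma w1_pos : 0 < c.w1 := by
  have := h.A_pos; have := h.E_pos; have := h.M_pos; have := h.l_pos
  unfold w1; positivity

lemma w2_pos : 0 < c.w2 := by
  have := h.A_pos; have := h.L_pos; have := h.tR_pos
  unfold w2; positivity

lemma w3_pos : 0 < c.w3 := by
  have := h.tC_pos; have := h.e1_pos
  unfold w3; positivity

lemma w4_pos : 0 < c.w4 := by
  have := h.L_pos; have := h.bx_pos
  unfold w4; positivity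

lemma w5_pos : 0 < c.w5 := by
  have := h.tC_pos; have := h.by_pos; have := h.e2_pos
  unfold w5; positivity

lemma cD_nonneg : 0 ≤ c.cD := by
  have := h.w3_pos; have := h.w4_pos; have := h.w5_pos; have := h.tC_pos; have := h.bx_pos
  have := h.by_pos; have := h.Cc_nonneg
  unfold cD; positivity

lemma cY_nonneg : 0 ≤ c.cY := by
  have := h.w2_pos; have := h.cD_nonneg; have := h.tR_pos
  unfold cY; positivity

lemma cex_nonneg : 0 ≤ c.cex := by
  have := h.w2_pos; have := h.cD_nonneg; have := h.tR_pos
  unfold cex; positivity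

lemma cey_nonneg : 0 ≤ c.cey := by
  have := h.w3_pos; have := h.w4_pos; have := h.w5_pos; have := h.tC_pos; have := h.bx_pos
  have := h.by_pos
  unfold cey; positivity

/-- The weights are chosen such that a squared displacement contributes at most about `L²`. -/
lemma cD_le : c.cD ≤ 23 / 20 * c.L ^ 2 := by
  have hL := h.L_pos
  have htC := h.tC_pos
  have hbx := h.bx_pos
  have hby := h.by_pos
  have he1 := h.e1_pos
  have he2 := h.e2_pos
  have h1 : c.w3 * ((2 * c.dC ^ 2 * c.L ^ 2 + 4 * (c.dC ^ 2 * c.B ^ 2 * c.Cc) * c.L ^ 2) / c.tC)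
      ≤ 1 / 2 * c.L ^ 2 := by
    have : c.w3 * ((2 * c.dC ^ 2 * c.L ^ 2 + 4 * (c.dC ^ 2 * c.B ^ 2 * c.Cc) * c.L ^ 2) / c.tC) =
        (2 * c.dC ^ 2 + 4 * (c.dC ^ 2 * c.B ^ 2 * c.Cc)) / c.e1 * (1 / 2 * c.L ^ 2) := by
      unfold w3; field_simp
    rw [this]
    exact mul_le_of_le_one_left (by positivity) ((div_le_one he1).2 h.e1_ge)
  have h2 : c.w4 * (2 / c.bx * (2 + 8 * (c.L ^ 2 * c.l ^ 2) +
      8 * (c.dC ^ 2 * c.B ^ 2 * (c.L ^ 2 * c.l ^ 2)) +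
      16 * ((c.Cc * c.B ^ 2 * c.dC ^ 2) * (c.L ^ 2 * c.l ^ 2)))) ≤ 37 / 100 * c.L ^ 2 := by
    have hlL := h.lam_L
    have hdCB := h.lam_dCB
    have hP : c.Cc * c.B ^ 2 * c.dC ^ 2 ≤ 1 / 3072 := by
      have := h.comp_y''
      have : c.bY ^ 2 ≤ 1 := pow_le_one₀ hby.le h.by_le
      linarith
    have hP0 : 0 ≤ c.Cc * c.B ^ 2 * c.dC ^ 2 := by have := h.Cc_nonneg; positivity
    have hQ0 : 0 ≤ c.L ^ 2 * c.l ^ 2 := by positivity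
    have hPQ : (c.Cc * c.B ^ 2 * c.dC ^ 2) * (c.L ^ 2 * c.l ^ 2) ≤ 1 / 3072 * (1 / 36) :=
      mul_le_mul hP (by linarith) hQ0 (by norm_num)
    have : c.w4 * (2 / c.bx * (2 + 8 * (c.L ^ 2 * c.l ^ 2) +
        8 * (c.dC ^ 2 * c.B ^ 2 * (c.L ^ 2 * c.l ^ 2)) +
        16 * ((c.Cc * c.B ^ 2 * c.dC ^ 2) * (c.L ^ 2 * c.l ^ 2)))) =
        (2 + 8 * (c.L ^ 2 * c.l ^ 2) + 8 * (c.dC ^ 2 * c.B ^ 2 * (c.L ^ 2 * c.l ^ 2)) +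
        16 * ((c.Cc * c.B ^ 2 * c.dC ^ 2) * (c.L ^ 2 * c.l ^ 2))) / 8 * c.L ^ 2 := by
      unfold w4; field_simp; ring
    rw [this]
    exact mul_le_mul_of_nonneg_right (by linarith) (by positivity)
  have h3 : c.w5 * (c.L ^ 2 / c.bY * (4 + 6 * (c.dC ^ 2 * c.B ^ 2) +
      12 * (c.Cc * c.B ^ 2 * c.dC ^ 2))) ≤ 27 / 100 * c.L ^ 2 := by
    have hP : c.Cc * c.B ^ 2 * c.dC ^ 2 ≤ 1 / 3072 := by
      have := h.comp_y''
      have : c.bY ^ 2 ≤ 1 := pow_le_one₀ hby.le h.by_le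
      linarith
    have hsum : 4 + 6 * (c.dC ^ 2 * c.B ^ 2) + 12 * (c.Cc * c.B ^ 2 * c.dC ^ 2) ≤
        27 / 25 * c.e2 := by linarith [h.dC_B, h.e2_ge]
    have : c.w5 * (c.L ^ 2 / c.bY * (4 + 6 * (c.dC ^ 2 * c.B ^ 2) +
        12 * (c.Cc * c.B ^ 2 * c.dC ^ 2))) = c.tC * ((4 + 6 * (c.dC ^ 2 * c.B ^ 2) +
        12 * (c.Cc * c.B ^ 2 * c.dC ^ 2)) / c.e2) * (1 / 4 * c.L ^ 2) := by
      unfold w5; field_simp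
    rw [this]
    have h4 : (4 + 6 * (c.dC ^ 2 * c.B ^ 2) + 12 * (c.Cc * c.B ^ 2 * c.dC ^ 2)) / c.e2 ≤ 27 / 25 :=
      (div_le_iff₀ he2).2 hsum
    have h5 : c.tC * ((4 + 6 * (c.dC ^ 2 * c.B ^ 2) + 12 * (c.Cc * c.B ^ 2 * c.dC ^ 2)) / c.e2) ≤
        1 * (27 / 25) := by
      have := h.Cc_nonneg
      exact mul_le_mul h.tC_le h4 (by positivity) zero_le_one
    calc _ ≤ 1 * (27 / 25) * (1 / 4 * c.L ^ 2) := mul_le_mul_of_nonneg_right h5 (by positivity)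
      _ = _ := by ring
  unfold cD
  linarith [sq_nonneg c.L]

/-- The contribution of the trackers is a small multiple of what the descent of the objective, with
weight `A² / E`, can absorb. -/
lemma cY_le : c.cY * (18 * (c.E * c.u ^ 2)) ≤ c.A ^ 2 := by
  have htR := h.tR_pos
  have hE := h.E_pos
  have hA : c.tR ^ 2 ≤ c.A ^ 2 := pow_le_pow_left₀ htR.le h.tR_le_A 2
  have h1 : c.w2 * (2 * (1 - c.tR) ^ 2 * c.dR ^ 2 * c.l ^ 2 / c.tR) * (32 * (c.E * c.u ^ 2))
      ≤ c.A ^ 2 := by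
    have : c.w2 * (2 * (1 - c.tR) ^ 2 * c.dR ^ 2 * c.l ^ 2 / c.tR) * (32 * (c.E * c.u ^ 2)) =
        384 * (c.dR ^ 2 * (1 - c.tR) ^ 2 * c.E * c.u ^ 2 * (c.L ^ 2 * c.l ^ 2)) / c.tR ^ 2 *
          c.A ^ 2 := by
      unfold w2; field_simp; ring
    rw [this]
    exact mul_le_of_le_one_left (sq_nonneg _) ((div_le_one (by positivity)).2 h.lam_R)
  have h2 : c.cD * (75 / 16 * c.dR ^ 2 * c.l ^ 2) * (c.E * c.u ^ 2) ≤
      23 / 20 * (75 / 16) / 240 * c.A ^ 2 := by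
    calc _ ≤ 23 / 20 * c.L ^ 2 * (75 / 16 * c.dR ^ 2 * c.l ^ 2) * (c.E * c.u ^ 2) := by
          gcongr
          exact h.cD_le
      _ = 23 / 20 * (75 / 16) * (c.dR ^ 2 * c.E * c.u ^ 2 * (c.L ^ 2 * c.l ^ 2)) := by ring
      _ ≤ _ := by linarith [h.lam_R']
  unfold cY
  linarith [sq_nonneg c.A]

/-- Coefficient of the consensus error. -/
lemma coeff_x : c.A ^ 2 * c.L ^ 2 + c.w2 * (1 - c.tR) + c.cD * (3 * c.A ^ 2) +
    c.cY * (3 * c.u ^ 2 * c.L ^ 2 / c.nn) ≤ c.w2 * (1 - c.tR / 16) := by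
  have htR := h.tR_pos
  have hw : c.w2 * c.tR = 6 * c.L ^ 2 * c.A ^ 2 := by unfold w2; field_simp
  have h1 : c.cD * (3 * c.A ^ 2) ≤ 23 / 20 * c.L ^ 2 * (3 * c.A ^ 2) :=
    mul_le_mul_of_nonneg_right h.cD_le (by positivity)
  have h2 : c.cY * (3 * c.u ^ 2 * c.L ^ 2 / c.nn) ≤ 1 / 6 * (c.A ^ 2 * c.L ^ 2) := by
    have hn := h.nn_pos
    have h3 : c.cY * (3 * c.u ^ 2 * c.L ^ 2 / c.nn) ≤
        c.cY * (3 * c.u ^ 2 * c.L ^ 2 / c.nn) * (c.E * c.nn) :=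
      le_mul_of_one_le_right (by have := h.cY_nonneg; positivity) h.one_le_En
    have h4 : c.cY * (3 * c.u ^ 2 * c.L ^ 2 / c.nn) * (c.E * c.nn) =
        c.cY * (18 * (c.E * c.u ^ 2)) * (c.L ^ 2 / 6) := by field_simp; ring
    have h5 := mul_le_mul_of_nonneg_right h.cY_le (show 0 ≤ c.L ^ 2 / 6 by positivity)
    linarith
  have h0 : 0 ≤ c.A ^ 2 * c.L ^ 2 := by positivity
  nlinarith

/-- Coefficient of the squared gradient: the decrease of the objective dominates. -/
lemma coeff_g : c.cY * (3 * c.u ^ 2) ≤ c.A ^ 2 / (4 * c.E) := by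
  have hE := h.E_pos
  rw [le_div_iff₀ (by positivity)]
  have := h.cY_le
  nlinarith [sq_nonneg c.A]

/-- Coefficient of the gradient tracking error. -/
lemma coeff_y : c.A ^ 2 / c.E * c.K + c.w3 * (1 - c.tC) + c.cY * 3 +
    c.w4 * (2 / c.bx * (8 * c.l ^ 2 * c.B ^ 2)) + c.w5 * (6 / c.bY * c.B ^ 2) ≤
      c.w3 * (1 - c.tC / 8) := by
  have hE := h.E_pos
  have he1 := h.e1_pos
  have he2 := h.e2_pos
  have htC := h.tC_pos
  have hbx := h.bx_pos
  have hby := h.by_pos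
  set τ := c.tC ^ 2 / c.e1 with hτ
  have hτe : τ * c.e1 = c.tC ^ 2 := by rw [hτ]; field_simp
  have hw : c.w3 * c.tC = τ / 2 := by unfold w3; rw [hτ]; field_simp
  have hAK : c.A ^ 2 / c.E * c.K ≤ τ / 12 := by
    rw [hτ, div_mul_eq_mul_div, div_div, div_le_div_iff₀ hE (by positivity)]
    linarith [h.K_le]
  have hcY : c.cY * 3 ≤ τ / 72 := by
    have h1 : c.cY * 18 * c.E ≤ c.A ^ 2 * c.K := by
      have hK : 0 ≤ c.K := by
        by_contra hneg
        have := mul_nonpos_of_nonpos_of_nonneg (not_le.1 hneg).le (sq_nonneg c.u)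
        linarith [h.one_le_Ku]
      calc c.cY * 18 * c.E ≤ c.cY * 18 * c.E * (c.K * c.u ^ 2) :=
            le_mul_of_one_le_right (by have := h.cY_nonneg; positivity) h.one_le_Ku
        _ = c.cY * (18 * (c.E * c.u ^ 2)) * c.K := by ring
        _ ≤ c.A ^ 2 * c.K := mul_le_mul_of_nonneg_right h.cY_le hK
    have h2 : c.cY * 18 ≤ c.A ^ 2 / c.E * c.K := by
      rw [div_mul_eq_mul_div, le_div_iff₀ hE]
      exact h1
    linarith
  have hw4 : c.w4 * (2 / c.bx * (8 * c.l ^ 2 * c.B ^ 2)) ≤ τ / 6 := by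
    have : c.w4 * (2 / c.bx * (8 * c.l ^ 2 * c.B ^ 2)) = c.B ^ 2 * (c.L ^ 2 * c.l ^ 2) := by
      unfold w4; field_simp; ring
    rw [this, hτ, div_div, le_div_iff₀ (by positivity)]
    linarith [h.lam_e1]
  have hw5 : c.w5 * (6 / c.bY * c.B ^ 2) ≤ τ / 32 := by
    have : c.w5 * (6 / c.bY * c.B ^ 2) = 3 / 2 * c.tC * c.B ^ 2 / c.e2 := by
      unfold w5; field_simp; ring
    rw [this, hτ, div_div, div_le_div_iff₀ he2 (by positivity)]
    have := mul_le_mul_of_nonneg_left h.e1_B htC.le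
    linarith
  have hτ0 : 0 < τ := by positivity
  linarith

/-- Coefficient of the compression error of the decision variables. -/
lemma coeff_hx : c.w4 * (1 - c.bx / 2) + c.cex * c.Cc ≤ c.w4 * (1 - c.bx / 4) := by
  have htR := h.tR_pos
  have hL := h.L_pos
  have hCc := h.Cc_nonneg
  have hA : c.tR ^ 2 ≤ c.A ^ 2 := pow_le_pow_left₀ htR.le h.tR_le_A 2
  have h1 : c.cex ≤ 16 * c.L ^ 2 * c.dR ^ 2 * c.A ^ 4 / c.tR ^ 2 := by
    have h2 : c.w2 * (2 * c.A ^ 2 * c.dR ^ 2 / c.tR) =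
        12 * c.L ^ 2 * c.dR ^ 2 * c.A ^ 4 / c.tR ^ 2 := by
      unfold w2; field_simp; ring
    have h3 : c.cD * (3 * c.A ^ 2 * c.dR ^ 2) ≤ 4 * c.L ^ 2 * c.dR ^ 2 * c.A ^ 4 / c.tR ^ 2 := by
      rw [le_div_iff₀ (by positivity)]
      calc _ ≤ 23 / 20 * c.L ^ 2 * (3 * c.A ^ 2 * c.dR ^ 2) * c.A ^ 2 := by
            gcongr
            exact h.cD_le
        _ = 69 / 20 * (c.L ^ 2 * c.dR ^ 2 * c.A ^ 4) := by ring
        _ ≤ 4 * (c.L ^ 2 * c.dR ^ 2 * c.A ^ 4) := by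
          have : 0 ≤ c.L ^ 2 * c.dR ^ 2 * c.A ^ 4 := by positivity
          linarith
        _ = _ := by ring
    unfold cex
    rw [h2]
    calc _ ≤ 12 * c.L ^ 2 * c.dR ^ 2 * c.A ^ 4 / c.tR ^ 2 +
          4 * c.L ^ 2 * c.dR ^ 2 * c.A ^ 4 / c.tR ^ 2 := by gcongr
      _ = _ := by ring
  have h4 : c.cex * c.Cc ≤ c.L ^ 2 * c.bx ^ 2 / 288 := by
    refine (mul_le_mul_of_nonneg_right h1 hCc).trans ?_
    rw [div_mul_eq_mul_div, div_le_div_iff₀ (by positivity) (by norm_num)]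
    have := mul_le_mul_of_nonneg_left h.comp_x (sq_nonneg c.L)
    linarith
  have h5 : c.w4 * c.bx = c.L ^ 2 * c.bx ^ 2 / 16 := by unfold w4; ring
  nlinarith [sq_nonneg (c.L * c.bx)]

/-- Coefficient of the compression error of the trackers. -/
lemma coeff_hy : c.w5 * (1 - c.bY / 4) + c.cey * (2 * c.Cc) ≤ c.w5 * (1 - c.bY / 16) := by
  have he1 := h.e1_pos
  have he2 := h.e2_pos
  have htC := h.tC_pos
  have hbx := h.bx_pos
  have hby := h.by_pos
  have hCc := h.Cc_nonneg
  set τ := c.tC * c.bY ^ 2 / c.e2 with hτ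
  have hτ0 : 0 < τ := by positivity
  have hw : c.w5 * c.bY = τ / 4 := by unfold w5; rw [hτ]; field_simp
  have h1 : c.w3 * (2 * c.B ^ 2 * c.dC ^ 2 / c.tC) * (2 * c.Cc) ≤ τ / 32 := by
    have : c.w3 * (2 * c.B ^ 2 * c.dC ^ 2 / c.tC) * (2 * c.Cc) =
        2 * (c.Cc * c.dC ^ 2 * c.B ^ 2) / c.e1 := by unfold w3; field_simp
    rw [this, hτ, div_div, div_le_div_iff₀ he1 (by positivity)]
    linarith [h.comp_y]
  have h2 : c.w4 * (2 / c.bx * (8 * c.l ^ 2 * (c.B ^ 2 * c.dC ^ 2))) * (2 * c.Cc) ≤ τ / 288 := by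
    have : c.w4 * (2 / c.bx * (8 * c.l ^ 2 * (c.B ^ 2 * c.dC ^ 2))) * (2 * c.Cc) =
        2 * (c.dC ^ 2 * (c.L ^ 2 * c.l ^ 2)) * (c.Cc * c.B ^ 2) := by
      unfold w4; field_simp; ring
    rw [this]
    have h3 : 2 * (c.dC ^ 2 * (c.L ^ 2 * c.l ^ 2)) * (c.Cc * c.B ^ 2) ≤
        1 / 6 * (c.Cc * c.B ^ 2) :=
      mul_le_mul_of_nonneg_right (by linarith [h.lam_dC]) (by positivity)
    refine h3.trans ?_
    rw [hτ, div_div, le_div_iff₀ (by positivity)]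
    linarith [h.comp_y']
  have h4 : c.w5 * (6 / c.bY * (c.B ^ 2 * c.dC ^ 2)) * (2 * c.Cc) ≤ τ / 1024 := by
    have : c.w5 * (6 / c.bY * (c.B ^ 2 * c.dC ^ 2)) * (2 * c.Cc) =
        3 * c.tC * (c.Cc * c.B ^ 2 * c.dC ^ 2) / c.e2 := by unfold w5; field_simp; ring
    rw [this, hτ, div_div, div_le_div_iff₀ he2 (by positivity)]
    have := mul_le_mul_of_nonneg_left h.comp_y'' (mul_nonneg htC.le he2.le)
    linarith
  unfold cey
  rw [add_mul, add_mul]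
  linarith

/-- One step of the Lyapunov function. The variables stand for the optimality gap `o`,
the squared gradient norm `g`, the consensus error `x`, the tracking error `y`, the
compression errors `hx` and `hy`, and of auxiliary squared norms; `Nex`, `Ney`, `Nhx`, `Nhy` are
excesses of the compression errors over their mean bounds, of either sign. -/
lemma lyapunov_step {ρ : ℝ} (hρ1 : 1 - c.M * c.l * c.μ / 2 ≤ ρ) (hρ2 : 1 - c.tR / 16 ≤ ρ)
    (hρ3 : 1 - c.tC / 8 ≤ ρ) (hρ4 : 1 - c.bx / 4 ≤ ρ) (hρ5 : 1 - c.bY / 16 ≤ ρ)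
    {o g x y hx hy D Y ex ey vy S Nex Ney Nhx Nhy o' x' y' hx' hy' : ℝ}
    (o0 : 0 ≤ o) (g0 : 0 ≤ g) (x0 : 0 ≤ x) (y0 : 0 ≤ y) (hx0 : 0 ≤ hx) (hy0 : 0 ≤ hy)
    (D0 : 0 ≤ D)
    (pl : 2 * c.μ * o ≤ g)
    (ho : o' ≤ o - c.M * c.l / 2 * g + c.M * c.l * (c.E * c.L ^ 2) * x + c.M * c.l * c.K * y)
    (hx2 : x' ≤ (1 - c.tR) * x +
      (2 * (1 - c.tR) ^ 2 * c.dR ^ 2 * c.l ^ 2 * Y + 2 * c.A ^ 2 * c.dR ^ 2 * ex) / c.tR)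
    (hy2 : y' ≤ (1 - c.tC) * y +
      (2 * c.dC ^ 2 * c.L ^ 2 * D + 2 * c.B ^ 2 * c.dC ^ 2 * ey) / c.tC)
    (hhx : hx' ≤ (1 - c.bx / 2) * hx + Nhx + 2 / c.bx * S)
    (hhy : hy' ≤ (1 - c.bY / 2) * vy + Nhy +
      6 / c.bY * (c.B ^ 2 * y + c.B ^ 2 * c.dC ^ 2 * c.L ^ 2 * D + c.B ^ 2 * c.dC ^ 2 * ey))
    (hS : S ≤ 2 * D + 8 * c.l ^ 2 * (c.L ^ 2 * D + c.B ^ 2 * y +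
      c.B ^ 2 * c.dC ^ 2 * c.L ^ 2 * D + c.B ^ 2 * c.dC ^ 2 * ey))
    (hD : D ≤ 3 * c.A ^ 2 * x + 75 / 16 * c.dR ^ 2 * c.l ^ 2 * Y + 3 * c.A ^ 2 * c.dR ^ 2 * ex)
    (hY : Y ≤ 3 * y + 3 * c.u ^ 2 * g + 3 * c.u ^ 2 * c.L ^ 2 / c.nn * x)
    (hvy : vy ≤ 2 * hy + 2 * c.L ^ 2 * D)
    (hvy' : vy ≤ hy / (1 - c.bY / 4) + 4 / c.bY * (c.L ^ 2 * D))
    (hex : ex ≤ c.Cc * hx + Nex) (hey : ey ≤ c.Cc * vy + Ney) :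
    c.w1 * o' + c.w2 * x' + c.w3 * y' + c.w4 * hx' + c.w5 * hy' ≤
      ρ * (c.w1 * o + c.w2 * x + c.w3 * y + c.w4 * hx + c.w5 * hy) +
        (c.cex * Nex + c.cey * Ney + c.w4 * Nhx + c.w5 * Nhy) := by
  have hw1 := h.w1_pos
  have hw2 := h.w2_pos
  have hw3 := h.w3_pos
  have hw4 := h.w4_pos
  have hw5 := h.w5_pos
  have htR := h.tR_pos
  have htC := h.tC_pos
  have hbx := h.bx_pos
  have hby := h.by_pos
  have hby1 := h.by_le
  have hCc := h.Cc_nonneg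
  have hE := h.E_pos
  have hM := h.M_pos
  have hl := h.l_pos
  have hw1E : c.w1 * (c.M * c.l) = c.A ^ 2 / c.E := by unfold w1; field_simp
  have i1 : c.w1 * o' ≤ c.w1 * (1 - c.M * c.l * c.μ / 2) * o - c.A ^ 2 / (4 * c.E) * g +
      c.A ^ 2 * c.L ^ 2 * x + c.A ^ 2 / c.E * c.K * y := by
    have h1 : o' ≤ (1 - c.M * c.l * c.μ / 2) * o - c.M * c.l / 4 * g +
        c.M * c.l * (c.E * c.L ^ 2) * x + c.M * c.l * c.K * y := by
      have := mul_le_mul_of_nonneg_left pl (show 0 ≤ c.M * c.l / 4 by positivity)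
      linarith only [this, ho]
    calc _ ≤ c.w1 * _ := mul_le_mul_of_nonneg_left h1 hw1.le
      _ = c.w1 * (1 - c.M * c.l * c.μ / 2) * o - (c.w1 * (c.M * c.l)) / 4 * g +
        (c.w1 * (c.M * c.l)) * (c.E * c.L ^ 2) * x + (c.w1 * (c.M * c.l)) * c.K * y := by ring
      _ = _ := by rw [hw1E]; field_simp
  have i5 : (1 - c.bY / 2) * vy ≤ (1 - c.bY / 4) * hy + 4 / c.bY * (c.L ^ 2 * D) := by
    have hpos : 0 < 1 - c.bY / 4 := by linarith
    have h1 : (1 - c.bY / 2) * vy ≤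
        (1 - c.bY / 2) * (hy / (1 - c.bY / 4) + 4 / c.bY * (c.L ^ 2 * D)) :=
      mul_le_mul_of_nonneg_left hvy' (by linarith)
    have h2 : (1 - c.bY / 2) * (hy / (1 - c.bY / 4)) ≤ (1 - c.bY / 4) * hy := by
      rw [← mul_div_assoc, div_le_iff₀ hpos]
      linarith only [mul_nonneg hy0 (sq_nonneg c.bY)]
    have h3 : (1 - c.bY / 2) * (4 / c.bY * (c.L ^ 2 * D)) ≤ 4 / c.bY * (c.L ^ 2 * D) :=
      mul_le_of_le_one_left (by positivity) (by linarith)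
    linarith only [h1, h2, h3]
  have hey' : ey ≤ 2 * c.Cc * hy + 2 * c.Cc * c.L ^ 2 * D + Ney := by
    have := mul_le_mul_of_nonneg_left hvy hCc
    linarith only [this, hey]
  have j2 := mul_le_mul_of_nonneg_left hx2 hw2.le
  have j3 := mul_le_mul_of_nonneg_left hy2 hw3.le
  have j4 := mul_le_mul_of_nonneg_left
    (hhx.trans (add_le_add_right (mul_le_mul_of_nonneg_left hS (by positivity)) _)) hw4.le
  have j5 := mul_le_mul_of_nonneg_left
    (hhy.trans (add_le_add_left (add_le_add_left i5 _) _)) hw5.le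
  have s1 : c.w2 * x' + c.w3 * y' + c.w4 * hx' + c.w5 * hy' ≤
      c.w2 * (1 - c.tR) * x + (c.w3 * (1 - c.tC) + c.w4 * (2 / c.bx * (8 * c.l ^ 2 * c.B ^ 2)) +
        c.w5 * (6 / c.bY * c.B ^ 2)) * y + c.w4 * (1 - c.bx / 2) * hx +
        c.w5 * (1 - c.bY / 4) * hy + (c.w4 * Nhx + c.w5 * Nhy) +
        (c.cD - c.cey * (2 * c.Cc * c.L ^ 2)) * D + c.cey * ey +
        c.w2 * (2 * (1 - c.tR) ^ 2 * c.dR ^ 2 * c.l ^ 2 / c.tR) * Y +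
        c.w2 * (2 * c.A ^ 2 * c.dR ^ 2 / c.tR) * ex := by
    refine (add_le_add (add_le_add (add_le_add j2 j3) j4) j5).trans (le_of_eq ?_)
    unfold cD cey
    field_simp
    ring
  have s2 := mul_le_mul_of_nonneg_left hey' h.cey_nonneg
  have s3 := mul_le_mul_of_nonneg_left hD h.cD_nonneg
  have s4 : c.w2 * (2 * (1 - c.tR) ^ 2 * c.dR ^ 2 * c.l ^ 2 / c.tR) * Y +
      c.cD * (75 / 16 * c.dR ^ 2 * c.l ^ 2) * Y ≤
      c.cY * (3 * y + 3 * c.u ^ 2 * g + 3 * c.u ^ 2 * c.L ^ 2 / c.nn * x) := by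
    rw [← add_mul]
    exact mul_le_mul_of_nonneg_left hY h.cY_nonneg
  have s5 : c.w2 * (2 * c.A ^ 2 * c.dR ^ 2 / c.tR) * ex + c.cD * (3 * c.A ^ 2 * c.dR ^ 2) * ex ≤
      c.cex * (c.Cc * hx + Nex) := by
    rw [← add_mul]
    exact mul_le_mul_of_nonneg_left hex h.cex_nonneg
  have k1 := mul_le_mul_of_nonneg_right h.coeff_x x0
  have k2 := mul_le_mul_of_nonneg_right h.coeff_g g0
  have k3 := mul_le_mul_of_nonneg_right h.coeff_y y0
  have k4 := mul_le_mul_of_nonneg_right h.coeff_hx hx0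
  have k5 := mul_le_mul_of_nonneg_right h.coeff_hy hy0
  have r1 := mul_le_mul_of_nonneg_right hρ1 (mul_nonneg hw1.le o0)
  have r2 := mul_le_mul_of_nonneg_right hρ2 (mul_nonneg hw2.le x0)
  have r3 := mul_le_mul_of_nonneg_right hρ3 (mul_nonneg hw3.le y0)
  have r4 := mul_le_mul_of_nonneg_right hρ4 (mul_nonneg hw4.le hx0)
  have r5 := mul_le_mul_of_nonneg_right hρ5 (mul_nonneg hw5.le hy0)
  linarith only [i1, s1, s2, s3, s4, s5, k1, k2, k3, k4, k5, r1, r2, r3, r4, r5]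

end Valid

end Rates

/-! ### Smooth objectives -/

section Objective

/-- The descent lemma for a function with an `L`-Lipschitz gradient. -/
lemma descent {V : Type*} [NormedAddCommGroup V] [InnerProductSpace ℝ V] [CompleteSpace V]
    {F : V → ℝ} {L : ℝ} (hF : Differentiable ℝ F)
    (hL : ∀ x y, ‖gradient F x - gradient F y‖ ≤ L * ‖x - y‖) (x d : V) :
    F (x + d) ≤ F x + inner ℝ (gradient F x) d + L / 2 * ‖d‖ ^ 2 := by
  set φ : ℝ → ℝ := fun t => F (x + t • d) - t * inner ℝ (gradient F x) d - L / 2 * t ^ 2 * ‖d‖ ^ 2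
  have hφ : ∀ t, HasDerivAt φ
      (inner ℝ (gradient F (x + t • d)) d - inner ℝ (gradient F x) d - L * t * ‖d‖ ^ 2) t := by
    intro t
    have h1 : HasDerivAt (fun t : ℝ => x + t • d) d t := by
      simpa using ((hasDerivAt_id t).smul_const d).const_add x
    have h2 : HasDerivAt (fun t : ℝ => F (x + t • d)) (inner ℝ (gradient F (x + t • d)) d) t := by
      have := (hF (x + t • d)).hasFDerivAt.comp_hasDerivAt t h1
      rwa [← inner_gradient_left] at this
    have h3 : HasDerivAt (fun t : ℝ => t * inner ℝ (gradient F x) d)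
        (inner ℝ (gradient F x) d) t := by
      simpa using (hasDerivAt_id t).mul_const (inner ℝ (gradient F x) d)
    have h4 : HasDerivAt (fun t : ℝ => L / 2 * t ^ 2 * ‖d‖ ^ 2) (L * t * ‖d‖ ^ 2) t := by
      have := (((hasDerivAt_id t).pow 2).const_mul (L / 2)).mul_const (‖d‖ ^ 2)
      refine this.congr_deriv ?_
      simp only [Nat.cast_ofNat, id, Nat.add_one_sub_one, pow_one]
      ring
    exact (h2.sub h3).sub h4
  have hanti : AntitoneOn φ (Set.Icc 0 1) := by
    refine antitoneOn_of_deriv_nonpos (convex_Icc 0 1)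
      (fun t _ => (hφ t).continuousAt.continuousWithinAt)
      (fun t _ => (hφ t).differentiableAt.differentiableWithinAt) fun t ht => ?_
    rw [interior_Icc] at ht
    rw [(hφ t).deriv, ← inner_sub_left]
    have h1 := real_inner_le_norm (gradient F (x + t • d) - gradient F x) d
    have h2 := hL (x + t • d) x
    rw [add_sub_cancel_left, norm_smul, Real.norm_eq_abs, abs_of_pos ht.1] at h2
    have h3 := mul_le_mul_of_nonneg_right h2 (norm_nonneg d)
    nlinarith
  have := hanti (Set.left_mem_Icc.2 zero_le_one) (Set.right_mem_Icc.2 zero_le_one) zero_le_one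
  simp only [φ, one_smul, zero_smul, add_zero, one_mul, zero_mul, sub_zero] at this
  linarith

/-- A gradient step of size `s ≤ 1 / L` with an error `w` in the gradient. -/
lemma inexact_gradient_step {V : Type*} [NormedAddCommGroup V] [InnerProductSpace ℝ V]
    [CompleteSpace V] {F : V → ℝ} {L : ℝ} (hF : Differentiable ℝ F)
    (hL : ∀ x y, ‖gradient F x - gradient F y‖ ≤ L * ‖x - y‖) (x w : V) {s : ℝ} (hs : 0 ≤ s)
    (hsL : L * s ≤ 1) :
    F (x - s • (gradient F x + w)) ≤ F x - s / 2 * ‖gradient F x‖ ^ 2 + s / 2 * ‖w‖ ^ 2 := by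
  have h1 := descent hF hL x (-(s • (gradient F x + w)))
  rw [← sub_eq_add_neg, inner_neg_right, inner_smul_right, norm_neg, norm_smul, mul_pow,
    Real.norm_eq_abs, sq_abs] at h1
  have h2 : ‖w‖ ^ 2 = ‖gradient F x + w‖ ^ 2 - 2 * inner ℝ (gradient F x) (gradient F x + w) +
      ‖gradient F x‖ ^ 2 := by
    have : w = (gradient F x + w) - gradient F x := by abel
    conv_lhs => rw [this, norm_sub_sq_real, real_inner_comm]
  have h3 := mul_le_mul_of_nonneg_right hsL (mul_nonneg hs (sq_nonneg ‖gradient F x + w‖))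
  rw [h2]
  linarith

variable {n p : ℕ} {f : Fin n → Dec p → ℝ} {L : Fin n → ℝ≥0} {μ : ℝ} {xs : Dec p}

lemma le_Lmax (L : Fin n → ℝ≥0) (i : Fin n) : (L i : ℝ) ≤ Lmax L :=
  le_ciSup (f := fun i => (L i : ℝ)) (Set.finite_range _).bddAbove i

lemma Lmax_nonneg (L : Fin n → ℝ≥0) : 0 ≤ Lmax L := Real.iSup_nonneg fun i => (L i).2

namespace ObjectiveAssumption

variable (h : ObjectiveAssumption f L μ xs)
include h

lemma norm_gradient_sub_le {K : ℝ} (hK : Lmax L ≤ K) (i : Fin n) (x y : Dec p) :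
    ‖gradient (f i) x - gradient (f i) y‖ ≤ K * ‖x - y‖ := by
  rw [← dist_eq_norm, ← dist_eq_norm]
  exact ((h.lipschitz i).dist_le_mul x y).trans
    (mul_le_mul_of_nonneg_right ((le_Lmax L i).trans hK) dist_nonneg)

lemma hasGradientAt_avgObj (x : Dec p) :
    HasGradientAt (avgObj f) ((n : ℝ)⁻¹ • ∑ i, gradient (f i) x) x := by
  rw [hasGradientAt_iff_hasFDerivAt]
  have h1 : HasFDerivAt (fun x => (n : ℝ)⁻¹ * ∑ i, f i x)
      ((n : ℝ)⁻¹ • ∑ i, fderiv ℝ (f i) x) x :=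
    (HasFDerivAt.fun_sum fun i _ => (h.differentiable i x).hasFDerivAt).const_mul _
  refine HasFDerivAt.congr_fderiv h1 ?_
  simp only [map_smul, map_sum, toDual_gradient]

lemma gradient_avgObj (x : Dec p) :
    gradient (avgObj f) x = (n : ℝ)⁻¹ • ∑ i, gradient (f i) x :=
  (h.hasGradientAt_avgObj x).gradient

lemma differentiable_avgObj : Differentiable ℝ (avgObj f) := fun x =>
  (h.hasGradientAt_avgObj x).differentiableAt

lemma norm_gradient_avgObj_sub_le [NeZero n] {K : ℝ} (hK : Lmax L ≤ K) (x y : Dec p) :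
    ‖gradient (avgObj f) x - gradient (avgObj f) y‖ ≤ K * ‖x - y‖ := by
  have hn : (n : ℝ) ≠ 0 := Nat.cast_ne_zero.2 (NeZero.ne n)
  rw [h.gradient_avgObj, h.gradient_avgObj, ← smul_sub, ← Finset.sum_sub_distrib, norm_smul,
    Real.norm_eq_abs, abs_of_nonneg (by positivity)]
  calc _ ≤ (n : ℝ)⁻¹ * ∑ _i : Fin n, K * ‖x - y‖ := by
        gcongr
        exact (norm_sum_le _ _).trans
          (Finset.sum_le_sum fun i _ => h.norm_gradient_sub_le hK i x y)
    _ = _ := by simp; field_simp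

lemma gradient_minimizer : gradient (avgObj f) xs = 0 := by
  have : IsLocalMin (avgObj f) xs := Filter.Eventually.of_forall h.minimizer
  rw [gradient, this.fderiv_eq_zero, map_zero]

lemma gap_nonneg (x : Dec p) : 0 ≤ avgObj f x - avgObj f xs := sub_nonneg.2 (h.minimizer x)

lemma gap_le [NeZero n] (x : Dec p) :
    avgObj f x - avgObj f xs ≤ Lmax L / 2 * ‖x - xs‖ ^ 2 := by
  have := descent h.differentiable_avgObj (h.norm_gradient_avgObj_sub_le le_rfl) xs (x - xs)
  rw [h.gradient_minimizer, inner_zero_left, add_sub_cancel] at this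
  linarith

/-- If the local gradients are constant, then so is the objective, because its gradient vanishes at
the minimizer. -/
lemma gap_eq_zero [NeZero n] (hL : Lmax L = 0) (x : Dec p) : avgObj f x - avgObj f xs = 0 := by
  have h1 := h.gap_le x
  rw [hL] at h1
  linarith [h.gap_nonneg x]

lemma frob_stackedGrad_sub_le {K : ℝ} (hK : Lmax L ≤ K) (X Y : Rows n p) :
    frob (stackedGrad f X - stackedGrad f Y) ≤ K * frob (X - Y) :=
  frob_le_mul ((Lmax_nonneg L).trans hK) fun i => h.norm_gradient_sub_le hK i (X i) (Y i)

lemma continuous_stackedGrad : Continuous (stackedGrad f) :=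
  continuous_pi fun i => (h.lipschitz i).continuous.comp (continuous_apply i)

end ObjectiveAssumption

end Objective

/-! ### Consequences of admissibility and of the step-size conditions -/

section Constants

variable {n : ℕ}

lemma one_le_specNorm [NeZero n] {T : Matrix (Fin n) (Fin n) ℝ}
    (hT : ∀ v, vecNorm v ≤ vecNorm (T.mulVec v)) : 1 ≤ specNorm T := by
  have h1 : 0 < vecNorm (1 : Fin n → ℝ) := vecNorm_pos one_ne_zero
  have h2 := (hT 1).trans (vecNorm_mulVec_le T 1)
  nlinarith

/-- An oblique projection `1 - a bᵀ` has Euclidean norm at least `‖a‖ ‖b‖`, so a norm for which it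
is nonexpansive cannot be too close to the Euclidean one. -/
lemma vecNorm_mul_le_specNorm [NeZero n] {T : Matrix (Fin n) (Fin n) ℝ} (hT : IsUnit T)
    (hge : ∀ v, vecNorm v ≤ vecNorm (T.mulVec v)) {a b : Fin n → ℝ} (hab : b ⬝ᵥ a = 1)
    (hQ : inducedNorm T (1 - Matrix.vecMulVec a b) ≤ 1) :
    vecNorm a * vecNorm b ≤ specNorm T := by
  have hdot : ∀ v : Fin n → ℝ, vecNorm v ^ 2 = v ⬝ᵥ v := fun v => by
    rw [vecNorm_sq]
    simp [dotProduct, sq]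
  have ha0 : a ≠ 0 := by rintro rfl; simp at hab
  have hapos := vecNorm_pos ha0
  set α := vecNorm a ^ 2 with hα
  have hα0 : 0 < α := by positivity
  -- the extremal vector
  obtain ⟨v, hv⟩ : ∃ v, v = b - α⁻¹ • a := ⟨_, rfl⟩
  have hbv : b ⬝ᵥ v = vecNorm b ^ 2 - α⁻¹ := by
    rw [hv, dotProduct_sub, dotProduct_smul, hab, hdot b, smul_eq_mul, mul_one]
  have hva : v ⬝ᵥ a = 0 := by
    rw [hv, sub_dotProduct, smul_dotProduct, hab, ← hdot a, ← hα, smul_eq_mul,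
      inv_mul_cancel₀ hα0.ne', sub_self]
  have hvv : vecNorm v ^ 2 = vecNorm b ^ 2 - α⁻¹ := by
    calc vecNorm v ^ 2 = (b - α⁻¹ • a) ⬝ᵥ v := by rw [hdot, ← hv]
      _ = _ := by
        rw [sub_dotProduct, smul_dotProduct, dotProduct_comm a v, hva, hbv, smul_zero, sub_zero]
  have h1 : 1 ≤ specNorm T := one_le_specNorm hge
  have hQv : (1 - Matrix.vecMulVec a b).mulVec v = v - vecNorm v ^ 2 • a := by
    rw [Matrix.sub_mulVec, Matrix.one_mulVec, Matrix.vecMulVec_mulVec, hbv, ← hvv]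
    rw [op_smul_eq_smul]
  have hQn : vecNorm ((1 - Matrix.vecMulVec a b).mulVec v) ^ 2 =
      (vecNorm v * (vecNorm a * vecNorm b)) ^ 2 := by
    rw [hQv, hdot]
    simp only [sub_dotProduct, dotProduct_sub, dotProduct_smul, smul_dotProduct,
      dotProduct_comm a v, hva, smul_eq_mul]
    rw [← hdot v, ← hdot a, ← hα]
    have : vecNorm b ^ 2 = vecNorm v ^ 2 + α⁻¹ := by rw [hvv]; ring
    rw [mul_pow, mul_pow, this, ← hα]
    field_simp
    ring
  have hab0 : 0 ≤ vecNorm a * vecNorm b := mul_nonneg (vecNorm_nonneg _) (vecNorm_nonneg _)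
  by_cases hv0 : v = 0
  · have : vecNorm b ^ 2 = α⁻¹ := by
      have h2 := hvv
      rw [hv0, hdot, dotProduct_zero] at h2
      linarith
    have h3 : (vecNorm a * vecNorm b) ^ 2 = 1 := by
      rw [mul_pow, this, ← hα, mul_inv_cancel₀ hα0.ne']
    nlinarith
  · have hvpos := vecNorm_pos hv0
    have h2 : vecNorm v * (vecNorm a * vecNorm b) ≤ specNorm T * vecNorm v := by
      have h3 : vecNorm v * (vecNorm a * vecNorm b) =
          vecNorm ((1 - Matrix.vecMulVec a b).mulVec v) :=
        (pow_left_inj₀ (mul_nonneg hvpos.le hab0) (vecNorm_nonneg _) two_ne_zero).1 hQn.symm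
      rw [h3]
      calc _ ≤ vecNorm (T.mulVec ((1 - Matrix.vecMulVec a b).mulVec v)) := hge _
        _ ≤ inducedNorm T (1 - Matrix.vecMulVec a b) * vecNorm (T.mulVec v) :=
          vecNorm_mulVec_le_inducedNorm hT _ _
        _ ≤ 1 * vecNorm (T.mulVec v) := mul_le_mul_of_nonneg_right hQ (vecNorm_nonneg _)
        _ ≤ _ := by rw [one_mul]; exact vecNorm_mulVec_le T v
    rw [mul_comm] at h2
    exact le_of_mul_le_mul_right h2 hvpos

lemma exists_ne_zero_dotProduct_eq_zero (hn : 2 ≤ n) (a : Fin n → ℝ) :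
    ∃ v : Fin n → ℝ, v ≠ 0 ∧ a ⬝ᵥ v = 0 := by
  obtain ⟨i, j, hij⟩ : ∃ i j : Fin n, i ≠ j :=
    ⟨⟨0, by omega⟩, ⟨1, by omega⟩, by simp⟩
  by_cases hi : a i = 0
  · exact ⟨Pi.single i 1, by simp, by simp [hi]⟩
  · refine ⟨Pi.single j (a i) - Pi.single i (a j), fun h => hi ?_, ?_⟩
    · have := congrFun h j
      simpa [hij.symm] using this
    · simp [dotProduct_sub, mul_comm]

/-- The contraction factor of a relaxed mixing step cannot exceed the norm of the step. -/
lemma contraction_le_step {T Q A : Matrix (Fin n) (Fin n) ℝ} (hT : IsUnit T) {γ t : ℝ}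
    (hγ : 0 ≤ γ) (hQ : inducedNorm T Q ≤ 1) (hc : inducedNorm T (Q * relaxed A γ) ≤ 1 - t)
    (hge : ∀ v, vecNorm v ≤ vecNorm (T.mulVec v)) {v : Fin n → ℝ} (hv : v ≠ 0)
    (hQv : Q.mulVec v = v) : t ≤ inducedNorm T (1 - A) * γ := by
  have hpos : 0 < vecNorm (T.mulVec v) := (vecNorm_pos hv).trans_le (hge v)
  have h1 : T.mulVec v = T.mulVec ((Q * relaxed A γ).mulVec v) +
      γ • T.mulVec (Q.mulVec ((1 - A).mulVec v)) := by
    rw [← Matrix.mulVec_smul, ← Matrix.mulVec_add, relaxed, Matrix.mul_sub, Matrix.sub_mulVec,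
      Matrix.mul_one, hQv, Matrix.mul_smul, Matrix.smul_mulVec, Matrix.mulVec_mulVec v Q,
      sub_add_cancel]
  have h2 : vecNorm (T.mulVec v) ≤ (1 - t) * vecNorm (T.mulVec v) +
      γ * (inducedNorm T (1 - A) * vecNorm (T.mulVec v)) := by
    conv_lhs => rw [h1]
    refine (vecNorm_add_le _ _).trans (add_le_add ?_ ?_)
    · exact (vecNorm_mulVec_le_inducedNorm hT _ _).trans
        (mul_le_mul_of_nonneg_right hc hpos.le)
    · rw [vecNorm_smul, abs_of_nonneg hγ]
      refine mul_le_mul_of_nonneg_left ?_ hγ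
      refine (vecNorm_mulVec_le_inducedNorm hT _ _).trans ?_
      refine (mul_le_of_le_one_left (vecNorm_nonneg _) hQ).trans ?_
      exact vecNorm_mulVec_le_inducedNorm hT _ _
  have h3 : t * vecNorm (T.mulVec v) ≤ inducedNorm T (1 - A) * γ * vecNorm (T.mulVec v) := by
    linarith
  exact le_of_mul_le_mul_right h3 hpos

lemma le_lamHat (P : Params n) (i : Fin n) : P.lam i ≤ lamHat P :=
  le_ciSup (Set.finite_range _).bddAbove i

lemma sum_mul_le_vecNorm_mul (a b : Fin n → ℝ) : ∑ i, a i * b i ≤ vecNorm a * vecNorm b :=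
  Real.sum_mul_le_sqrt_mul_sqrt _ _ _

lemma vecNorm_one : vecNorm (fun _ : Fin n => (1 : ℝ)) = √n := by
  simp [vecNorm]

namespace NormData.Admissible

variable {D : NormData n} {R C : Matrix (Fin n) (Fin n) ℝ} {γx γy : ℝ}

lemma uR_ne_zero [NeZero n] (h : D.Admissible R C γx γy) : D.uR ≠ 0 := by
  intro h0
  have := h.uR_sum
  rw [h0] at this
  simp only [Pi.zero_apply, Finset.sum_const_zero] at this
  exact NeZero.ne n (Nat.cast_eq_zero.1 this.symm)

lemma uC_ne_zero [NeZero n] (h : D.Admissible R C γx γy) : D.uC ≠ 0 := by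
  intro h0
  have := h.uC_sum
  rw [h0] at this
  simp only [Pi.zero_apply, Finset.sum_const_zero] at this
  exact NeZero.ne n (Nat.cast_eq_zero.1 this.symm)

lemma uR_le_δR [NeZero n] (h : D.Admissible R C γx γy) :
    vecNorm D.uR ^ 2 ≤ n * D.δR ^ 2 := by
  have hn : 0 < (n : ℝ) := Nat.cast_pos.2 (Nat.pos_of_ne_zero (NeZero.ne n))
  have h1 : D.piR = 1 - Matrix.vecMulVec (fun _ => 1) ((n : ℝ)⁻¹ • D.uR) := by
    rw [NormData.piR, Matrix.vecMulVec_smul]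
  have h2 := vecNorm_mul_le_specNorm h.TR_unit h.TR_ge (a := fun _ => 1) (b := (n : ℝ)⁻¹ • D.uR)
    (by
      rw [smul_dotProduct]
      simp [dotProduct, h.uR_sum, hn.ne'])
    (by rw [← h1]; exact h.piR_norm)
  rw [vecNorm_one, vecNorm_smul, abs_of_pos (inv_pos.2 hn)] at h2
  have h3 := pow_le_pow_left₀ (by have := vecNorm_nonneg D.uR; positivity) h2 2
  rw [mul_pow, mul_pow, Real.sq_sqrt hn.le] at h3
  have h4 : (n : ℝ) * (((n : ℝ)⁻¹) ^ 2 * vecNorm D.uR ^ 2) = vecNorm D.uR ^ 2 / n := by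
    field_simp
  rw [h4, div_le_iff₀ hn] at h3
  rw [mul_comm]
  exact h3

lemma uC_le_δC [NeZero n] (h : D.Admissible R C γx γy) :
    vecNorm D.uC ^ 2 ≤ n * D.δC ^ 2 := by
  have hn : 0 < (n : ℝ) := Nat.cast_pos.2 (Nat.pos_of_ne_zero (NeZero.ne n))
  have h1 : D.piC = 1 - Matrix.vecMulVec ((n : ℝ)⁻¹ • D.uC) (fun _ => 1) := by
    rw [NormData.piC, Matrix.smul_vecMulVec]
  have h2 := vecNorm_mul_le_specNorm h.TC_unit h.TC_ge (b := fun _ => 1) (a := (n : ℝ)⁻¹ • D.uC)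
    (by
      rw [dotProduct_smul]
      simp [dotProduct, h.uC_sum, hn.ne'])
    (by rw [← h1]; exact h.piC_norm)
  rw [vecNorm_one, vecNorm_smul, abs_of_pos (inv_pos.2 hn)] at h2
  have h3 := pow_le_pow_left₀ (by have := vecNorm_nonneg D.uC; positivity) h2 2
  rw [mul_pow, mul_pow, Real.sq_sqrt hn.le] at h3
  have h4 : ((n : ℝ)⁻¹) ^ 2 * vecNorm D.uC ^ 2 * n = vecNorm D.uC ^ 2 / n := by
    field_simp
  rw [h4, div_le_iff₀ hn] at h3
  rw [mul_comm]
  exact h3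

lemma θR_le_aR (h : D.Admissible R C γx γy) (hn : 2 ≤ n) (hγ : 0 ≤ γx) :
    D.θR * γx ≤ inducedNorm D.TR (1 - R) * γx := by
  obtain ⟨v, hv, huv⟩ := exists_ne_zero_dotProduct_eq_zero hn D.uR
  refine contraction_le_step h.TR_unit hγ h.piR_norm h.contractR h.TR_ge hv ?_
  rw [NormData.piR, Matrix.sub_mulVec, Matrix.one_mulVec, Matrix.smul_mulVec,
    Matrix.vecMulVec_mulVec, huv]
  simp

lemma θC_le_aC (h : D.Admissible R C γx γy) (hn : 2 ≤ n) (hγ : 0 ≤ γy) :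
    D.θC * γy ≤ inducedNorm D.TC (1 - C) * γy := by
  obtain ⟨v, hv, huv⟩ := exists_ne_zero_dotProduct_eq_zero hn (fun _ => (1 : ℝ))
  refine contraction_le_step h.TC_unit hγ h.piC_norm h.contractC h.TC_ge hv ?_
  rw [NormData.piC, Matrix.sub_mulVec, Matrix.one_mulVec, Matrix.smul_mulVec,
    Matrix.vecMulVec_mulVec, huv]
  simp

lemma lamBar_le [NeZero n] (h : D.Admissible R C γx γy) {P : Params n}
    (hl : 0 ≤ lamHat P) : lamBar D P ≤ lamHat P * (vecNorm D.uR * vecNorm D.uC / n) := by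
  have hn : 0 < (n : ℝ) := Nat.cast_pos.2 (Nat.pos_of_ne_zero (NeZero.ne n))
  have h0 : ∑ i, D.uR i * P.lam i * D.uC i ≤ lamHat P * ∑ i, D.uR i * D.uC i := by
    rw [Finset.mul_sum]
    refine Finset.sum_le_sum fun i _ => ?_
    have := mul_le_mul_of_nonneg_right (le_lamHat P i)
      (mul_nonneg (h.uR_nonneg i) (h.uC_nonneg i))
    linarith
  rw [lamBar, inv_mul_le_iff₀ hn]
  refine h0.trans ?_
  calc _ ≤ lamHat P * (vecNorm D.uR * vecNorm D.uC) :=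
        mul_le_mul_of_nonneg_left (sum_mul_le_vecNorm_mul _ _) hl
    _ = _ := by field_simp

end NormData.Admissible

/-- The constants of the recursion for the algorithm with parameters `P`, with a gradient Lipschitz
constant `L`. -/
noncomputable def rates (D : NormData n) (P : Params n) (L M Cc r δ μ : ℝ) : Rates where
  tR := D.θR * P.γx
  tC := D.θC * P.γy
  A := D.aR P * P.γx
  B := D.aC P * P.γy
  bx := P.αx * r * δ
  bY := P.αy * r * δ
  l := lamHat P
  L := L
  u := vecNorm D.uC
  dR := D.δR
  dC := D.δC
  Cc := Cc
  e1 := D.e1 P Cc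
  e2 := D.e2 P Cc
  E := D.eE M
  K := vecNorm D.uR ^ 2 / ((n : ℝ) ^ 2 * M ^ 2)
  M := M
  μ := μ
  nn := n

/-- Squaring an inequality `a √X y ≤ √W z`. -/
lemma sq_mul_le_of_sqrt {a X y W z : ℝ} (ha : 0 ≤ a) (hX : 0 ≤ X) (hy : 0 ≤ y) (hW : 0 ≤ W)
    (h : a * √X * y ≤ √W * z) : a ^ 2 * X * y ^ 2 ≤ W * z ^ 2 := by
  have := pow_le_pow_left₀ (by positivity) h 2
  rwa [mul_pow, mul_pow, mul_pow, Real.sq_sqrt hX, Real.sq_sqrt hW] at this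

/-- A Lipschitz constant may be enlarged to a positive one without violating finitely many bounds on
its product with the step-size. -/
lemma exists_pos_lipschitz {Lm l q₁ q₂ q₃ : ℝ} (hLm : 0 ≤ Lm) (hl : 0 < l) (h₁ : 0 ≤ q₁)
    (h₂ : 0 ≤ q₂) (h₃ : 0 ≤ q₃) (b₁ : q₁ * (Lm ^ 2 * l ^ 2) ≤ 1)
    (b₂ : q₂ * (Lm ^ 2 * l ^ 2) ≤ 1) (b₃ : q₃ * (Lm ^ 2 * l ^ 2) ≤ 1) :
    ∃ L, Lm ≤ L ∧ 0 < L ∧ q₁ * (L ^ 2 * l ^ 2) ≤ 1 ∧ q₂ * (L ^ 2 * l ^ 2) ≤ 1 ∧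
      q₃ * (L ^ 2 * l ^ 2) ≤ 1 := by
  rcases hLm.eq_or_lt with h0 | hpos
  · have hsq : (1 / (l * (1 + q₁ + q₂ + q₃))) ^ 2 * l ^ 2 = 1 / (1 + q₁ + q₂ + q₃) ^ 2 := by
      field_simp
    have hz : ∀ z, z ≤ 1 + q₁ + q₂ + q₃ → z * (1 / (1 + q₁ + q₂ + q₃) ^ 2) ≤ 1 := by
      intro z hz
      rw [mul_one_div, div_le_one (by positivity)]
      nlinarith
    refine ⟨1 / (l * (1 + q₁ + q₂ + q₃)), by rw [← h0]; positivity, by positivity, ?_, ?_, ?_⟩ <;>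
    · rw [hsq]
      exact hz _ (by linarith)
  · exact ⟨Lm, le_rfl, hpos, b₁, b₂, b₃⟩

/-- The step-size conditions, with squared bounds and cleared denominators, imply those of
`Rates.Valid`. The conditions on `aR = ‖I - R‖_R` and `aC = ‖I - C‖_C` without the norm equivalence
constants are weaker than the same conditions with the factors `δ_R`, `δ_C` that the estimates
need; the latter follow from the remaining conditions by means of `θ_R ≤ aR`, `θ_C ≤ aC`,
`‖u_R‖ ≤ √n δ_R` and `‖u_C‖ ≤ √n δ_C`. -/
lemma Rates.exists_valid {θR θC γx γy tR tC aR aC A B bx bY l Lm m u dR dC Cc e1 e2 E K M n : ℝ}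
    (μ : ℝ) (htR : tR = θR * γx) (htC : tC = θC * γy) (hA : A = aR * γx) (hB : B = aC * γy)
    (hE : E = m * u / (n ^ 2 * M)) (hK : K = m ^ 2 / (n ^ 2 * M ^ 2))
    (he1 : e1 = 2 * dC ^ 2 + 4 * dC ^ 2 * aC ^ 2 * Cc) (he2ge : 4 ≤ e2)
    (hn : 0 < n) (hm : 0 < m) (hu : 0 < u) (hM : 0 < M) (hl : 0 < l) (hLm : 0 ≤ Lm)
    (hCc : 0 ≤ Cc) (hθR : 0 < θR) (hθC : 0 < θC) (hγx : 0 < γx) (hγy : 0 < γy) (hγy1 : γy ≤ 1)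
    (htC1 : tC ≤ 1) (htRA : tR ≤ A) (hθCa : θC ≤ aC)
    (hdR1 : 1 ≤ dR) (hdC1 : 1 ≤ dC) (hmd : m ^ 2 ≤ n * dR ^ 2) (hud : u ^ 2 ≤ n * dC ^ 2)
    (hMmu : M * n ≤ m * u) (hbx0 : 0 < bx) (hbx1 : bx ≤ 1) (hbY0 : 0 < bY) (hbY1 : bY ≤ 1)
    (b1 : 36 * (Lm ^ 2 * l ^ 2) ≤ 1)
    (b4 : 6 * e1 * aC ^ 2 * (Lm ^ 2 * l ^ 2) ≤ θC ^ 2)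
    (b5 : 384 * (dR ^ 2 * (1 - tR) ^ 2 * E * u ^ 2) * (Lm ^ 2 * l ^ 2) ≤ tR ^ 2)
    (g2 : 4608 * (Cc * dR ^ 2 * aR ^ 4 * γx ^ 2) ≤ θR ^ 2 * bx ^ 2)
    (g6 : 12 * m * e1 * A ^ 2 ≤ M * u * tC ^ 2)
    (y2 : 48 * e1 * aC ^ 2 * γy ≤ θC * e2)
    (y3 : 64 * Cc * e2 * dC ^ 2 * aC ^ 2 * γy ≤ θC * bY ^ 2 * e1)
    (y4 : 48 * Cc * e2 * aC ^ 2 * γy ≤ θC * bY ^ 2) :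
    ∃ L, Lm ≤ L ∧
      (Rates.mk tR tC A B bx bY l L u dR dC Cc e1 e2 E K M μ n).Valid ∧
      L * (l * (m * u / n)) ≤ 1 ∧ 24 * A ^ 2 ≤ 1 := by
  have htR0 : 0 < tR := by rw [htR]; positivity
  have htC0 : 0 < tC := by rw [htC]; positivity
  have haC0 : 0 < aC := hθC.trans_le hθCa
  have hA0 : 0 < A := htR0.trans_le htRA
  have hB0 : 0 < B := by rw [hB]; positivity
  have htCB : tC ≤ B := by rw [htC, hB]; gcongr
  have hE0 : 0 < E := by rw [hE]; positivity
  have he1pos : 0 < e1 := by rw [he1]; positivity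
  have he1d : 2 * dC ^ 2 ≤ e1 := by
    rw [he1]; exact le_add_of_nonneg_right (by positivity)
  have he2pos : 0 < e2 := by linarith only [he2ge]
  have g2' : 4608 * (Cc * dR ^ 2 * A ^ 4) ≤ tR ^ 2 * bx ^ 2 := by
    have := mul_le_mul_of_nonneg_right g2 (sq_nonneg γx)
    rw [hA, htR]
    linarith only [this]
  have y2' : 48 * (e1 * B ^ 2) ≤ tC * e2 := by
    have := mul_le_mul_of_nonneg_right y2 hγy.le
    rw [hB, htC]
    linarith only [this]
  have y3' : 64 * (Cc * e2 * dC ^ 2 * B ^ 2) ≤ tC * bY ^ 2 * e1 := by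
    have := mul_le_mul_of_nonneg_right y3 hγy.le
    rw [hB, htC]
    linarith only [this]
  have y4' : 48 * (Cc * e2 * B ^ 2) ≤ tC * bY ^ 2 := by
    have := mul_le_mul_of_nonneg_right y4 hγy.le
    rw [hB, htC]
    linarith only [this]
  have y5 : 3072 * (Cc * B ^ 2 * dC ^ 2) ≤ bY ^ 2 := by
    have h1 := mul_le_mul y3' y2' (by positivity) (by positivity)
    have h2 : e1 * e2 * (3072 * (Cc * B ^ 2 * dC ^ 2) * B ^ 2) ≤ e1 * e2 * (bY ^ 2 * tC ^ 2) := by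
      linarith only [h1]
    have h3 := le_of_mul_le_mul_left h2 (by positivity)
    have h4 : bY ^ 2 * tC ^ 2 ≤ bY ^ 2 * B ^ 2 := by gcongr
    exact le_of_mul_le_mul_right (h3.trans h4) (by positivity)
  have y6 : 96 * (dC ^ 2 * B ^ 2) ≤ e2 := by
    have h1 := mul_le_mul_of_nonneg_right he1d (sq_nonneg B)
    have h2 := mul_le_mul_of_nonneg_right htC1 he2pos.le
    linarith only [h1, h2, y2']
  have a24 : 24 * A ^ 2 ≤ tC ^ 2 := by
    have h1 : M * n * (u * tC ^ 2) ≤ m * u * (u * tC ^ 2) := by gcongr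
    have h2 : 12 * m * A ^ 2 * (2 * u ^ 2) ≤ 12 * m * A ^ 2 * (n * e1) := by
      have h0 := mul_le_mul_of_nonneg_left he1d hn.le
      exact mul_le_mul_of_nonneg_left (by linarith only [h0, hud]) (by positivity)
    have h3 := mul_le_mul_of_nonneg_left g6 hn.le
    have h4 : m * u ^ 2 * (24 * A ^ 2) ≤ m * u ^ 2 * tC ^ 2 := by linarith only [h1, h2, h3]
    exact le_of_mul_le_mul_left h4 (by positivity)
  have a24' : 24 * A ^ 2 ≤ 1 := a24.trans (pow_le_one₀ htC0.le htC1)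
  have htRA2 : tR ^ 2 ≤ A ^ 2 := pow_le_pow_left₀ htR0.le htRA 2
  -- `tR ≤ 1 / √24`, so that `1 - tR` is bounded below
  have htR2 : tR ≤ 41 / 200 := by nlinarith only [htRA2, a24', htR0]
  have hone : 240 ≤ 384 * (1 - tR) ^ 2 := by nlinarith only [htR2, htR0]
  obtain ⟨L, hLL, hL0, s1, s4, s5⟩ := exists_pos_lipschitz (q₁ := 36)
    (q₂ := 6 * e1 * aC ^ 2 / θC ^ 2)
    (q₃ := 384 * (dR ^ 2 * (1 - tR) ^ 2 * E * u ^ 2) / tR ^ 2) hLm hl (by norm_num)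
    (by positivity) (by positivity) b1
    (by rw [div_mul_eq_mul_div]; exact (div_le_one (by positivity)).2 b4)
    (by rw [div_mul_eq_mul_div]; exact (div_le_one (by positivity)).2 b5)
  rw [div_mul_eq_mul_div, div_le_one (by positivity)] at s4 s5
  have hLl : 0 ≤ L ^ 2 * l ^ 2 := by positivity
  have s5' : 240 * (dR ^ 2 * E * u ^ 2 * (L ^ 2 * l ^ 2)) ≤ tR ^ 2 := by
    have := mul_le_mul_of_nonneg_right hone
      (show 0 ≤ dR ^ 2 * E * u ^ 2 * (L ^ 2 * l ^ 2) by positivity)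
    linarith only [this, s5]
  have hlC : 6 * (e1 * (L ^ 2 * l ^ 2)) ≤ 1 := by
    have h1 : θC ^ 2 ≤ aC ^ 2 := pow_le_pow_left₀ hθC.le hθCa 2
    have h2 : aC ^ 2 * (6 * (e1 * (L ^ 2 * l ^ 2))) ≤ aC ^ 2 * 1 := by linarith only [s4, h1]
    exact le_of_mul_le_mul_left h2 (by positivity)
  have hle1 : 6 * (e1 * B ^ 2 * (L ^ 2 * l ^ 2)) ≤ tC ^ 2 := by
    have := mul_le_mul_of_nonneg_right s4 (sq_nonneg γy)
    rw [hB, htC]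
    linarith only [this]
  refine ⟨L, hLL, ?_, ?_, a24'⟩
  · exact
      { tR_pos := htR0
        tR_le_A := htRA
        tC_pos := htC0
        tC_le := htC1
        bx_pos := hbx0
        bx_le := hbx1
        by_pos := hbY0
        by_le := hbY1
        l_pos := hl
        L_pos := hL0
        u_pos := hu
        Cc_nonneg := hCc
        e1_pos := he1pos
        e2_ge := he2ge
        E_pos := hE0
        M_pos := hM
        nn_pos := hn
        one_le_Ku := by
          change 1 ≤ K * u ^ 2
          rw [hK, div_mul_eq_mul_div, one_le_div (by positivity)]
          have := pow_le_pow_left₀ (by positivity) hMmu 2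
          linarith only [this]
        one_le_En := by
          change 1 ≤ E * n
          rw [hE, div_mul_eq_mul_div, one_le_div (by positivity)]
          have := mul_le_mul_of_nonneg_right hMmu hn.le
          linarith only [this]
        K_le := by
          change 12 * e1 * A ^ 2 * K ≤ E * tC ^ 2
          have := mul_le_mul_of_nonneg_right g6 (show 0 ≤ m / (n ^ 2 * M ^ 2) by positivity)
          calc _ = 12 * m * e1 * A ^ 2 * (m / (n ^ 2 * M ^ 2)) := by rw [hK]; ring
            _ ≤ _ := this
            _ = _ := by rw [hE]; field_simp
        lam_R := by
          change 384 * (dR ^ 2 * (1 - tR) ^ 2 * E * u ^ 2 * (L ^ 2 * l ^ 2)) ≤ tR ^ 2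
          linarith only [s5]
        lam_R' := s5'
        comp_x := g2'
        lam_e1 := hle1
        lam_L := s1
        lam_dC := by
          change 12 * (dC ^ 2 * (L ^ 2 * l ^ 2)) ≤ 1
          have := mul_le_mul_of_nonneg_right he1d hLl
          linarith only [this, hlC]
        lam_dCB := by
          change 12 * (dC ^ 2 * B ^ 2 * (L ^ 2 * l ^ 2)) ≤ 1
          have h1 := mul_le_mul_of_nonneg_right he1d
            (show 0 ≤ B ^ 2 * (L ^ 2 * l ^ 2) by positivity)
          have h2 : tC ^ 2 ≤ 1 := pow_le_one₀ htC0.le htC1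
          linarith only [h1, h2, hle1]
        e1_B := y2'
        comp_y := y3'
        comp_y' := y4'
        comp_y'' := y5
        dC_B := y6
        e1_ge := by
          change 2 * dC ^ 2 + 4 * (dC ^ 2 * B ^ 2 * Cc) ≤ e1
          have h1 : B ^ 2 ≤ aC ^ 2 := by
            rw [hB]
            exact pow_le_pow_left₀ (by positivity) (mul_le_of_le_one_right haC0.le hγy1) 2
          have := mul_le_mul_of_nonneg_left h1 (show 0 ≤ 4 * (dC ^ 2 * Cc) by positivity)
          rw [he1]
          linarith only [this] }
  · have h1 : (m * u / n) ^ 2 ≤ dR ^ 2 * E * u ^ 2 := by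
      have h2 : (m * u / n) ^ 2 * (M * n) ≤ (m * u / n) ^ 2 * (m * u) := by gcongr
      have h3 : m ^ 2 * (E * u ^ 2) ≤ n * dR ^ 2 * (E * u ^ 2) := by gcongr
      have h4 : m ^ 2 * (E * u ^ 2) * M = (m * u / n) ^ 2 * (m * u) := by
        rw [hE]; field_simp
      have h5 := mul_le_mul_of_nonneg_right h3 hM.le
      have h6 : (M * n) * (m * u / n) ^ 2 ≤ (M * n) * (dR ^ 2 * E * u ^ 2) := by
        linarith only [h2, h4, h5]
      exact le_of_mul_le_mul_left h6 (by positivity)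
    have h2 := mul_le_mul_of_nonneg_right h1 hLl
    have h3 : (L * (l * (m * u / n))) ^ 2 ≤ 1 ^ 2 := by
      have h4 : (L * (l * (m * u / n))) ^ 2 = (m * u / n) ^ 2 * (L ^ 2 * l ^ 2) := by ring
      rw [h4]
      linarith only [h2, s5', htRA2, a24']
    exact le_of_sq_le_sq h3 zero_le_one

/-- The step-size conditions imply those of the analysis, if there are at least two agents. -/
lemma exists_rates_valid [NeZero n] (hn2 : 2 ≤ n) {D : NormData n} {P : Params n}
    (hD : D.Admissible P.R P.C P.γx P.γy) {Lm M Cc r δ : ℝ} (μ : ℝ) (hLm : 0 ≤ Lm)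
    (hl : 0 < lamHat P) (hM : 0 < M) (hMl : M * lamHat P ≤ lamBar D P) (hCc : 0 ≤ Cc)
    (hr : 0 < r) (hδ : 0 < δ) (hδ1 : δ ≤ 1) (hαx : 0 < P.αx) (hαx1 : P.αx ≤ 1 / r)
    (hαy : 0 < P.αy) (hαy1 : P.αy ≤ 1 / r) (hγx : 0 < P.γx) (hγy : 0 < P.γy)
    (hs : StepSizeBound D P Lm M Cc) (hx : GammaXBound D P M Cc r δ)
    (hy : GammaYBound D P Cc r δ) :
    ∃ L, Lm ≤ L ∧ (rates D P L M Cc r δ μ).Valid ∧ L * lamBar D P ≤ 1 ∧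
      24 * (D.aR P * P.γx) ^ 2 ≤ 1 := by
  have hn : 0 < (n : ℝ) := Nat.cast_pos.2 (Nat.pos_of_ne_zero (NeZero.ne n))
  have hm : 0 < vecNorm D.uR := vecNorm_pos hD.uR_ne_zero
  have hu : 0 < vecNorm D.uC := vecNorm_pos hD.uC_ne_zero
  have hlam := hD.lamBar_le hl.le
  have hMmu : M * n ≤ vecNorm D.uR * vecNorm D.uC := by
    have h1 := hMl.trans hlam
    rw [mul_comm] at h1
    exact (le_div_iff₀ hn).1 (le_of_mul_le_mul_left h1 hl)
  have htR1 : D.θR * P.γx ≤ 1 := by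
    have := (inducedNorm_nonneg D.TR (D.piR * relaxed P.R P.γx)).trans hD.contractR
    linarith
  have htC1 : D.θC * P.γy ≤ 1 := by
    have := (inducedNorm_nonneg D.TC (D.piC * relaxed P.C P.γy)).trans hD.contractC
    linarith
  have htRA : D.θR * P.γx ≤ D.aR P * P.γx := hD.θR_le_aR hn2 hγx.le
  have htCB : D.θC * P.γy ≤ D.aC P * P.γy := hD.θC_le_aC hn2 hγy.le
  have haR0 : 0 < D.aR P := hD.θR_pos.trans_le (le_of_mul_le_mul_right htRA hγx)
  have hdC1 : 1 ≤ D.δC := one_le_specNorm hD.TC_ge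
  have he1 : D.e1 P Cc = 2 * D.δC ^ 2 + 4 * D.δC ^ 2 * D.aC P ^ 2 * Cc := rfl
  have he10 : 0 < D.e1 P Cc := by rw [he1]; positivity
  have hE0 : 0 < D.eE M := by unfold NormData.eE; positivity
  have h36 : 0 < 36 * D.aR P ^ 2 := by positivity
  have h3 : 0 < 3 * D.aR P ^ 2 := by positivity
  obtain ⟨L, h1, h2, h3, h4⟩ := Rates.exists_valid (γx := P.γx) (γy := P.γy) (θR := D.θR)
    (θC := D.θC) (aR := D.aR P) (aC := D.aC P) (bx := P.αx * r * δ) (bY := P.αy * r * δ)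
    (l := lamHat P) (Lm := Lm) (dR := D.δR) (e2 := D.e2 P Cc) μ rfl rfl rfl rfl
    (show D.eE M = _ from rfl) rfl he1
    (le_add_of_nonneg_left (by have := hCc; unfold NormData.d3; positivity))
    hn hm hu hM hl hLm hCc hD.θR_pos hD.θC_pos hγx hγy hy.b1 htC1 htRA
    (le_of_mul_le_mul_right htCB hγy) (one_le_specNorm hD.TR_ge) hdC1 hD.uR_le_δR hD.uC_le_δC
    hMmu (by positivity)
    (mul_le_one₀ ((le_div_iff₀ hr).1 hαx1) hδ.le hδ1) (by positivity)
    (mul_le_one₀ ((le_div_iff₀ hr).1 hαy1) hδ.le hδ1)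
    (by
      have := pow_le_pow_left₀ (by positivity) hs.b1 2
      linarith only [this])
    (by
      have h0 := sq_mul_le_of_sqrt (a := 2) (X := D.e1 P Cc * D.c32 P * D.c43 P) (W := D.d42 P)
        (z := D.θC) (y := Lm * lamHat P) (by norm_num)
        (by unfold NormData.c32 NormData.c43; positivity) (by positivity) h36.le
        (by linarith only [hs.b4])
      have hc32 : D.c32 P = 3 * D.aR P ^ 2 := rfl
      have hc43 : D.c43 P = 18 * D.aC P ^ 2 := rfl
      have hd42 : D.d42 P = 36 * D.aR P ^ 2 := rfl
      rw [hc32, hc43, hd42] at h0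
      refine le_of_mul_le_mul_left (a := 36 * D.aR P ^ 2) ?_ h36
      linarith only [h0])
    (by
      have hb := hs.b5a
      rw [show D.c2 = D.δR ^ 2 from rfl,
        Real.sqrt_sq (show 0 ≤ D.δR from specNorm_nonneg _)] at hb
      have hdR : 0 ≤ D.δR := specNorm_nonneg _
      have ht : 0 ≤ 1 - D.θR * P.γx := by linarith only [htR1]
      have h0 := sq_mul_le_of_sqrt
        (a := 2 * D.δR * (1 - D.θR * P.γx) * vecNorm D.uC * Lm * lamHat P) (X := 96 * D.eE M)
        (y := 1) (W := 1) (z := D.θR * P.γx) (by positivity) (by positivity) zero_le_one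
        zero_le_one (by rw [Real.sqrt_one]; linarith only [hb])
      linarith only [h0])
    (by
      have h0 := sq_mul_le_of_sqrt (a := 8) (X := Cc * D.d42 P * D.c24 P) (y := P.γx) (W := 1)
        (z := D.θR * (P.αx * r * δ)) (by norm_num)
        (by unfold NormData.d42 NormData.c24; positivity) hγx.le zero_le_one
        (by rw [Real.sqrt_one]; linarith only [hx.b2])
      rw [show D.d42 P = 36 * D.aR P ^ 2 from rfl,
        show D.c24 P = 2 * D.δR ^ 2 * D.aR P ^ 2 from rfl] at h0
      linarith only [h0])
    (by
      have h0 := sq_mul_le_of_sqrt (a := 2) (X := vecNorm D.uR * D.e1 P Cc * D.c32 P)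
        (y := P.γx) (W := M * vecNorm D.uC) (z := D.θC * P.γy) (by norm_num)
        (by unfold NormData.c32; positivity) hγx.le (by positivity) (by linarith only [hx.b6])
      rw [show D.c32 P = 3 * D.aR P ^ 2 from rfl] at h0
      linarith only [h0])
    (by
      have h0 := hy.b2
      rw [show D.c32 P = 3 * D.aR P ^ 2 from rfl, show D.d52 P = 3 * D.aR P ^ 2 from rfl,
        show D.d53 P = 12 * D.aC P ^ 2 from rfl] at h0
      refine le_of_mul_le_mul_left (a := 3 * D.aR P ^ 2) ?_ h3
      linarith only [h0])
    (by
      have h0 := hy.b3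
      rw [show D.c32 P = 3 * D.aR P ^ 2 from rfl, show D.d52 P = 3 * D.aR P ^ 2 from rfl,
        show D.c35 P = 4 * D.δC ^ 2 * D.aC P ^ 2 from rfl] at h0
      refine le_of_mul_le_mul_left (a := 3 * D.aR P ^ 2) ?_ h3
      linarith only [h0])
    (by
      have h0 := hy.b4
      rw [show D.d42 P = 36 * D.aR P ^ 2 from rfl, show D.d52 P = 3 * D.aR P ^ 2 from rfl,
        show D.c45 P = 36 * D.aC P ^ 2 from rfl] at h0
      refine le_of_mul_le_mul_left (a := 36 * D.aR P ^ 2) ?_ h36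
      linarith only [h0])
  exact ⟨L, h1, h2, (mul_le_mul_of_nonneg_left hlam (hLm.trans h1)).trans h3, h4⟩

end Constants

/-! ### One iteration of the algorithm -/

section Step

variable {n p : ℕ}

/-- Convexity of the square, applied to `(1 - t) x + t (w / t)`. -/
lemma sq_le_of_le_convex {a x w t : ℝ} (ha : 0 ≤ a) (ht : 0 < t) (ht1 : t ≤ 1)
    (h : a ≤ (1 - t) * x + w) : a ^ 2 ≤ (1 - t) * x ^ 2 + w ^ 2 / t := by
  have h1 : a ^ 2 ≤ ((1 - t) * x + w) ^ 2 := pow_le_pow_left₀ ha h 2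
  have h2 : (1 - t) * x ^ 2 + w ^ 2 / t - ((1 - t) * x + w) ^ 2 =
      (1 - t) * (t * x - w) ^ 2 / t := by
    field_simp
    ring
  have h3 : 0 ≤ (1 - t) * (t * x - w) ^ 2 / t :=
    div_nonneg (mul_nonneg (by linarith) (sq_nonneg _)) ht.le
  linarith

/-- Convexity of the square, applied to `(1 - t) (x / (1 - t)) + t (w / t)`. -/
lemma sq_le_of_le_add {a x w t : ℝ} (ha : 0 ≤ a) (ht : 0 < t) (ht1 : t < 1) (h : a ≤ x + w) :
    a ^ 2 ≤ x ^ 2 / (1 - t) + w ^ 2 / t := by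
  have h0 : 0 < 1 - t := by linarith
  have h1 : a ^ 2 ≤ (x + w) ^ 2 := pow_le_pow_left₀ ha h 2
  have h2 : x ^ 2 / (1 - t) + w ^ 2 / t - (x + w) ^ 2 =
      (t * x - (1 - t) * w) ^ 2 / ((1 - t) * t) := by
    field_simp
    ring
  have h3 : 0 ≤ (t * x - (1 - t) * w) ^ 2 / ((1 - t) * t) := by positivity
  linarith

lemma sq_le_two_mul {a x y : ℝ} (ha : 0 ≤ a) (h : a ≤ x + y) : a ^ 2 ≤ 2 * (x ^ 2 + y ^ 2) := by
  have h1 : a ^ 2 ≤ (x + y) ^ 2 := pow_le_pow_left₀ ha h 2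
  nlinarith [sq_nonneg (x - y)]

lemma sq_le_three_mul {a x y z : ℝ} (ha : 0 ≤ a) (h : a ≤ x + y + z) :
    a ^ 2 ≤ 3 * (x ^ 2 + y ^ 2 + z ^ 2) := by
  have h1 : a ^ 2 ≤ (x + y + z) ^ 2 := pow_le_pow_left₀ ha h 2
  nlinarith [sq_nonneg (x - y), sq_nonneg (y - z), sq_nonneg (x - z)]

lemma sq_le_four_mul {a x y z w : ℝ} (ha : 0 ≤ a) (h : a ≤ x + y + z + w) :
    a ^ 2 ≤ 4 * (x ^ 2 + y ^ 2 + z ^ 2 + w ^ 2) := by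
  have h1 : a ^ 2 ≤ (x + y + z + w) ^ 2 := pow_le_pow_left₀ ha h 2
  nlinarith [sq_nonneg (x - y), sq_nonneg (y - z), sq_nonneg (x - z), sq_nonneg (x - w),
    sq_nonneg (y - w), sq_nonneg (z - w)]

/-! #### Relaxed mixing -/

lemma relaxed_mix (A : Matrix (Fin n) (Fin n) ℝ) (γ : ℝ) (X : Rows n p) :
    mix (relaxed A γ) X = X - γ • mix (1 - A) X := by
  rw [relaxed, sub_mix, one_mix, smul_mix]

/-- A mixing step in which `X` is transmitted as `Xh`. -/
lemma mixing_step_eq (A : Matrix (Fin n) (Fin n) ℝ) (γ : ℝ) (X Xh : Rows n p) :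
    X - γ • (Xh - mix A Xh) = mix (relaxed A γ) X + γ • mix (1 - A) (X - Xh) := by
  rw [relaxed_mix, mix_sub, sub_mix 1 A Xh, one_mix]
  module

/-- A relaxed mixing step contracts the distance of `Z` to consensus, measured by `T` and the
projection `Q`, up to a perturbation `W` of its input and an error `e` in the transmission. -/
lemma frob_mixing_contraction {T Q A : Matrix (Fin n) (Fin n) ℝ} {γ t : ℝ} (hT : IsUnit T)
    (hγ : 0 ≤ γ) (hQ : inducedNorm T Q ≤ 1) (hc : inducedNorm T (Q * relaxed A γ) ≤ 1 - t)
    (hQA : Q * relaxed A γ * Q = Q * relaxed A γ) (Z W e : Rows n p) :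
    frob (mix T (mix Q (mix (relaxed A γ) (Z + W) + γ • mix (1 - A) e))) ≤
      (1 - t) * frob (mix T (mix Q Z)) + ((1 - t) * specNorm T * frob W +
        inducedNorm T (1 - A) * γ * specNorm T * frob e) := by
  have ht : 0 ≤ 1 - t := (inducedNorm_nonneg _ _).trans hc
  have h1 : mix T (mix Q (mix (relaxed A γ) (Z + W) + γ • mix (1 - A) e)) =
      mix T (mix (Q * relaxed A γ) (mix Q Z)) + mix T (mix (Q * relaxed A γ) W) +
        γ • mix T (mix Q (mix (1 - A) e)) := by
    rw [← mul_mix _ Q Z, hQA, mul_mix, mul_mix]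
    simp only [mix_add, mix_smul]
  have h2 : frob (mix T (mix (Q * relaxed A γ) (mix Q Z))) ≤ (1 - t) * frob (mix T (mix Q Z)) :=
    (frob_mix_mix_le hT _ _).trans (mul_le_mul_of_nonneg_right hc (frob_nonneg _))
  have h3 : frob (mix T (mix (Q * relaxed A γ) W)) ≤ (1 - t) * (specNorm T * frob W) :=
    (frob_mix_mix_le hT _ _).trans
      (mul_le_mul hc (frob_mix_le T W) (frob_nonneg _) ht)
  have h4 : frob (γ • mix T (mix Q (mix (1 - A) e))) ≤
      γ * (inducedNorm T (1 - A) * (specNorm T * frob e)) := by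
    rw [frob_smul, abs_of_nonneg hγ]
    refine mul_le_mul_of_nonneg_left ?_ hγ
    refine (frob_mix_mix_le hT _ _).trans ?_
    refine (mul_le_of_le_one_left (frob_nonneg _) hQ).trans ?_
    exact (frob_mix_mix_le hT _ _).trans
      (mul_le_mul_of_nonneg_left (frob_mix_le T e) (inducedNorm_nonneg _ _))
  rw [h1]
  have h5 := (frob_add_le (mix T (mix (Q * relaxed A γ) (mix Q Z)) +
    mix T (mix (Q * relaxed A γ) W)) (γ • mix T (mix Q (mix (1 - A) e)))).trans
    (add_le_add_left (frob_add_le _ _) _)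
  linarith

/-- The displacement by a mixing step, in the Euclidean norm. -/
lemma frob_mixing_displacement {T Q A : Matrix (Fin n) (Fin n) ℝ} {γ : ℝ} (hT : IsUnit T)
    (hge : ∀ v, vecNorm v ≤ vecNorm (T.mulVec v)) (hγ : 0 ≤ γ) (hQA : (1 - A) * Q = 1 - A)
    (Z W e : Rows n p) :
    frob (mix (relaxed A γ) (Z + W) + γ • mix (1 - A) e - (Z + W)) ≤
      inducedNorm T (1 - A) * γ * frob (mix T (mix Q Z)) +
      inducedNorm T (1 - A) * γ * specNorm T * frob W +
      inducedNorm T (1 - A) * γ * specNorm T * frob e := by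
  have hbd : ∀ V : Rows n p, frob (γ • mix (1 - A) V) ≤
      inducedNorm T (1 - A) * γ * frob (mix T V) := by
    intro V
    rw [frob_smul, abs_of_nonneg hγ]
    calc _ ≤ γ * (inducedNorm T (1 - A) * frob (mix T V)) :=
          mul_le_mul_of_nonneg_left ((frob_le_frob_mix hge _).trans (frob_mix_mix_le hT _ _)) hγ
      _ = _ := by ring
  have h1 : mix (relaxed A γ) (Z + W) + γ • mix (1 - A) e - (Z + W) =
      -(γ • mix (1 - A) (mix Q Z)) - γ • mix (1 - A) W + γ • mix (1 - A) e := by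
    rw [relaxed_mix, ← mul_mix, hQA, mix_add, smul_add]
    abel
  have hc : 0 ≤ inducedNorm T (1 - A) * γ := mul_nonneg (inducedNorm_nonneg _ _) hγ
  have h2 := hbd (mix Q Z)
  have h3 := (hbd W).trans (mul_le_mul_of_nonneg_left (frob_mix_le T W) hc)
  have h4 := (hbd e).trans (mul_le_mul_of_nonneg_left (frob_mix_le T e) hc)
  rw [h1]
  have h5 := (frob_add_le (-(γ • mix (1 - A) (mix Q Z)) - γ • mix (1 - A) W)
    (γ • mix (1 - A) e)).trans (add_le_add_left (frob_sub_le _ _) _)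
  rw [frob_neg] at h5
  linarith

/-! #### Averages and projections -/

lemma wavg_sub (D : NormData n) (X Y : Rows n p) :
    wavg D (X - Y) = wavg D X - wavg D Y := by
  simp [wavg, smul_sub]

lemma wavg_smul (D : NormData n) (c : ℝ) (X : Rows n p) :
    wavg D (c • X) = c • wavg D X := by
  simp [wavg, Finset.smul_sum, smul_comm c]

lemma sum_mix_of_colStochastic {C : Matrix (Fin n) (Fin n) ℝ}
    (hC : C ∈ Matrix.colStochastic ℝ (Fin n))
    (Y : Rows n p) : ∑ i, mix C Y i = ∑ i, Y i := by
  simp only [mix]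
  rw [Finset.sum_comm]
  refine Finset.sum_congr rfl fun j _ => ?_
  rw [← Finset.sum_smul, Matrix.sum_col_of_mem_colStochastic hC, one_smul]

namespace NormData.Admissible

variable {D : NormData n} {R C : Matrix (Fin n) (Fin n) ℝ} {γx γy : ℝ}

lemma sub_mul_piR (D : NormData n) (hR : R ∈ Matrix.rowStochastic ℝ (Fin n)) :
    (1 - R) * D.piR = 1 - R := by
  have h1 : R.mulVec (fun _ => 1) = fun _ => 1 := Matrix.one_vecMul_of_mem_rowStochastic hR
  rw [NormData.piR, Matrix.mul_sub, Matrix.mul_one, Matrix.mul_smul, Matrix.mul_vecMulVec,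
    Matrix.sub_mulVec, h1, Matrix.one_mulVec, sub_self, Matrix.zero_vecMulVec, smul_zero,
    sub_zero]

lemma sub_mul_piC (h : D.Admissible R C γx γy) : (1 - C) * D.piC = 1 - C := by
  rw [NormData.piC, Matrix.mul_sub, Matrix.mul_one, Matrix.mul_smul, Matrix.mul_vecMulVec,
    Matrix.sub_mulVec, h.uC_eigen, Matrix.one_mulVec, sub_self, Matrix.zero_vecMulVec, smul_zero,
    sub_zero]

lemma piR_mul_self [NeZero n] (h : D.Admissible R C γx γy) : D.piR * D.piR = D.piR :=
  consensusProj_mul_self h.uR_sum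

lemma piC_mul_self [NeZero n] (h : D.Admissible R C γx γy) : D.piC * D.piC = D.piC := by
  have h1 : D.piC = (consensusProj D.uC).transpose := by
    simp [NormData.piC, consensusProj, Matrix.transpose_vecMulVec]
  rw [h1, ← Matrix.transpose_mul, consensusProj_mul_self h.uC_sum]

lemma mul_relaxed_mul {Q A : Matrix (Fin n) (Fin n) ℝ} (hQ : Q * Q = Q)
    (hQA : (1 - A) * Q = 1 - A) (γ : ℝ) : Q * relaxed A γ * Q = Q * relaxed A γ := by
  rw [relaxed, Matrix.mul_assoc, Matrix.sub_mul, Matrix.smul_mul, hQA, Matrix.one_mul,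
    Matrix.mul_sub, hQ, Matrix.mul_sub, Matrix.mul_one]

lemma mix_piR_apply (D : NormData n) (X : Rows n p) (i : Fin n) :
    mix D.piR X i = X i - wavg D X := by
  rw [NormData.piR, sub_mix, one_mix, smul_mix]
  simp [mix, wavg, Matrix.vecMulVec_apply]

lemma mix_piC_apply (D : NormData n) (Y : Rows n p) (i : Fin n) :
    mix D.piC Y i = Y i - D.uC i • ((n : ℝ)⁻¹ • ∑ j, Y j) := by
  rw [NormData.piC, sub_mix, one_mix, smul_mix]
  simp [mix, Matrix.vecMulVec_apply, ← Finset.smul_sum, smul_comm (D.uC i)]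

lemma wavg_mix (h : D.Admissible R C γx γy) (X : Rows n p) : wavg D (mix R X) = wavg D X := by
  simp only [wavg, mix, Finset.smul_sum, smul_smul]
  rw [Finset.sum_comm]
  refine Finset.sum_congr rfl fun j _ => ?_
  rw [← Finset.sum_smul, ← congrFun h.uR_eigen j]
  congr 1
  simp [Matrix.vecMul, dotProduct, Finset.mul_sum]

end NormData.Admissible

lemma sum_mul_norm_le (a : Fin n → ℝ) (X : Rows n p) :
    ∑ i, a i * ‖X i‖ ≤ vecNorm a * frob X :=
  Real.sum_mul_le_sqrt_mul_sqrt _ _ _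

/-! #### The objective at the weighted average -/

variable {f : Fin n → Dec p → ℝ} {Ls : Fin n → ℝ≥0} {μ : ℝ} {xs : Dec p}

/-- The average of the local gradients differs from the gradient at the weighted average by the
consensus error. -/
lemma norm_avg_grad_sub_le [NeZero n] (hf : ObjectiveAssumption f Ls μ xs) {L : ℝ}
    (hL : Lmax Ls ≤ L) (D : NormData n) (X : Rows n p) :
    ‖(n : ℝ)⁻¹ • ∑ i, gradient (f i) (X i) - gradient (avgObj f) (wavg D X)‖ ^ 2 ≤
      L ^ 2 / n * frob (mix D.piR X) ^ 2 := by
  have hn : 0 < (n : ℝ) := Nat.cast_pos.2 (Nat.pos_of_ne_zero (NeZero.ne n))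
  have hL0 := (Lmax_nonneg Ls).trans hL
  rw [hf.gradient_avgObj, ← smul_sub, ← Finset.sum_sub_distrib, norm_smul, Real.norm_eq_abs,
    abs_of_pos (inv_pos.2 hn)]
  have h1 : ‖∑ i, (gradient (f i) (X i) - gradient (f i) (wavg D X))‖ ≤
      L * (√n * frob (mix D.piR X)) := by
    calc _ ≤ ∑ i, L * ‖mix D.piR X i‖ := by
          refine (norm_sum_le _ _).trans (Finset.sum_le_sum fun i _ => ?_)
          rw [NormData.Admissible.mix_piR_apply]
          exact hf.norm_gradient_sub_le hL i _ _
      _ = L * ∑ i, 1 * ‖mix D.piR X i‖ := by simp [Finset.mul_sum]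
      _ ≤ _ := by
        rw [← vecNorm_one]
        exact mul_le_mul_of_nonneg_left (sum_mul_norm_le _ _) hL0
  calc _ ≤ ((n : ℝ)⁻¹ * (L * (√n * frob (mix D.piR X)))) ^ 2 := by gcongr
    _ = _ := by
      rw [mul_pow, mul_pow, mul_pow, Real.sq_sqrt hn.le]
      field_simp

/-- Decrease of the optimality gap in one iteration. -/
lemma gap_step [NeZero n] (hf : ObjectiveAssumption f Ls μ xs) {L : ℝ} (hL : Lmax Ls ≤ L)
    {D : NormData n} {R C : Matrix (Fin n) (Fin n) ℝ} {γx γy : ℝ}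
    (hD : D.Admissible R C γx γy) {P : Params n} (hlam0 : ∀ i, 0 ≤ P.lam i) {M : ℝ} (hM : 0 < M)
    (hl : 0 < lamHat P) (hMl : M * lamHat P ≤ lamBar D P) (hLl : L * lamBar D P ≤ 1)
    (X Y : Rows n p) (hY : ∑ i, Y i = ∑ i, gradient (f i) (X i)) :
    avgObj f (wavg D X - wavg D (fun i => P.lam i • Y i)) ≤ avgObj f (wavg D X) -
      M * lamHat P / 2 * ‖gradient (avgObj f) (wavg D X)‖ ^ 2 +
      M * lamHat P * (D.eE M * L ^ 2) * frob (mix D.piR X) ^ 2 +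
      M * lamHat P * (vecNorm D.uR ^ 2 / ((n : ℝ) ^ 2 * M ^ 2)) * frob (mix D.piC Y) ^ 2 := by
  have hn : 0 < (n : ℝ) := Nat.cast_pos.2 (Nat.pos_of_ne_zero (NeZero.ne n))
  have hL0 := (Lmax_nonneg Ls).trans hL
  have hlb : 0 < lamBar D P := (mul_pos hM hl).trans_le hMl
  set G := gradient (avgObj f) (wavg D X) with hG
  set yb : Dec p := (n : ℝ)⁻¹ • ∑ i, Y i with hyb
  set q : Dec p := wavg D (fun i => P.lam i • mix D.piC Y i) with hq
  -- `Y = u_C ȳ + Π_C Y`, so the weighted average moves along `ȳ` with step-size `λ̄`, up to `q`.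
  have hdec : wavg D (fun i => P.lam i • Y i) =
      lamBar D P • (G + ((yb - G) + (lamBar D P)⁻¹ • q)) := by
    have h1 : wavg D (fun i => P.lam i • Y i) = lamBar D P • yb + q := by
      have h2 : ∀ i, D.uR i • P.lam i • Y i =
          (D.uR i * P.lam i * D.uC i) • yb + D.uR i • P.lam i • mix D.piC Y i := by
        intro i
        rw [NormData.Admissible.mix_piC_apply, ← hyb]
        module
      rw [hq, wavg, wavg, lamBar, Finset.sum_congr rfl fun i _ => h2 i, Finset.sum_add_distrib,
        ← Finset.sum_smul, smul_add, smul_smul]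
    rw [h1, ← add_assoc, add_sub_cancel, smul_add, smul_inv_smul₀ hlb.ne']
  have hqn : ‖q‖ ≤ (n : ℝ)⁻¹ * (lamHat P * (vecNorm D.uR * frob (mix D.piC Y))) := by
    rw [hq, wavg, norm_smul, Real.norm_eq_abs, abs_of_pos (inv_pos.2 hn)]
    refine mul_le_mul_of_nonneg_left ?_ (inv_pos.2 hn).le
    calc _ ≤ ∑ i, lamHat P * (D.uR i * ‖mix D.piC Y i‖) := by
          refine (norm_sum_le _ _).trans (Finset.sum_le_sum fun i _ => ?_)
          rw [norm_smul, norm_smul, Real.norm_eq_abs, Real.norm_eq_abs,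
            abs_of_nonneg (hD.uR_nonneg i), abs_of_nonneg (hlam0 i)]
          have := mul_le_mul_of_nonneg_right (le_lamHat P i)
            (mul_nonneg (hD.uR_nonneg i) (norm_nonneg (mix D.piC Y i)))
          linarith
      _ ≤ _ := by
        rw [← Finset.mul_sum]
        exact mul_le_mul_of_nonneg_left (sum_mul_norm_le _ _) hl.le
  have hz := norm_avg_grad_sub_le hf hL D X
  rw [← hY, ← hyb, ← hG] at hz
  have hw : ‖(yb - G) + (lamBar D P)⁻¹ • q‖ ^ 2 ≤
      2 * (‖yb - G‖ ^ 2 + ((lamBar D P)⁻¹ * ‖q‖) ^ 2) := by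
    refine sq_le_two_mul (norm_nonneg _) ((norm_add_le _ _).trans (le_of_eq ?_))
    rw [norm_smul, Real.norm_eq_abs, abs_of_pos (inv_pos.2 hlb)]
  have hstep := inexact_gradient_step hf.differentiable_avgObj
    (hf.norm_gradient_avgObj_sub_le hL) (wavg D X) ((yb - G) + (lamBar D P)⁻¹ • q) hlb.le hLl
  rw [← hG, ← hdec] at hstep
  have t1 : lamBar D P / 2 * ‖(yb - G) + (lamBar D P)⁻¹ • q‖ ^ 2 ≤
      lamBar D P * ‖yb - G‖ ^ 2 + (lamBar D P)⁻¹ * ‖q‖ ^ 2 := by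
    have h1 := mul_le_mul_of_nonneg_left hw (show 0 ≤ lamBar D P / 2 by positivity)
    have h2 : lamBar D P / 2 * (2 * (‖yb - G‖ ^ 2 + ((lamBar D P)⁻¹ * ‖q‖) ^ 2)) =
        lamBar D P * ‖yb - G‖ ^ 2 + (lamBar D P)⁻¹ * ‖q‖ ^ 2 := by field_simp
    linarith
  have t2 : lamBar D P * ‖yb - G‖ ^ 2 ≤
      M * lamHat P * (D.eE M * L ^ 2) * frob (mix D.piR X) ^ 2 := by
    calc _ ≤ lamHat P * (vecNorm D.uR * vecNorm D.uC / n) *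
          (L ^ 2 / n * frob (mix D.piR X) ^ 2) := by
          have := vecNorm_nonneg D.uR
          have := vecNorm_nonneg D.uC
          exact mul_le_mul (hD.lamBar_le hl.le) hz (by positivity) (by positivity)
      _ = _ := by
        unfold NormData.eE
        field_simp
  have t3 : (lamBar D P)⁻¹ * ‖q‖ ^ 2 ≤
      M * lamHat P * (vecNorm D.uR ^ 2 / ((n : ℝ) ^ 2 * M ^ 2)) * frob (mix D.piC Y) ^ 2 := by
    calc _ ≤ (M * lamHat P)⁻¹ *
          ((n : ℝ)⁻¹ * (lamHat P * (vecNorm D.uR * frob (mix D.piC Y)))) ^ 2 := by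
          gcongr
      _ = _ := by field_simp
  have t4 : M * lamHat P / 2 * ‖G‖ ^ 2 ≤ lamBar D P / 2 * ‖G‖ ^ 2 := by gcongr
  linarith

lemma frob_smul_const (u : Fin n → ℝ) (y : Dec p) :
    frob (fun i => u i • y) = vecNorm u * ‖y‖ := by
  simp only [frob, vecNorm, norm_smul, mul_pow, ← Finset.sum_mul, Real.norm_eq_abs, sq_abs]
  rw [Real.sqrt_mul (Finset.sum_nonneg fun _ _ => sq_nonneg _), Real.sqrt_sq (norm_nonneg _)]

/-- The trackers are bounded by the tracking error, the gradient, and the consensus error. -/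
lemma tracker_sq_le [NeZero n] (hf : ObjectiveAssumption f Ls μ xs) {L : ℝ} (hL : Lmax Ls ≤ L)
    (D : NormData n) (X Y : Rows n p) (hY : ∑ i, Y i = ∑ i, gradient (f i) (X i)) :
    frob Y ^ 2 ≤ 3 * frob (mix D.piC Y) ^ 2 +
      3 * vecNorm D.uC ^ 2 * ‖gradient (avgObj f) (wavg D X)‖ ^ 2 +
      3 * vecNorm D.uC ^ 2 * L ^ 2 / n * frob (mix D.piR X) ^ 2 := by
  set G := gradient (avgObj f) (wavg D X) with hG
  set yb : Dec p := (n : ℝ)⁻¹ • ∑ i, Y i with hyb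
  have hz := norm_avg_grad_sub_le hf hL D X
  rw [← hY, ← hyb, ← hG] at hz
  have h1 : Y = mix D.piC Y + (fun i => D.uC i • G) + fun i => D.uC i • (yb - G) := by
    funext i
    simp only [Pi.add_apply, NormData.Admissible.mix_piC_apply, ← hyb, smul_sub]
    abel
  have h2 : frob Y ≤ frob (mix D.piC Y) + vecNorm D.uC * ‖G‖ + vecNorm D.uC * ‖yb - G‖ := by
    conv_lhs => rw [h1]
    refine (frob_add_le _ _).trans ?_
    rw [frob_smul_const]
    gcongr
    refine (frob_add_le _ _).trans ?_
    rw [frob_smul_const]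
  have h3 := sq_le_three_mul (frob_nonneg _) h2
  have h4 := mul_le_mul_of_nonneg_left hz (sq_nonneg (vecNorm D.uC))
  rw [mul_pow, mul_pow] at h3
  have h5 : 3 * vecNorm D.uC ^ 2 * L ^ 2 / n * frob (mix D.piR X) ^ 2 =
      3 * (vecNorm D.uC ^ 2 * (L ^ 2 / n * frob (mix D.piR X) ^ 2)) := by ring
  rw [h5]
  linarith

end Step

/-! ### Decrease of the Lyapunov function along one iteration -/

section Lyapunov

variable {n p : ℕ}

lemma frob_sub_smul_sq_le {V Q : Rows n p} {α r : ℝ} (hr : 0 < r) (hα : 0 ≤ α)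
    (hαr : α * r ≤ 1) :
    frob (V - α • Q) ^ 2 ≤
      (1 - α * r) * frob V ^ 2 + α * r * frob (V - r⁻¹ • Q) ^ 2 := by
  have h1 : V - α • Q = (1 - α * r) • V + (α * r) • (V - r⁻¹ • Q) := by
    rw [smul_sub, smul_smul, mul_assoc, mul_inv_cancel₀ hr.ne', mul_one]
    module
  have h2 : frob (V - α • Q) ≤ (1 - α * r) * frob V + α * r * frob (V - r⁻¹ • Q) := by
    rw [h1]
    refine (frob_add_le _ _).trans ?_
    rw [frob_smul, frob_smul, abs_of_nonneg (by linarith), abs_of_nonneg (by positivity)]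
  refine (pow_le_pow_left₀ (frob_nonneg _) h2 2).trans ?_
  have h3 : 0 ≤ α * r * (1 - α * r) * (frob V - frob (V - r⁻¹ • Q)) ^ 2 := by
    have : 0 ≤ 1 - α * r := by linarith
    positivity
  linarith

/-- The compression error after the update of the reference points: up to the excess of the
`r`-scaled error over its mean bound, it contracts with factor `1 - α r δ / 2`, and it grows with
the displacement `W` of the compressed quantity. -/
lemma compression_memory_step {V Q W : Rows n p} {α r δ : ℝ} (hr : 0 < r) (hα : 0 < α)
    (hαr : α * r ≤ 1) (hδ : 0 < δ) (hδ1 : δ ≤ 1) :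
    frob (V - α • Q + W) ^ 2 ≤ (1 - α * r * δ / 2) * frob V ^ 2 +
      α * r / (1 - α * r * δ / 2) * (frob (V - r⁻¹ • Q) ^ 2 - (1 - δ) * frob V ^ 2) +
      2 / (α * r * δ) * frob W ^ 2 := by
  have hb : 0 < α * r * δ := by positivity
  have hb1 : α * r * δ ≤ 1 := mul_le_one₀ hαr hδ.le hδ1
  have hpos : 0 < 1 - α * r * δ / 2 := by linarith
  have h1 := sq_le_of_le_add (frob_nonneg _) (half_pos hb) (by linarith)
    (frob_add_le (V - α • Q) W)
  have h2 := div_le_div_of_nonneg_right (frob_sub_smul_sq_le (V := V) (Q := Q) hr hα.le hαr)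
    hpos.le
  have h3 : ((1 - α * r) * frob V ^ 2 + α * r * frob (V - r⁻¹ • Q) ^ 2) /
      (1 - α * r * δ / 2) = (1 - α * r * δ) / (1 - α * r * δ / 2) * frob V ^ 2 +
      α * r / (1 - α * r * δ / 2) * (frob (V - r⁻¹ • Q) ^ 2 - (1 - δ) * frob V ^ 2) := by
    field_simp
    ring
  have h4 : (1 - α * r * δ) / (1 - α * r * δ / 2) ≤ 1 - α * r * δ / 2 := by
    rw [div_le_iff₀ hpos]
    linarith only [sq_nonneg (α * r * δ)]
  have h5 := mul_le_mul_of_nonneg_right h4 (sq_nonneg (frob V))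
  have h6 : frob W ^ 2 / (α * r * δ / 2) = 2 / (α * r * δ) * frob W ^ 2 := by field_simp
  linarith

lemma frob_lam_smul_le {P : Params n} (hlam : ∀ i, 0 ≤ P.lam i) (Y : Rows n p) :
    frob (fun i => P.lam i • Y i) ≤ lamHat P * frob Y := by
  refine frob_le_mul (Real.iSup_nonneg hlam) fun i => ?_
  rw [norm_smul, Real.norm_eq_abs, abs_of_nonneg (hlam i)]
  exact mul_le_mul_of_nonneg_right (le_lamHat P i) (norm_nonneg _)

/-- A gradient step of size `1 / L` cannot go below the minimum. -/
lemma ObjectiveAssumption.sq_norm_gradient_le [NeZero n] {f : Fin n → Dec p → ℝ}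
    {Ls : Fin n → ℝ≥0} {μ : ℝ} {xs : Dec p} (hf : ObjectiveAssumption f Ls μ xs) {L : ℝ}
    (hL : Lmax Ls ≤ L) (hL0 : 0 < L) (x : Dec p) :
    ‖gradient (avgObj f) x‖ ^ 2 ≤ 2 * L * (avgObj f x - avgObj f xs) := by
  have h1 := inexact_gradient_step hf.differentiable_avgObj
    (hf.norm_gradient_avgObj_sub_le hL) x 0 (inv_pos.2 hL0).le (mul_inv_cancel₀ hL0.ne').le
  have h2 := hf.minimizer (x - L⁻¹ • (gradient (avgObj f) x + 0))
  rw [norm_zero] at h1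
  have h3 : L⁻¹ / 2 * ‖gradient (avgObj f) x‖ ^ 2 ≤ avgObj f x - avgObj f xs := by linarith
  have h4 := mul_le_mul_of_nonneg_left h3 (show 0 ≤ 2 * L by positivity)
  have h5 : 2 * L * (L⁻¹ / 2 * ‖gradient (avgObj f) x‖ ^ 2) = ‖gradient (avgObj f) x‖ ^ 2 := by
    field_simp
  linarith

/-- The relations between the variables that the iteration preserves. -/
structure State.Consistent (P : Params n) (f : Fin n → Dec p → ℝ) (S : State n p) : Prop where
  HR_eq : S.HR = mix P.R S.Hx
  HC_eq : S.HC = mix P.C S.Hy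
  sum_Y : ∑ i, S.Y i = ∑ i, gradient (f i) (S.X i)

/-- The trackers after the correction by the gradient increment, before compression. -/
noncomputable def trackerUpdate (f : Fin n → Dec p → ℝ) (S : State n p) (X' : Rows n p) :
    Rows n p :=
  S.Y + stackedGrad f X' - stackedGrad f S.X

/-- The next decision variables, given the output `Q` of the first compression step. -/
noncomputable def nextX (P : Params n) (S : State n p) (Q : Rows n p) : Rows n p :=
  localUpdate P S - P.γx • (S.Hx + Q - (S.HR + mix P.R Q))

/-- The next state, given the outputs of the two compression steps. -/
noncomputable def nextState (P : Params n) (f : Fin n → Dec p → ℝ) (S : State n p)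
    (Qx Qy : Rows n p) : State n p where
  X := nextX P S Qx
  Y := trackerUpdate f S (nextX P S Qx) - P.γy • (S.Hy + Qy - (S.HC + mix P.C Qy))
  Hx := (1 - P.αx) • S.Hx + P.αx • (S.Hx + Qx)
  Hy := (1 - P.αy) • S.Hy + P.αy • (S.Hy + Qy)
  HR := (1 - P.αx) • S.HR + P.αx • (S.HR + mix P.R Qx)
  HC := (1 - P.αy) • S.HC + P.αy • (S.HC + mix P.C Qy)

section Eqns

variable {P : Params n} {f : Fin n → Dec p → ℝ} {S : State n p}

lemma State.Consistent.nextX_eq (hS : S.Consistent P f) (Q : Rows n p) :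
    nextX P S Q = mix (relaxed P.R P.γx) (localUpdate P S) +
      P.γx • mix (1 - P.R) (localUpdate P S - S.Hx - Q) := by
  rw [nextX, hS.HR_eq, ← mix_add, mixing_step_eq, sub_sub]

lemma State.Consistent.nextY_eq (hS : S.Consistent P f) (Qx Qy : Rows n p) :
    (nextState P f S Qx Qy).Y = mix (relaxed P.C P.γy) (trackerUpdate f S (nextX P S Qx)) +
      P.γy • mix (1 - P.C) (trackerUpdate f S (nextX P S Qx) - S.Hy - Qy) := by
  simp only [nextState]
  rw [hS.HC_eq, ← mix_add, mixing_step_eq, sub_sub]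

lemma State.Consistent.nextState (hC : P.C ∈ Matrix.colStochastic ℝ (Fin n))
    (hS : S.Consistent P f) (Qx Qy : Rows n p) : (nextState P f S Qx Qy).Consistent P f where
  HR_eq := by simp only [RCPP.nextState, hS.HR_eq, mix_add, mix_smul]
  HC_eq := by simp only [RCPP.nextState, hS.HC_eq, mix_add, mix_smul]
  sum_Y := by
    have h1 : ∀ V : Rows n p, ∑ i, (P.γy • (V - mix P.C V)) i = 0 := fun V => by
      simp [← Finset.smul_sum, sum_mix_of_colStochastic hC]
    simp only [RCPP.nextState]
    rw [hS.HC_eq, ← mix_add]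
    change ∑ i, (trackerUpdate f S (nextX P S Qx) i - (P.γy • (_ - mix P.C _ : Rows n p)) i) = _
    rw [Finset.sum_sub_distrib, h1, sub_zero]
    simp [trackerUpdate, stackedGrad, Finset.sum_sub_distrib, Finset.sum_add_distrib, hS.sum_Y]

end Eqns

end Lyapunov

section Regime

variable {n p : ℕ}

/-- Mixing and transmission errors do not affect the weighted average. -/
lemma wavg_nextX {D : NormData n} {P : Params n} {f : Fin n → Dec p → ℝ} {S : State n p}
    (hD : D.Admissible P.R P.C P.γx P.γy) (hS : S.Consistent P f) (Q : Rows n p) :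
    wavg D (nextX P S Q) = wavg D S.X - wavg D (fun i => P.lam i • S.Y i) := by
  have h1 : localUpdate P S = S.X - fun i => P.lam i • S.Y i := rfl
  rw [nextX, hS.HR_eq, ← mix_add, wavg_sub, wavg_smul, wavg_sub, hD.wavg_mix, sub_self, smul_zero,
    sub_zero, h1, wavg_sub]

/-- The standing assumptions for the analysis of one iteration: the objective, the norms, and the
consequences `Rates.Valid` of the step-size conditions, for a positive upper bound `L` of the
Lipschitz constants. -/
structure Regime (D : NormData n) (P : Params n) (f : Fin n → Dec p → ℝ) (Ls : Fin n → ℝ≥0)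
    (xs : Dec p) (L M Cc r δ μ : ℝ) : Prop where
  obj : ObjectiveAssumption f Ls μ xs
  Lmax_le : Lmax Ls ≤ L
  adm : D.Admissible P.R P.C P.γx P.γy
  rowStochastic : P.R ∈ Matrix.rowStochastic ℝ (Fin n)
  colStochastic : P.C ∈ Matrix.colStochastic ℝ (Fin n)
  lam_nonneg : ∀ i, 0 ≤ P.lam i
  lamHat_le : M * lamHat P ≤ lamBar D P
  lamBar_le : L * lamBar D P ≤ 1
  valid : (rates D P L M Cc r δ μ).Valid
  A_le : 24 * (D.aR P * P.γx) ^ 2 ≤ 1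
  r_pos : 0 < r
  δ_pos : 0 < δ
  δ_le : δ ≤ 1
  αx_pos : 0 < P.αx
  αx_le : P.αx * r ≤ 1
  αy_pos : 0 < P.αy
  αy_le : P.αy * r ≤ 1
  γx_pos : 0 < P.γx
  γy_pos : 0 < P.γy

namespace Regime

variable {D : NormData n} {P : Params n} {f : Fin n → Dec p → ℝ} {Ls : Fin n → ℝ≥0} {xs : Dec p}
  {L M Cc r δ μ : ℝ} (h : Regime D P f Ls xs L M Cc r δ μ)
include h

lemma L_pos : 0 < L := h.valid.L_pos

lemma lamHat_pos : 0 < lamHat P := h.valid.l_pos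

lemma tR_le_one : D.θR * P.γx ≤ 1 := by
  linarith [(inducedNorm_nonneg D.TR (D.piR * relaxed P.R P.γx)).trans h.adm.contractR]

lemma tC_le_one : D.θC * P.γy ≤ 1 := h.valid.tC_le

lemma frob_localUpdate_sub_le (S : State n p) :
    frob (localUpdate P S - S.X) ≤ lamHat P * frob S.Y := by
  have h1 : localUpdate P S - S.X = -fun i => P.lam i • S.Y i := by
    funext i
    simp [localUpdate]
  rw [h1, frob_neg]
  exact frob_lam_smul_le h.lam_nonneg _

lemma frob_trackerUpdate_sub_le (S : State n p) (X' : Rows n p) :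
    frob (trackerUpdate f S X' - S.Y) ≤ L * frob (X' - S.X) := by
  have h1 : trackerUpdate f S X' - S.Y = stackedGrad f X' - stackedGrad f S.X := by
    rw [trackerUpdate]
    abel
  rw [h1]
  exact h.obj.frob_stackedGrad_sub_le h.Lmax_le _ _

variable {S : State n p} (hS : S.Consistent P f)

include hS in
lemma frob_tracker_mixing_le (Qx Qy : Rows n p) :
    frob ((nextState P f S Qx Qy).Y - trackerUpdate f S (nextX P S Qx)) ≤
      D.aC P * P.γy * frob (mix D.TC (mix D.piC S.Y)) +
      D.aC P * P.γy * D.δC * (L * frob (nextX P S Qx - S.X)) +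
      D.aC P * P.γy * D.δC * frob (trackerUpdate f S (nextX P S Qx) - S.Hy - Qy) := by
  have h1 := frob_mixing_displacement h.adm.TC_unit h.adm.TC_ge h.γy_pos.le h.adm.sub_mul_piC
    S.Y (trackerUpdate f S (nextX P S Qx) - S.Y) (trackerUpdate f S (nextX P S Qx) - S.Hy - Qy)
  rw [add_sub_cancel, ← hS.nextY_eq] at h1
  have h2 := mul_le_mul_of_nonneg_left (h.frob_trackerUpdate_sub_le S (nextX P S Qx))
    (mul_nonneg (mul_nonneg (inducedNorm_nonneg D.TC (1 - P.C)) h.γy_pos.le)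
      (specNorm_nonneg D.TC))
  unfold NormData.δC NormData.aC
  linarith

include hS in
lemma localUpdate_displacement_sq_le (Qx Qy : Rows n p) :
    frob (localUpdate P (nextState P f S Qx Qy) - localUpdate P S) ^ 2 ≤
      2 * frob (nextX P S Qx - S.X) ^ 2 + 8 * lamHat P ^ 2 *
        (L ^ 2 * frob (nextX P S Qx - S.X) ^ 2 +
        (D.aC P * P.γy) ^ 2 * frob (mix D.TC (mix D.piC S.Y)) ^ 2 +
        (D.aC P * P.γy) ^ 2 * D.δC ^ 2 * L ^ 2 * frob (nextX P S Qx - S.X) ^ 2 +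
        (D.aC P * P.γy) ^ 2 * D.δC ^ 2 *
          frob (trackerUpdate f S (nextX P S Qx) - S.Hy - Qy) ^ 2) := by
  have h1 : localUpdate P (nextState P f S Qx Qy) - localUpdate P S = (nextX P S Qx - S.X) -
      fun i => P.lam i • ((nextState P f S Qx Qy).Y - S.Y) i := by
    funext i
    simp only [localUpdate, Pi.sub_apply, smul_sub]
    rw [show (nextState P f S Qx Qy).X = nextX P S Qx from rfl]
    abel
  have h2 : (nextState P f S Qx Qy).Y - S.Y = (trackerUpdate f S (nextX P S Qx) - S.Y) +
      ((nextState P f S Qx Qy).Y - trackerUpdate f S (nextX P S Qx)) := by abel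
  have h3 : frob ((nextState P f S Qx Qy).Y - S.Y) ≤ L * frob (nextX P S Qx - S.X) +
      D.aC P * P.γy * frob (mix D.TC (mix D.piC S.Y)) +
      D.aC P * P.γy * D.δC * (L * frob (nextX P S Qx - S.X)) +
      D.aC P * P.γy * D.δC * frob (trackerUpdate f S (nextX P S Qx) - S.Hy - Qy) := by
    have h4 := frob_add_le (trackerUpdate f S (nextX P S Qx) - S.Y)
      ((nextState P f S Qx Qy).Y - trackerUpdate f S (nextX P S Qx))
    rw [← h2] at h4
    linarith [h.frob_tracker_mixing_le hS Qx Qy, h.frob_trackerUpdate_sub_le S (nextX P S Qx)]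
  have h5 := sq_le_four_mul (frob_nonneg _) h3
  have h6 := sq_le_two_mul (frob_nonneg _)
    ((frob_sub_le (nextX P S Qx - S.X)
      fun i => P.lam i • ((nextState P f S Qx Qy).Y - S.Y) i).trans
      (add_le_add_right (frob_lam_smul_le h.lam_nonneg _) _))
  rw [← h1] at h6
  have h7 := mul_le_mul_of_nonneg_left h5 (show 0 ≤ 2 * lamHat P ^ 2 by positivity)
  linarith

variable [NeZero n]

include hS in
/-- Recursion of the consensus error. -/
lemma consensus_sq_le (Q : Rows n p) :
    frob (mix D.TR (mix D.piR (nextX P S Q))) ^ 2 ≤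
      (1 - D.θR * P.γx) * frob (mix D.TR (mix D.piR S.X)) ^ 2 +
        (2 * (1 - D.θR * P.γx) ^ 2 * D.δR ^ 2 * lamHat P ^ 2 * frob S.Y ^ 2 +
          2 * (D.aR P * P.γx) ^ 2 * D.δR ^ 2 * frob (localUpdate P S - S.Hx - Q) ^ 2) /
            (D.θR * P.γx) := by
  have ht : 0 < D.θR * P.γx := h.valid.tR_pos
  have h1 := frob_mixing_contraction h.adm.TR_unit h.γx_pos.le h.adm.piR_norm h.adm.contractR
    (NormData.Admissible.mul_relaxed_mul h.adm.piR_mul_self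
      (NormData.Admissible.sub_mul_piR D h.rowStochastic) P.γx)
    S.X (localUpdate P S - S.X) (localUpdate P S - S.Hx - Q)
  rw [add_sub_cancel, ← hS.nextX_eq] at h1
  have h2 := mul_le_mul_of_nonneg_left (h.frob_localUpdate_sub_le S)
    (mul_nonneg (sub_nonneg.2 h.tR_le_one) (specNorm_nonneg D.TR))
  refine (sq_le_of_le_convex (frob_nonneg _) ht h.tR_le_one
    (h1.trans (add_le_add_right (add_le_add_left h2 _) _))).trans ?_
  have h3 := sq_le_two_mul (a := (1 - D.θR * P.γx) * specNorm D.TR * (lamHat P * frob S.Y) +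
      inducedNorm D.TR (1 - P.R) * P.γx * specNorm D.TR * frob (localUpdate P S - S.Hx - Q))
    (by
      have := h.lamHat_pos; have := sub_nonneg.2 h.tR_le_one; have := h.γx_pos
      have := specNorm_nonneg D.TR; have := frob_nonneg S.Y
      have := inducedNorm_nonneg D.TR (1 - P.R)
      have := frob_nonneg (localUpdate P S - S.Hx - Q)
      positivity) le_rfl
  refine add_le_add_right (div_le_div_of_nonneg_right (h3.trans (le_of_eq ?_)) ht.le) _
  unfold NormData.δR NormData.aR
  ring

include hS in
/-- The displacement `‖X⁺ - X‖²` in one iteration. -/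
lemma displacement_sq_le (Q : Rows n p) :
    frob (nextX P S Q - S.X) ^ 2 ≤
      3 * (D.aR P * P.γx) ^ 2 * frob (mix D.TR (mix D.piR S.X)) ^ 2 +
        75 / 16 * D.δR ^ 2 * lamHat P ^ 2 * frob S.Y ^ 2 +
          3 * (D.aR P * P.γx) ^ 2 * D.δR ^ 2 * frob (localUpdate P S - S.Hx - Q) ^ 2 := by
  have hA0 : 0 ≤ D.aR P * P.γx := mul_nonneg (inducedNorm_nonneg _ _) h.γx_pos.le
  have hd1 : 1 ≤ D.δR := one_le_specNorm h.adm.TR_ge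
  have h1 := frob_mixing_displacement h.adm.TR_unit h.adm.TR_ge h.γx_pos.le
    (NormData.Admissible.sub_mul_piR D h.rowStochastic)
    S.X (localUpdate P S - S.X) (localUpdate P S - S.Hx - Q)
  rw [add_sub_cancel, ← hS.nextX_eq] at h1
  have h2 := h.frob_localUpdate_sub_le S
  have h3 : nextX P S Q - S.X = (nextX P S Q - localUpdate P S) + (localUpdate P S - S.X) := by
    abel
  have h4 : frob (nextX P S Q - S.X) ≤ D.aR P * P.γx * frob (mix D.TR (mix D.piR S.X)) +
      5 / 4 * D.δR * (lamHat P * frob S.Y) +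
      D.aR P * P.γx * D.δR * frob (localUpdate P S - S.Hx - Q) := by
    rw [h3]
    refine (frob_add_le _ _).trans ?_
    -- `A ≤ 1 / 4` and `δ_R ≥ 1` merge the two contributions of the trackers.
    have h5 : D.aR P * P.γx * D.δR + 1 ≤ 5 / 4 * D.δR := by
      have : D.aR P * P.γx ≤ 1 / 4 := by nlinarith [h.A_le]
      nlinarith
    have h6 : (D.aR P * P.γx * D.δR + 1) * frob (localUpdate P S - S.X) ≤
        5 / 4 * D.δR * (lamHat P * frob S.Y) :=
      mul_le_mul h5 h2 (frob_nonneg _) (by positivity)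
    unfold NormData.aR NormData.δR at *
    linarith
  refine (sq_le_three_mul (frob_nonneg _) h4).trans (le_of_eq ?_)
  ring

include hS in
/-- Recursion of the gradient tracking error. -/
lemma tracking_sq_le (Qx Qy : Rows n p) :
    frob (mix D.TC (mix D.piC (nextState P f S Qx Qy).Y)) ^ 2 ≤
      (1 - D.θC * P.γy) * frob (mix D.TC (mix D.piC S.Y)) ^ 2 +
        (2 * D.δC ^ 2 * L ^ 2 * frob (nextX P S Qx - S.X) ^ 2 +
          2 * (D.aC P * P.γy) ^ 2 * D.δC ^ 2 *
            frob (trackerUpdate f S (nextX P S Qx) - S.Hy - Qy) ^ 2) / (D.θC * P.γy) := by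
  have ht : 0 < D.θC * P.γy := h.valid.tC_pos
  set X' := nextX P S Qx with hX'
  have h1 := frob_mixing_contraction h.adm.TC_unit h.γy_pos.le h.adm.piC_norm h.adm.contractC
    (NormData.Admissible.mul_relaxed_mul h.adm.piC_mul_self h.adm.sub_mul_piC P.γy)
    S.Y (trackerUpdate f S X' - S.Y) (trackerUpdate f S X' - S.Hy - Qy)
  rw [add_sub_cancel, hX', ← hS.nextY_eq, ← hX'] at h1
  have h2 : (1 - D.θC * P.γy) * specNorm D.TC * frob (trackerUpdate f S X' - S.Y) ≤
      specNorm D.TC * (L * frob (X' - S.X)) :=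
    mul_le_mul (mul_le_of_le_one_left (specNorm_nonneg _) (by linarith))
      (h.frob_trackerUpdate_sub_le S X') (frob_nonneg _) (specNorm_nonneg _)
  refine (sq_le_of_le_convex (frob_nonneg _) ht h.tC_le_one
    (h1.trans (add_le_add_right (add_le_add_left h2 _) _))).trans ?_
  have h3 := sq_le_two_mul (a := specNorm D.TC * (L * frob (X' - S.X)) +
      inducedNorm D.TC (1 - P.C) * P.γy * specNorm D.TC * frob (trackerUpdate f S X' - S.Hy - Qy))
    (by
      have := h.L_pos; have := h.γy_pos
      have := specNorm_nonneg D.TC; have := frob_nonneg (X' - S.X)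
      have := inducedNorm_nonneg D.TC (1 - P.C)
      have := frob_nonneg (trackerUpdate f S X' - S.Hy - Qy)
      positivity) le_rfl
  refine add_le_add_right (div_le_div_of_nonneg_right (h3.trans (le_of_eq ?_)) ht.le) _
  unfold NormData.δC NormData.aC
  ring

end Regime

end Regime

section Decrease

variable {n p : ℕ}

/-- The Lyapunov function: a weighted sum of the optimality gap at the weighted average, the
consensus error, the gradient tracking error, and the two compression errors. -/
noncomputable def lyap (c : Rates) (D : NormData n) (P : Params n) (f : Fin n → Dec p → ℝ)
    (xs : Dec p) (S : State n p) : ℝ :=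
  c.w1 * (avgObj f (wavg D S.X) - avgObj f xs) +
  c.w2 * frob (mix D.TR (mix D.piR S.X)) ^ 2 + c.w3 * frob (mix D.TC (mix D.piC S.Y)) ^ 2 +
  c.w4 * frob (localUpdate P S - S.Hx) ^ 2 + c.w5 * frob (S.Y - S.Hy) ^ 2

namespace Regime

variable {D : NormData n} {P : Params n} {f : Fin n → Dec p → ℝ} {Ls : Fin n → ℝ≥0} {xs : Dec p}
  {L M Cc r δ μ : ℝ} (h : Regime D P f Ls xs L M Cc r δ μ)
include h

lemma lyap_nonneg (S : State n p) : 0 ≤ lyap (rates D P L M Cc r δ μ) D P f xs S := by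
  have h1 := h.valid.w1_pos
  have h2 := h.valid.w2_pos
  have h3 := h.valid.w3_pos
  have h4 := h.valid.w4_pos
  have h5 := h.valid.w5_pos
  have h6 := h.obj.gap_nonneg (wavg D S.X)
  unfold lyap
  positivity

/-- The Lyapunov function dominates each of its terms. -/
lemma le_lyap (S : State n p) :
    (rates D P L M Cc r δ μ).w1 * (avgObj f (wavg D S.X) - avgObj f xs) ≤
      lyap (rates D P L M Cc r δ μ) D P f xs S ∧
    (rates D P L M Cc r δ μ).w2 * frob (mix D.TR (mix D.piR S.X)) ^ 2 ≤
      lyap (rates D P L M Cc r δ μ) D P f xs S ∧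
    (rates D P L M Cc r δ μ).w3 * frob (mix D.TC (mix D.piC S.Y)) ^ 2 ≤
      lyap (rates D P L M Cc r δ μ) D P f xs S ∧
    (rates D P L M Cc r δ μ).w4 * frob (localUpdate P S - S.Hx) ^ 2 ≤
      lyap (rates D P L M Cc r δ μ) D P f xs S ∧
    (rates D P L M Cc r δ μ).w5 * frob (S.Y - S.Hy) ^ 2 ≤
      lyap (rates D P L M Cc r δ μ) D P f xs S := by
  have h1 := mul_nonneg h.valid.w1_pos.le (h.obj.gap_nonneg (wavg D S.X))
  have h2 := mul_nonneg h.valid.w2_pos.le (sq_nonneg (frob (mix D.TR (mix D.piR S.X))))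
  have h3 := mul_nonneg h.valid.w3_pos.le (sq_nonneg (frob (mix D.TC (mix D.piC S.Y))))
  have h4 := mul_nonneg h.valid.w4_pos.le (sq_nonneg (frob (localUpdate P S - S.Hx)))
  have h5 := mul_nonneg h.valid.w5_pos.le (sq_nonneg (frob (S.Y - S.Hy)))
  unfold lyap
  refine ⟨?_, ?_, ?_, ?_, ?_⟩ <;> linarith

lemma tracker_input_sq_le (S : State n p) (Q : Rows n p) :
    frob (trackerUpdate f S (nextX P S Q) - S.Hy) ^ 2 ≤
      2 * frob (S.Y - S.Hy) ^ 2 + 2 * L ^ 2 * frob (nextX P S Q - S.X) ^ 2 := by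
  have h1 : trackerUpdate f S (nextX P S Q) - S.Hy =
    (S.Y - S.Hy) + (trackerUpdate f S (nextX P S Q) - S.Y) := by abel
  have h2 := (frob_add_le (S.Y - S.Hy) (trackerUpdate f S (nextX P S Q) - S.Y)).trans
    (add_le_add_right (h.frob_trackerUpdate_sub_le S (nextX P S Q)) _)
  rw [← h1] at h2
  refine (sq_le_two_mul (frob_nonneg _) h2).trans (le_of_eq ?_)
  ring

variable [NeZero n]

lemma frob_Y_sq_le {S : State n p} (hS : S.Consistent P f) :
    frob S.Y ^ 2 ≤ 3 * frob (mix D.TC (mix D.piC S.Y)) ^ 2 +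
    3 * vecNorm D.uC ^ 2 * ‖gradient (avgObj f) (wavg D S.X)‖ ^ 2 +
    3 * vecNorm D.uC ^ 2 * L ^ 2 / n * frob (mix D.TR (mix D.piR S.X)) ^ 2 := by
  refine (tracker_sq_le h.obj h.Lmax_le D S.X S.Y hS.sum_Y).trans ?_
  have h1 := pow_le_pow_left₀ (frob_nonneg _) (frob_le_frob_mix h.adm.TC_ge (mix D.piC S.Y)) 2
  have h2 := pow_le_pow_left₀ (frob_nonneg _) (frob_le_frob_mix h.adm.TR_ge (mix D.piR S.X)) 2
  have h3 := mul_le_mul_of_nonneg_left h2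
    (show 0 ≤ 3 * vecNorm D.uC ^ 2 * L ^ 2 / n by positivity)
  linarith

/-- The Lyapunov function decreases by the factor `ρ` in one iteration, up to the excess of the
compression errors over their mean bounds. -/
theorem lyap_step {ρ : ℝ} (hρ : rhoTilde D P M μ r δ ≤ ρ) {S : State n p}
    (hS : S.Consistent P f)
    (Qx Qy : Rows n p) :
    lyap (rates D P L M Cc r δ μ) D P f xs (nextState P f S Qx Qy) ≤
      ρ * lyap (rates D P L M Cc r δ μ) D P f xs S +
      ((rates D P L M Cc r δ μ).cex * (frob (localUpdate P S - S.Hx - Qx) ^ 2 -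
        Cc * frob (localUpdate P S - S.Hx) ^ 2) +
      (rates D P L M Cc r δ μ).cey *
        (frob (trackerUpdate f S (nextX P S Qx) - S.Hy - Qy) ^ 2 -
          Cc * frob (trackerUpdate f S (nextX P S Qx) - S.Hy) ^ 2) +
      (rates D P L M Cc r δ μ).w4 * (P.αx * r / (1 - P.αx * r * δ / 2) *
        (frob (localUpdate P S - S.Hx - r⁻¹ • Qx) ^ 2 -
          (1 - δ) * frob (localUpdate P S - S.Hx) ^ 2)) +
      (rates D P L M Cc r δ μ).w5 * (P.αy * r / (1 - P.αy * r * δ / 2) *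
        (frob (trackerUpdate f S (nextX P S Qx) - S.Hy - r⁻¹ • Qy) ^ 2 -
          (1 - δ) * frob (trackerUpdate f S (nextX P S Qx) - S.Hy) ^ 2))) := by
  simp only [rhoTilde, max_le_iff] at hρ
  obtain ⟨hρ1, hρ2, hρ3, hρ4, hρ5⟩ := hρ
  have hbx : 0 < P.αx * r * δ := h.valid.bx_pos
  have hby : 0 < P.αy * r * δ := h.valid.by_pos
  have hby1 : P.αy * r * δ ≤ 1 := h.valid.by_le
  set X' := nextX P S Qx with hX'
  set Vy := trackerUpdate f S X' - S.Hy with hVy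
  set S' := nextState P f S Qx Qy with hS'
  have hhx : frob (localUpdate P S' - S'.Hx) ^ 2 ≤ _ :=
    le_of_eq_of_le (congrArg (fun V => frob V ^ 2) (show localUpdate P S' - S'.Hx =
      localUpdate P S - S.Hx - P.αx • Qx + (localUpdate P S' - localUpdate P S) by
        rw [show S'.Hx = (1 - P.αx) • S.Hx + P.αx • (S.Hx + Qx) from rfl]
        module))
      (compression_memory_step h.r_pos h.αx_pos h.αx_le h.δ_pos h.δ_le)
  have hhy : frob (S'.Y - S'.Hy) ^ 2 ≤ _ :=
    le_of_eq_of_le (congrArg (fun V => frob V ^ 2) (show S'.Y - S'.Hy =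
      Vy - P.αy • Qy + (S'.Y - trackerUpdate f S X') by
        rw [show S'.Hy = (1 - P.αy) • S.Hy + P.αy • (S.Hy + Qy) from rfl]
        module))
      (compression_memory_step h.r_pos h.αy_pos h.αy_le h.δ_pos h.δ_le)
  have hmixY := sq_le_three_mul (frob_nonneg _) (h.frob_tracker_mixing_le hS Qx Qy)
  have hM : 0 < M := h.valid.M_pos
  have hgap := gap_step h.obj h.Lmax_le h.adm h.lam_nonneg hM h.lamHat_pos
    h.lamHat_le h.lamBar_le S.X S.Y hS.sum_Y
  rw [← wavg_nextX h.adm hS Qx] at hgap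
  have hl := h.lamHat_pos
  refine h.valid.lyapunov_step (g := ‖gradient (avgObj f) (wavg D S.X)‖ ^ 2)
    (D := frob (X' - S.X) ^ 2) (Y := frob S.Y ^ 2)
    (ex := frob (localUpdate P S - S.Hx - Qx) ^ 2) (ey := frob (Vy - Qy) ^ 2)
    (vy := frob Vy ^ 2) (S := frob (localUpdate P S' - localUpdate P S) ^ 2)
    hρ1 hρ2 hρ3 hρ4 hρ5 (h.obj.gap_nonneg _) (sq_nonneg _) (sq_nonneg _) (sq_nonneg _)
    (sq_nonneg _) (sq_nonneg _) (sq_nonneg _) (h.obj.pl _) ?_ (h.consensus_sq_le hS Qx)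
    (h.tracking_sq_le hS Qx Qy) hhx ?_ (h.localUpdate_displacement_sq_le hS Qx Qy)
    (h.displacement_sq_le hS Qx) (h.frob_Y_sq_le hS) (h.tracker_input_sq_le S Qx) ?_
    (by change _ ≤ Cc * _ + _; linarith) (by change _ ≤ Cc * _ + _; linarith)
  · change avgObj f (wavg D X') - avgObj f xs ≤ avgObj f (wavg D S.X) - avgObj f xs -
      M * lamHat P / 2 * ‖gradient (avgObj f) (wavg D S.X)‖ ^ 2 +
      M * lamHat P * (D.eE M * L ^ 2) * frob (mix D.TR (mix D.piR S.X)) ^ 2 +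
      M * lamHat P * (vecNorm D.uR ^ 2 / ((n : ℝ) ^ 2 * M ^ 2)) *
        frob (mix D.TC (mix D.piC S.Y)) ^ 2
    have hE : 0 ≤ D.eE M := h.valid.E_pos.le
    have h1 := pow_le_pow_left₀ (frob_nonneg _) (frob_le_frob_mix h.adm.TC_ge (mix D.piC S.Y)) 2
    have h2 := pow_le_pow_left₀ (frob_nonneg _) (frob_le_frob_mix h.adm.TR_ge (mix D.piR S.X)) 2
    have h3 := mul_le_mul_of_nonneg_left h2
      (show 0 ≤ M * lamHat P * (D.eE M * L ^ 2) by positivity)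
    have h4 := mul_le_mul_of_nonneg_left h1
      (show 0 ≤ M * lamHat P * (vecNorm D.uR ^ 2 / ((n : ℝ) ^ 2 * M ^ 2)) by positivity)
    linarith
  · refine hhy.trans ?_
    have h1 := mul_le_mul_of_nonneg_left hmixY (show 0 ≤ 2 / (P.αy * r * δ) by positivity)
    refine (add_le_add_right h1 _).trans (le_of_eq ?_)
    simp only [rates]
    ring
  · have h1 : Vy = (S.Y - S.Hy) + (trackerUpdate f S X' - S.Y) := by rw [hVy]; abel
    have h2 := (frob_add_le (S.Y - S.Hy) (trackerUpdate f S X' - S.Y)).trans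
      (add_le_add_right (h.frob_trackerUpdate_sub_le S X') _)
    rw [← h1] at h2
    have h3 := sq_le_of_le_add (frob_nonneg _) (show 0 < P.αy * r * δ / 4 by positivity)
      (by linarith) h2
    refine h3.trans (le_of_eq ?_)
    simp only [rates]
    field_simp

/-- The input of the second compression step is controlled by the Lyapunov function and the error
of the first compression step. -/
lemma exists_tracker_input_le : ∃ K₁ K₂ : ℝ, ∀ S : State n p, S.Consistent P f → ∀ Q : Rows n p,
    frob (trackerUpdate f S (nextX P S Q) - S.Hy) ^ 2 ≤
      K₁ * lyap (rates D P L M Cc r δ μ) D P f xs S +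
      K₂ * frob (localUpdate P S - S.Hx - Q) ^ 2 := by
  have w1 := h.valid.w1_pos
  have w2 := h.valid.w2_pos
  have w3 := h.valid.w3_pos
  have w5 := h.valid.w5_pos
  have hL := h.L_pos
  set c := rates D P L M Cc r δ μ
  refine ⟨2 / c.w5 + 2 * L ^ 2 * (3 * (D.aR P * P.γx) ^ 2 / c.w2 + 75 / 16 * D.δR ^ 2 *
    lamHat P ^ 2 * (3 / c.w3 + 3 * vecNorm D.uC ^ 2 * (2 * L) / c.w1 +
      3 * vecNorm D.uC ^ 2 * L ^ 2 / n / c.w2)),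
    2 * L ^ 2 * (3 * (D.aR P * P.γx) ^ 2 * D.δR ^ 2), fun S hS Q => ?_⟩
  obtain ⟨l1, l2, l3, -, l5⟩ := h.le_lyap S
  set V := lyap c D P f xs S
  have m1 : avgObj f (wavg D S.X) - avgObj f xs ≤ V / c.w1 := (le_div_iff₀' w1).2 l1
  have m2 : frob (mix D.TR (mix D.piR S.X)) ^ 2 ≤ V / c.w2 := (le_div_iff₀' w2).2 l2
  have m3 : frob (mix D.TC (mix D.piC S.Y)) ^ 2 ≤ V / c.w3 := (le_div_iff₀' w3).2 l3
  have m5 : frob (S.Y - S.Hy) ^ 2 ≤ V / c.w5 := (le_div_iff₀' w5).2 l5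
  have hg := (h.obj.sq_norm_gradient_le h.Lmax_le hL (wavg D S.X)).trans
    (mul_le_mul_of_nonneg_left m1 (by positivity))
  calc _ ≤ 2 * frob (S.Y - S.Hy) ^ 2 + 2 * L ^ 2 * frob (nextX P S Q - S.X) ^ 2 :=
        h.tracker_input_sq_le S Q
    _ ≤ 2 * (V / c.w5) + 2 * L ^ 2 * (3 * (D.aR P * P.γx) ^ 2 * (V / c.w2) +
        75 / 16 * D.δR ^ 2 * lamHat P ^ 2 * (3 * (V / c.w3) +
          3 * vecNorm D.uC ^ 2 * (2 * L * (V / c.w1)) +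
          3 * vecNorm D.uC ^ 2 * L ^ 2 / n * (V / c.w2)) +
        3 * (D.aR P * P.γx) ^ 2 * D.δR ^ 2 * frob (localUpdate P S - S.Hx - Q) ^ 2) := by
        gcongr
        refine (h.displacement_sq_le hS Q).trans ?_
        gcongr
        refine (h.frob_Y_sq_le hS).trans ?_
        gcongr
    _ = _ := by ring

end Regime

end Decrease

/-! ### The compression error in mean -/

section Compression

/-- A quadratic bound in mean over the seed `ζ`, uniform in the argument, passes to a random
argument `Z` that is independent of the seed. -/
lemma integrable_comp_of_indepFun {Ω Ξ H : Type*} [MeasurableSpace Ω] [MeasurableSpace Ξ]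
    [NormedAddCommGroup H] [MeasurableSpace H] {Pr : Measure Ω} [IsProbabilityMeasure Pr]
    {ν : Measure Ξ} [IsProbabilityMeasure ν] {Z : Ω → H} {ζ : Ω → Ξ} (hind : IndepFun Z ζ Pr)
    (hZ : Measurable Z) (hζ : Measurable ζ) (hν : Measure.map ζ Pr = ν) {g : Ξ × H → ℝ}
    (hg : Measurable g) (hg0 : ∀ z, 0 ≤ g z) {a b : ℝ}
    (hint : ∀ x, Integrable (fun ξ => g (ξ, x)) ν)
    (hbd : ∀ x, ∫ ξ, g (ξ, x) ∂ν ≤ a * ‖x‖ ^ 2 + b)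
    (hZ2 : Integrable (fun ω => ‖Z ω‖ ^ 2) Pr) (hm : Measurable fun x : H => ‖x‖ ^ 2) :
    Integrable (fun ω => g (ζ ω, Z ω)) Pr ∧
      ∫ ω, g (ζ ω, Z ω) ∂Pr ≤ a * ∫ ω, ‖Z ω‖ ^ 2 ∂Pr + b := by
  have : IsProbabilityMeasure (Measure.map Z Pr) :=
    Measure.isProbabilityMeasure_map hZ.aemeasurable
  have hmap : Measure.map (fun ω => (ζ ω, Z ω)) Pr = ν.prod (Measure.map Z Pr) := by
    rw [← hν]
    exact (indepFun_iff_map_prod_eq_prod_map_map hζ.aemeasurable hZ.aemeasurable).1 hind.symm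
  have hpair : Measurable fun ω => (ζ ω, Z ω) := hζ.prodMk hZ
  have hZ2' : Integrable (fun x => a * ‖x‖ ^ 2 + b) (Measure.map Z Pr) := by
    refine (Integrable.const_mul ?_ a).add (integrable_const b)
    exact (integrable_map_measure hm.aestronglyMeasurable hZ.aemeasurable).2 hZ2
  have hgi : Integrable g (ν.prod (Measure.map Z Pr)) := by
    rw [integrable_prod_iff' hg.aestronglyMeasurable]
    refine ⟨ae_of_all _ hint, hZ2'.mono'
      hg.norm.stronglyMeasurable.integral_prod_left'.aestronglyMeasurable ?_⟩
    refine ae_of_all _ fun x => ?_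
    rw [Real.norm_eq_abs, abs_of_nonneg (integral_nonneg fun _ => norm_nonneg _)]
    simp only [Real.norm_eq_abs, abs_of_nonneg (hg0 _)]
    exact hbd x
  have h1 : ∫ ω, g (ζ ω, Z ω) ∂Pr = ∫ z, g z ∂(ν.prod (Measure.map Z Pr)) := by
    rw [← hmap, integral_map hpair.aemeasurable hg.aestronglyMeasurable]
  refine ⟨?_, ?_⟩
  · rw [← hmap] at hgi
    exact (integrable_map_measure hg.aestronglyMeasurable hpair.aemeasurable).1 hgi
  · rw [h1, integral_prod_symm _ hgi]
    refine (integral_mono hgi.integral_prod_right hZ2' hbd).trans (le_of_eq ?_)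
    rw [integral_map hZ.aemeasurable hZ2'.aestronglyMeasurable,
      integral_add (hZ2.const_mul a) (integrable_const b), integral_const_mul]
    simp

variable {n p : ℕ}

lemma continuous_mix (A : Matrix (Fin n) (Fin n) ℝ) :
    Continuous (mix A : Rows n p → Rows n p) := by
  unfold mix
  fun_prop

lemma _root_.Measurable.mix {Ω : Type*} [MeasurableSpace Ω] {Q : Ω → Rows n p}
    (hQ : Measurable Q) (A : Matrix (Fin n) (Fin n) ℝ) : Measurable fun ω => mix A (Q ω) :=
  (continuous_mix A).measurable.comp hQ

lemma continuous_frob : Continuous (frob : Rows n p → ℝ) := by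
  unfold frob
  fun_prop

/-- Mean squared error of the dynamically scaled compressor, after multiplication of the output
with `κ`; the two cases of interest are `κ = 1` and `κ = 1 / r`. -/
lemma integral_scaledComp_error_le {Ω Ξ : Type*} [MeasurableSpace Ω] [MeasurableSpace Ξ]
    {Pr : Measure Ω} [IsProbabilityMeasure Pr] {ν : Measure Ξ} [IsProbabilityMeasure ν]
    {comp : Ξ → Dec p → Dec p} (hcomp : Measurable (Function.uncurry comp)) {κ a b : ℝ}
    (hint : ∀ x, Integrable (fun ξ => ‖κ • comp ξ x - x‖ ^ 2) ν)
    (hbd : ∀ x, ∫ ξ, ‖κ • comp ξ x - x‖ ^ 2 ∂ν ≤ a * ‖x‖ ^ 2 + b) {s : ℝ} (hs : s ≠ 0)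
    {V : Ω → Rows n p} {η : Ω → Fin n → Ξ} (hV : Measurable V) (hη : Measurable η)
    (hlaw : ∀ i, Measure.map (fun ω => η ω i) Pr = ν) (hind : IndepFun V η Pr)
    (hV2 : Integrable (fun ω => frob (V ω) ^ 2) Pr) :
    Integrable (fun ω => frob (V ω - κ • scaledComp comp s (η ω) (V ω)) ^ 2) Pr ∧
      ∫ ω, frob (V ω - κ • scaledComp comp s (η ω) (V ω)) ^ 2 ∂Pr ≤
        a * ∫ ω, frob (V ω) ^ 2 ∂Pr + n * (s ^ 2 * b) := by
  have hVi : ∀ i, Integrable (fun ω => ‖V ω i‖ ^ 2) Pr := by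
    intro i
    refine hV2.mono' (by fun_prop) (ae_of_all _ fun ω => ?_)
    rw [Real.norm_eq_abs, abs_of_nonneg (sq_nonneg _), frob_sq]
    exact Finset.single_le_sum (f := fun i => ‖V ω i‖ ^ 2) (fun _ _ => sq_nonneg _)
      (Finset.mem_univ i)
  have hscale : ∀ (ξ : Ξ) (x : Dec p), ‖x - κ • s • comp ξ (s⁻¹ • x)‖ ^ 2 =
      s ^ 2 * ‖κ • comp ξ (s⁻¹ • x) - s⁻¹ • x‖ ^ 2 := by
    intro ξ x
    have h1 : x - κ • s • comp ξ (s⁻¹ • x) = -(s • (κ • comp ξ (s⁻¹ • x) - s⁻¹ • x)) := by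
      rw [smul_sub, smul_inv_smul₀ hs, smul_comm]
      abel
    rw [h1, norm_neg, norm_smul, mul_pow, Real.norm_eq_abs, sq_abs]
  have key : ∀ i, Integrable (fun ω => ‖V ω i - κ • s • comp (η ω i) (s⁻¹ • V ω i)‖ ^ 2) Pr ∧
      ∫ ω, ‖V ω i - κ • s • comp (η ω i) (s⁻¹ • V ω i)‖ ^ 2 ∂Pr ≤
        a * ∫ ω, ‖V ω i‖ ^ 2 ∂Pr + s ^ 2 * b := by
    intro i
    have hc : Measurable fun z : Ξ × Dec p => comp z.1 (s⁻¹ • z.2) :=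
      hcomp.comp (measurable_fst.prodMk (measurable_snd.const_smul s⁻¹))
    refine integrable_comp_of_indepFun (Z := fun ω => V ω i) (ζ := fun ω => η ω i)
      (g := fun z => ‖z.2 - κ • s • comp z.1 (s⁻¹ • z.2)‖ ^ 2)
      (hind.comp (measurable_pi_apply i) (measurable_pi_apply i)) (by fun_prop) (by fun_prop)
      (hlaw i) (by fun_prop) (fun _ => sq_nonneg _) (fun x => ?_) (fun x => ?_) (hVi i)
      (by fun_prop)
    · simp only [hscale]
      exact (hint _).const_mul _
    · simp only [hscale, integral_const_mul]
      calc _ ≤ s ^ 2 * (a * ‖s⁻¹ • x‖ ^ 2 + b) :=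
            mul_le_mul_of_nonneg_left (hbd _) (sq_nonneg s)
        _ = _ := by
          rw [norm_smul, mul_pow, Real.norm_eq_abs, sq_abs]
          field_simp
  have hrow : ∀ ω, frob (V ω - κ • scaledComp comp s (η ω) (V ω)) ^ 2 =
      ∑ i, ‖V ω i - κ • s • comp (η ω i) (s⁻¹ • V ω i)‖ ^ 2 := fun ω => frob_sq _
  simp only [hrow, frob_sq]
  refine ⟨integrable_finsetSum _ fun i _ => (key i).1, ?_⟩
  rw [integral_finsetSum _ fun i _ => (key i).1, integral_finsetSum _ fun i _ => hVi i,
    Finset.mul_sum]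
  refine (Finset.sum_le_sum fun i _ => (key i).2).trans (le_of_eq ?_)
  simp [Finset.sum_add_distrib]

end Compression

/-! ### Measurability and independence of the iterates -/

section Iterates

variable {n p : ℕ} {Ω Ξ : Type*}

/-- Measurability of all components of a random state. -/
structure StateMeasurable [MeasurableSpace Ω] (S : Ω → State n p) : Prop where
  X : Measurable fun ω => (S ω).X
  Y : Measurable fun ω => (S ω).Y
  Hx : Measurable fun ω => (S ω).Hx
  Hy : Measurable fun ω => (S ω).Hy
  HR : Measurable fun ω => (S ω).HR
  HC : Measurable fun ω => (S ω).HC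

section

variable {mΩ : MeasurableSpace Ω} [MeasurableSpace Ξ] {P : Params n} {f : Fin n → Dec p → ℝ}
  {S : Ω → State n p} {Q : Ω → Rows n p}

lemma measurable_scaledComp {comp : Ξ → Dec p → Dec p}
    (hcomp : Measurable (Function.uncurry comp)) (s : ℝ) {η : Ω → Fin n → Ξ}
    {V : Ω → Rows n p} (hη : Measurable η) (hV : Measurable V) :
    Measurable fun ω => scaledComp comp s (η ω) (V ω) := by
  refine measurable_pi_lambda _ fun i => ?_
  have h1 : Measurable fun ω => (η ω i, s⁻¹ • V ω i) := by fun_prop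
  exact (hcomp.comp h1).const_smul s

namespace StateMeasurable

lemma localUpdate (hS : StateMeasurable S) : Measurable fun ω => localUpdate P (S ω) := by
  have hX := hS.X
  have hY := hS.Y
  unfold RCPP.localUpdate
  fun_prop

lemma nextX (hS : StateMeasurable S) (hQ : Measurable Q) :
    Measurable fun ω => nextX P (S ω) (Q ω) := by
  have h1 := hS.Hx
  have h2 := hS.HR
  have h3 := hS.localUpdate (P := P)
  have h4 := hQ.mix P.R
  unfold RCPP.nextX
  fun_prop

lemma trackerUpdate (hS : StateMeasurable S) (hf : Continuous (stackedGrad f))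
    {X' : Ω → Rows n p} (hX' : Measurable X') :
    Measurable fun ω => trackerUpdate f (S ω) (X' ω) := by
  have h1 : Measurable fun ω => stackedGrad f (X' ω) := hf.measurable.comp hX'
  have h2 : Measurable fun ω => stackedGrad f (S ω).X := hf.measurable.comp hS.X
  have h3 := hS.Y
  unfold RCPP.trackerUpdate
  fun_prop

lemma inputX (hS : StateMeasurable S) :
    Measurable fun ω => RCPP.localUpdate P (S ω) - (S ω).Hx :=
  hS.localUpdate.sub hS.Hx

lemma inputY (hS : StateMeasurable S) (hf : Continuous (stackedGrad f)) (hQ : Measurable Q) :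
    Measurable fun ω => RCPP.trackerUpdate f (S ω) (RCPP.nextX P (S ω) (Q ω)) - (S ω).Hy :=
  (hS.trackerUpdate hf (hS.nextX hQ)).sub hS.Hy

lemma nextState (hS : StateMeasurable S) (hf : Continuous (stackedGrad f))
    {Qx Qy : Ω → Rows n p} (hQx : Measurable Qx) (hQy : Measurable Qy) :
    StateMeasurable fun ω => nextState P f (S ω) (Qx ω) (Qy ω) := by
  have hR := hQx.mix P.R
  have hC := hQy.mix P.C
  have hX := hS.nextX (P := P) hQx
  have hY := hS.trackerUpdate hf hX
  have hHx := hS.Hx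
  have hHy := hS.Hy
  have hHR := hS.HR
  have hHC := hS.HC
  constructor <;> simp only [RCPP.nextState] <;> fun_prop

lemma lyap (hS : StateMeasurable S) (hf : Differentiable ℝ (avgObj f)) (c : Rates)
    (D : NormData n) (xs : Dec p) : Measurable fun ω => lyap c D P f xs (S ω) := by
  have hX := hS.X
  have h1 : Measurable fun ω => wavg D (S ω).X := by
    unfold wavg
    fun_prop
  have h2 : Measurable fun ω => avgObj f (wavg D (S ω).X) := hf.continuous.measurable.comp h1
  have h3 : ∀ {Z : Ω → Rows n p}, Measurable Z → Measurable fun ω => frob (Z ω) ^ 2 := fun hZ =>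
    (continuous_frob.measurable.comp hZ).pow_const 2
  have h4 := h3 ((hS.X.mix D.piR).mix D.TR)
  have h5 := h3 ((hS.Y.mix D.piC).mix D.TC)
  have h6 : Measurable fun ω => frob (RCPP.localUpdate P (S ω) - (S ω).Hx) ^ 2 :=
    h3 (hS.localUpdate.sub hS.Hx)
  have h7 : Measurable fun ω => frob ((S ω).Y - (S ω).Hy) ^ 2 := h3 (hS.Y.sub hS.Hy)
  exact (((((h2.sub_const _).const_mul _).add (h4.const_mul _)).add (h5.const_mul _)).add
    (h6.const_mul _)).add (h7.const_mul _)

end StateMeasurable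

/-- The iterates depend measurably on the seeds that have been used. -/
lemma stateMeasurable_iterate (hf : Continuous (stackedGrad f)) {comp : Ξ → Dec p → Dec p}
    (hcomp : Measurable (Function.uncurry comp)) (s : ℕ → ℝ) (X0 : Rows n p)
    {ξ : ℕ × Fin 2 → Ω → Fin n → Ξ} :
    ∀ k, (∀ j : ℕ × Fin 2, j.1 < k → Measurable (ξ j)) →
      StateMeasurable fun ω => iterate P f comp s X0 (fun j => ξ j ω) k
  | 0, _ => by constructor <;> exact measurable_const
  | k + 1, hξ => by
    have hS := stateMeasurable_iterate hf hcomp s X0 k fun j hj => hξ j (hj.trans k.lt_succ_self)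
    have hQx := measurable_scaledComp hcomp (s k) (hξ (k, 0) k.lt_succ_self)
      (hS.inputX (P := P))
    exact hS.nextState hf hQx (measurable_scaledComp hcomp (s k) (hξ (k, 1) k.lt_succ_self)
      (hS.inputY hf hQx))

end

lemma indepFun_of_measurable_iSup {ι β γ : Type*} [MeasurableSpace Ω] [MeasurableSpace β]
    [MeasurableSpace γ] {Pr : Measure Ω} {ξ : ι → Ω → γ} (hξ : ∀ j, Measurable (ξ j))
    (hind : iIndepFun ξ Pr) {T : Set ι} {j : ι} (hj : j ∉ T) {V : Ω → β}
    (hV : @Measurable _ _ (⨆ i ∈ T, MeasurableSpace.comap (ξ i) inferInstance) _ V) :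
    IndepFun V (ξ j) Pr := by
  have h1 := indep_iSup_of_disjoint (fun i => (hξ i).comap_le) hind.iIndep
    (Set.disjoint_singleton_right.2 hj)
  rw [IndepFun_iff_Indep]
  have h2 := indep_of_indep_of_le_left h1 hV.comap_le
  simpa using h2

lemma consistent_iterate {P : Params n} {f : Fin n → Dec p → ℝ}
    (hC : P.C ∈ Matrix.colStochastic ℝ (Fin n)) (comp : Ξ → Dec p → Dec p) (s : ℕ → ℝ)
    (X0 : Rows n p) (ξ : ℕ × Fin 2 → Fin n → Ξ) :
    ∀ k, (iterate P f comp s X0 ξ k).Consistent P f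
  | 0 => ⟨(mix_zero _).symm, (mix_zero _).symm, rfl⟩
  | k + 1 => (consistent_iterate hC comp s X0 ξ k).nextState hC _ _

end Iterates

/-! ### Convergence in mean -/

section Mean

variable {n p : ℕ} {D : NormData n} {P : Params n} {f : Fin n → Dec p → ℝ} {Ls : Fin n → ℝ≥0}
  {xs : Dec p} {L M Cc r δ μ : ℝ} {Ω Ξ : Type*} [MeasurableSpace Ω] [MeasurableSpace Ξ]
  {Pr : Measure Ω} [IsProbabilityMeasure Pr] {ν : Measure Ξ} [IsProbabilityMeasure ν]
  {comp : Ξ → Dec p → Dec p} {σsq σrsq : ℝ}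

/-- The excess of a compression error over its bound by the input has mean at most `n s² b`. -/
lemma integral_excess_le (hcomp : Measurable (Function.uncurry comp)) {κ a b : ℝ}
    (hint : ∀ x, Integrable (fun ξ => ‖κ • comp ξ x - x‖ ^ 2) ν)
    (hbd : ∀ x, ∫ ξ, ‖κ • comp ξ x - x‖ ^ 2 ∂ν ≤ a * ‖x‖ ^ 2 + b) {s : ℝ} (hs : s ≠ 0)
    {V : Ω → Rows n p} {η : Ω → Fin n → Ξ} (hV : Measurable V) (hη : Measurable η)
    (hlaw : ∀ i, Measure.map (fun ω => η ω i) Pr = ν) (hind : IndepFun V η Pr)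
    (hV2 : Integrable (fun ω => frob (V ω) ^ 2) Pr) :
    Integrable (fun ω => frob (V ω - κ • scaledComp comp s (η ω) (V ω)) ^ 2 -
        a * frob (V ω) ^ 2) Pr ∧
      ∫ ω, (frob (V ω - κ • scaledComp comp s (η ω) (V ω)) ^ 2 - a * frob (V ω) ^ 2) ∂Pr ≤
        n * b * s ^ 2 := by
  obtain ⟨h1, h2⟩ := integral_scaledComp_error_le hcomp hint hbd hs hV hη hlaw hind hV2
  refine ⟨h1.sub (hV2.const_mul a), ?_⟩
  rw [integral_sub h1 (hV2.const_mul a), integral_const_mul]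
  linarith

namespace Regime

variable [NeZero n] (h : Regime D P f Ls xs L M Cc r δ μ)
  (hcomp : CompressorAssumption ν comp Cc σsq r δ σrsq)
  {ξ : ℕ × Fin 2 → Ω → Fin n → Ξ} (hξ : SeedAssumption Pr ν ξ)
include h hcomp hξ

lemma integral_lyap_step {ρ : ℝ} (hρ : rhoTilde D P M μ r δ ≤ ρ) {s : ℕ → ℝ} (hs : ∀ k, s k ≠ 0)
    (X0 : Rows n p) (k : ℕ)
    (hV : Integrable (fun ω => lyap (rates D P L M Cc r δ μ) D P f xs
      (iterate P f comp s X0 (fun j => ξ j ω) k)) Pr) :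
    Integrable (fun ω => lyap (rates D P L M Cc r δ μ) D P f xs
      (iterate P f comp s X0 (fun j => ξ j ω) (k + 1))) Pr ∧
    ∫ ω, lyap (rates D P L M Cc r δ μ) D P f xs
        (iterate P f comp s X0 (fun j => ξ j ω) (k + 1)) ∂Pr ≤
      ρ * ∫ ω, lyap (rates D P L M Cc r δ μ) D P f xs
        (iterate P f comp s X0 (fun j => ξ j ω) k) ∂Pr +
      n * ((rates D P L M Cc r δ μ).cex * σsq + (rates D P L M Cc r δ μ).cey * σsq +
        (rates D P L M Cc r δ μ).w4 * (P.αx * r / (1 - P.αx * r * δ / 2)) * σrsq +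
        (rates D P L M Cc r δ μ).w5 * (P.αy * r / (1 - P.αy * r * δ / 2)) * σrsq) *
          s k ^ 2 := by
  have hbx1 : P.αx * r * δ ≤ 1 := h.valid.bx_le
  have hby1 : P.αy * r * δ ≤ 1 := h.valid.by_le
  have hκx : 0 ≤ P.αx * r / (1 - P.αx * r * δ / 2) :=
    div_nonneg (mul_nonneg h.αx_pos.le h.r_pos.le) (by linarith)
  have hκy : 0 ≤ P.αy * r / (1 - P.αy * r * δ / 2) :=
    div_nonneg (mul_nonneg h.αy_pos.le h.r_pos.le) (by linarith)
  have hcex := h.valid.cex_nonneg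
  have hcey := h.valid.cey_nonneg
  have hw4 := h.valid.w4_pos
  have hw5 := h.valid.w5_pos
  have hstep := fun (S : State n p) hS => h.lyap_step hρ (S := S) hS
  have hle := h.le_lyap
  have hnonneg := h.lyap_nonneg
  obtain ⟨K₁, K₂, hK⟩ := h.exists_tracker_input_le
  set c := rates D P L M Cc r δ μ
  set S : Ω → State n p := fun ω => iterate P f comp s X0 (fun j => ξ j ω) k with hSdef
  have hF := h.obj.continuous_stackedGrad
  have hcons : ∀ ω, (S ω).Consistent P f := fun ω =>
    consistent_iterate h.colStochastic comp s X0 _ k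
  have hSm : StateMeasurable S :=
    stateMeasurable_iterate hF hcomp.measurable s X0 k fun j _ => hξ.measurable j
  -- The state of iteration `k` only depends on the seeds of earlier iterations.
  have hseed : ∀ (T : Set (ℕ × Fin 2)), ∀ j ∈ T,
      @Measurable _ _ (⨆ i ∈ T, MeasurableSpace.comap (ξ i) inferInstance) _ (ξ j) :=
    fun T j hj => (comap_measurable (ξ j)).mono
      (le_iSup₂ (f := fun i (_ : i ∈ T) => MeasurableSpace.comap (ξ i) inferInstance) j hj) le_rfl
  have hpast : ∀ T : Set (ℕ × Fin 2), (∀ j : ℕ × Fin 2, j.1 < k → j ∈ T) →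
      @StateMeasurable n p Ω (⨆ i ∈ T, MeasurableSpace.comap (ξ i) inferInstance) S :=
    fun T hT => stateMeasurable_iterate (mΩ := _) hF hcomp.measurable s X0 k
      fun j hj => hseed T j (hT j hj)
  set Vx : Ω → Rows n p := fun ω => localUpdate P (S ω) - (S ω).Hx with hVx
  set Qx : Ω → Rows n p := fun ω => scaledComp comp (s k) (ξ (k, 0) ω) (Vx ω) with hQx
  set Vy : Ω → Rows n p :=
    fun ω => trackerUpdate f (S ω) (nextX P (S ω) (Qx ω)) - (S ω).Hy with hVy
  set Qy : Ω → Rows n p := fun ω => scaledComp comp (s k) (ξ (k, 1) ω) (Vy ω) with hQy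
  have hVxm : Measurable Vx := hSm.inputX
  have hQxm : Measurable Qx := measurable_scaledComp hcomp.measurable _ (hξ.measurable _) hVxm
  have hVym : Measurable Vy := hSm.inputY hF hQxm
  have hQym : Measurable Qy := measurable_scaledComp hcomp.measurable _ (hξ.measurable _) hVym
  have hindx : IndepFun Vx (ξ (k, 0)) Pr := by
    refine indepFun_of_measurable_iSup (T := {j | j.1 < k}) hξ.measurable hξ.indep (by simp) ?_
    have h1 := hpast {j | j.1 < k} fun j hj => hj
    exact h1.inputX
  have hindy : IndepFun Vy (ξ (k, 1)) Pr := by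
    refine indepFun_of_measurable_iSup (T := {j | j.1 < k ∨ j = (k, 0)}) hξ.measurable hξ.indep
      (by simp) ?_
    have h1 := hpast {j | j.1 < k ∨ j = (k, 0)} fun j hj => Or.inl hj
    have h2 := measurable_scaledComp hcomp.measurable (s k)
      (hseed {j | j.1 < k ∨ j = (k, 0)} (k, 0) (Or.inr rfl))
      (h1.inputX (P := P))
    exact h1.inputY hF h2
  have herr : ∀ x, Integrable (fun ξ => ‖(1 : ℝ) • comp ξ x - x‖ ^ 2) ν := by
    simpa only [one_smul] using hcomp.integrable
  have herr' : ∀ x, ∫ ξ, ‖(1 : ℝ) • comp ξ x - x‖ ^ 2 ∂ν ≤ Cc * ‖x‖ ^ 2 + σsq := by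
    simpa only [one_smul] using hcomp.error
  -- The input of the first compression step is a term of the Lyapunov function; that of the second
  -- one is controlled by the Lyapunov function and the first compression error.
  have hVx2 : Integrable (fun ω => frob (Vx ω) ^ 2) Pr := by
    refine (hV.const_mul c.w4⁻¹).mono'
      ((continuous_frob.measurable.comp hVxm).pow_const 2).aestronglyMeasurable
      (ae_of_all _ fun ω => ?_)
    rw [Real.norm_eq_abs, abs_of_nonneg (sq_nonneg _), inv_mul_eq_div, le_div_iff₀' hw4]
    exact (hle (S ω)).2.2.2.1
  obtain ⟨ix, lx⟩ := integral_excess_le hcomp.measurable herr herr' (hs k) hVxm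
    (hξ.measurable (k, 0)) (hξ.law (k, 0)) hindx hVx2
  obtain ⟨ix', lx'⟩ := integral_excess_le hcomp.measurable hcomp.integrable_scaled
    hcomp.error_scaled (hs k) hVxm (hξ.measurable (k, 0)) (hξ.law (k, 0)) hindx hVx2
  have hex : Integrable (fun ω => frob (Vx ω - Qx ω) ^ 2) Pr := by
    have := ix.add (hVx2.const_mul Cc)
    simpa only [one_smul, Pi.add_def, sub_add_cancel] using this
  have hVy2 : Integrable (fun ω => frob (Vy ω) ^ 2) Pr := by
    refine ((hV.const_mul K₁).add (hex.const_mul K₂)).mono'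
      ((continuous_frob.measurable.comp hVym).pow_const 2).aestronglyMeasurable
      (ae_of_all _ fun ω => ?_)
    rw [Real.norm_eq_abs, abs_of_nonneg (sq_nonneg _)]
    exact hK (S ω) (hcons ω) (Qx ω)
  obtain ⟨iy, ly⟩ := integral_excess_le hcomp.measurable herr herr' (hs k) hVym
    (hξ.measurable (k, 1)) (hξ.law (k, 1)) hindy hVy2
  obtain ⟨iy', ly'⟩ := integral_excess_le hcomp.measurable hcomp.integrable_scaled
    hcomp.error_scaled (hs k) hVym (hξ.measurable (k, 1)) (hξ.law (k, 1)) hindy hVy2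
  simp only [one_smul] at ix lx iy ly
  have hpt := fun ω => hstep (S ω) (hcons ω) (Qx ω) (Qy ω)
  have hi1 := ((ix.const_mul c.cex).add (iy.const_mul c.cey)).add
    ((ix'.const_mul (P.αx * r / (1 - P.αx * r * δ / 2))).const_mul c.w4)
  have hi2 := hi1.add ((iy'.const_mul (P.αy * r / (1 - P.αy * r * δ / 2))).const_mul c.w5)
  have hi := (hV.const_mul ρ).add hi2
  have hV' : Integrable (fun ω => lyap c D P f xs (nextState P f (S ω) (Qx ω) (Qy ω))) Pr := by
    refine hi.mono' ((hSm.nextState hF hQxm hQym).lyap h.obj.differentiable_avgObj c D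
      xs).aestronglyMeasurable (ae_of_all _ fun ω => ?_)
    rw [Real.norm_eq_abs, abs_of_nonneg (hnonneg _)]
    exact hpt ω
  refine ⟨hV', (integral_mono hV' hi hpt).trans ?_⟩
  rw [integral_add' (hV.const_mul ρ) hi2,
    integral_add' hi1 ((iy'.const_mul (P.αy * r / (1 - P.αy * r * δ / 2))).const_mul c.w5),
    integral_add' ((ix.const_mul c.cex).add (iy.const_mul c.cey))
      ((ix'.const_mul (P.αx * r / (1 - P.αx * r * δ / 2))).const_mul c.w4),
    integral_add' (ix.const_mul c.cex) (iy.const_mul c.cey)]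
  simp only [integral_const_mul]
  have t1 := mul_le_mul_of_nonneg_left lx hcex
  have t2 := mul_le_mul_of_nonneg_left ly hcey
  have t3 := mul_le_mul_of_nonneg_left lx' (mul_nonneg hw4.le hκx)
  have t4 := mul_le_mul_of_nonneg_left ly' (mul_nonneg hw5.le hκy)
  linarith

end Regime

end Mean

section Conclusion

lemma le_geometric_of_recursion {a : ℕ → ℝ} {ρ c K : ℝ} (hρ : 0 ≤ ρ) (hc : ρ < c) (hK : 0 ≤ K)
    (ha : 0 ≤ a 0) (h : ∀ k, a (k + 1) ≤ ρ * a k + K * c ^ k) (k : ℕ) :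
    a k ≤ (a 0 + K / (c - ρ)) * c ^ k := by
  have hcρ : 0 < c - ρ := sub_pos.2 hc
  induction k with
  | zero =>
    have : 0 ≤ K / (c - ρ) := by positivity
    simpa using this
  | succ k ih =>
    have hck : 0 ≤ c ^ k := pow_nonneg (hρ.trans hc.le) k
    have h1 := mul_le_mul_of_nonneg_left ih hρ
    have h2 : K / (c - ρ) * (c - ρ) = K := div_mul_cancel₀ K hcρ.ne'
    have h3 : 0 ≤ a 0 * (c - ρ) * c ^ k := by positivity
    calc a (k + 1) ≤ ρ * ((a 0 + K / (c - ρ)) * c ^ k) + K / (c - ρ) * (c - ρ) * c ^ k := by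
          rw [h2]
          linarith [h k]
      _ ≤ _ := by
        rw [pow_succ]
        linarith

/-- A nonnegative quantity dominated by a function with geometrically decaying mean. -/
lemma mean_convergence_of_le {Ω : Type*} [MeasurableSpace Ω] {Pr : Measure Ω} {V g : ℕ → Ω → ℝ}
    {w A c : ℝ} (hw : 0 < w) (hc : 0 < c) (hc1 : c < 1) (hg0 : ∀ k ω, 0 ≤ g k ω)
    (hg : ∀ k, Measurable (g k)) (hgV : ∀ k ω, w * g k ω ≤ V k ω)
    (hV : ∀ k, Integrable (V k) Pr) (hA : ∀ k, ∫ ω, V k ω ∂Pr ≤ A * c ^ k) :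
    (∀ k, Integrable (g k) Pr) ∧ Tendsto (fun k => ∫ ω, g k ω ∂Pr) atTop (𝓝 0) ∧
      (fun k => ∫ ω, g k ω ∂Pr) =O[atTop] (fun k : ℕ => c ^ k) := by
  have hle : ∀ k ω, g k ω ≤ w⁻¹ * V k ω := fun k ω => by
    rw [inv_mul_eq_div, le_div_iff₀' hw]
    exact hgV k ω
  have hint : ∀ k, Integrable (g k) Pr := fun k =>
    ((hV k).const_mul w⁻¹).mono' (hg k).aestronglyMeasurable (ae_of_all _ fun ω => by
      rw [Real.norm_eq_abs, abs_of_nonneg (hg0 k ω)]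
      exact hle k ω)
  have hO : (fun k => ∫ ω, g k ω ∂Pr) =O[atTop] (fun k : ℕ => c ^ k) := by
    refine IsBigO.of_bound (w⁻¹ * A) (Eventually.of_forall fun k => ?_)
    rw [Real.norm_eq_abs, Real.norm_eq_abs, abs_of_nonneg (integral_nonneg (hg0 k)),
      abs_of_nonneg (by positivity)]
    calc _ ≤ w⁻¹ * ∫ ω, V k ω ∂Pr := by
          rw [← integral_const_mul]
          exact integral_mono (hint k) ((hV k).const_mul _) (hle k)
      _ ≤ w⁻¹ * (A * c ^ k) := mul_le_mul_of_nonneg_left (hA k) (by positivity)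
      _ = _ := by ring
  exact ⟨hint, hO.trans_tendsto (tendsto_pow_atTop_nhds_zero_of_lt_one hc.le hc1), hO⟩

variable {n p : ℕ} [NeZero n] {D : NormData n} {P : Params n} {f : Fin n → Dec p → ℝ}
  {Ls : Fin n → ℝ≥0} {xs : Dec p} {L M Cc r δ μ : ℝ}

theorem Regime.mean_convergence (h : Regime D P f Ls xs L M Cc r δ μ) {Ω Ξ : Type*}
    [MeasurableSpace Ω] [MeasurableSpace Ξ] {Pr : Measure Ω} [IsProbabilityMeasure Pr]
    {ν : Measure Ξ} [IsProbabilityMeasure ν] {comp : Ξ → Dec p → Dec p} {σsq σrsq : ℝ}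
    (hcomp : CompressorAssumption ν comp Cc σsq r δ σrsq)
    {ξ : ℕ × Fin 2 → Ω → Fin n → Ξ} (hξ : SeedAssumption Pr ν ξ) {c c₀ : ℝ}
    (hρc : rhoTilde D P M μ r δ < c) (hc1 : c < 1) (hc₀ : 0 < c₀) {s : ℕ → ℝ}
    (hs : ∀ k, s k ^ 2 = c₀ * c ^ k) (X0 : Rows n p) :
    ((∀ k, Integrable (fun ω => avgObj f (wavg D (iterate P f comp s X0 (fun j => ξ j ω) k).X) -
        avgObj f xs) Pr) ∧
      Tendsto (fun k => ∫ ω, (avgObj f (wavg D (iterate P f comp s X0 (fun j => ξ j ω) k).X) -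
        avgObj f xs) ∂Pr) atTop (𝓝 0) ∧
      (fun k => ∫ ω, (avgObj f (wavg D (iterate P f comp s X0 (fun j => ξ j ω) k).X) -
        avgObj f xs) ∂Pr) =O[atTop] (fun k : ℕ => c ^ k)) ∧
    ((∀ k, Integrable (fun ω =>
        rowsNormSq D.TR (mix D.piR (iterate P f comp s X0 (fun j => ξ j ω) k).X)) Pr) ∧
      Tendsto (fun k => ∫ ω,
        rowsNormSq D.TR (mix D.piR (iterate P f comp s X0 (fun j => ξ j ω) k).X) ∂Pr)
          atTop (𝓝 0) ∧
      (fun k => ∫ ω,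
        rowsNormSq D.TR (mix D.piR (iterate P f comp s X0 (fun j => ξ j ω) k).X) ∂Pr)
          =O[atTop] (fun k : ℕ => c ^ k)) := by
  have hρ0 : 0 < rhoTilde D P M μ r δ := by
    have h1 : 1 - D.θR * P.γx / 16 ≤ rhoTilde D P M μ r δ :=
      (le_max_left _ _).trans (le_max_right _ _)
    linarith [h.tR_le_one]
  have hc : 0 < c := hρ0.trans hρc
  have hs0 : ∀ k, s k ≠ 0 := fun k hk => by
    have h1 := hs k
    have h2 : 0 < c₀ * c ^ k := by positivity
    rw [hk, zero_pow two_ne_zero] at h1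
    exact h2.ne h1
  have hstep := h.integral_lyap_step hcomp hξ le_rfl hs0 X0
  have hle := fun k ω => h.le_lyap (iterate P f comp s X0 (fun j => ξ j ω) k)
  have h0 : ∀ k ω, 0 ≤ lyap (rates D P L M Cc r δ μ) D P f xs
    (iterate P f comp s X0 (fun j => ξ j ω) k) := fun k ω => h.lyap_nonneg _
  have hbx1 : P.αx * r * δ ≤ 1 := h.valid.bx_le
  have hby1 : P.αy * r * δ ≤ 1 := h.valid.by_le
  have hκx : 0 ≤ P.αx * r / (1 - P.αx * r * δ / 2) :=
    div_nonneg (mul_nonneg h.αx_pos.le h.r_pos.le) (by linarith)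
  have hκy : 0 ≤ P.αy * r / (1 - P.αy * r * δ / 2) :=
    div_nonneg (mul_nonneg h.αy_pos.le h.r_pos.le) (by linarith)
  have hcex := h.valid.cex_nonneg
  have hcey := h.valid.cey_nonneg
  have hw1 := h.valid.w1_pos
  have hw2 := h.valid.w2_pos
  have hw4 := h.valid.w4_pos
  have hw5 := h.valid.w5_pos
  have hσ := hcomp.σsq_nonneg
  have hσr := hcomp.σrsq_nonneg
  set R := rates D P L M Cc r δ μ
  set V : ℕ → Ω → ℝ := fun k ω =>
    lyap R D P f xs (iterate P f comp s X0 (fun j => ξ j ω) k) with hVdef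
  have hV : ∀ k, Integrable (V k) Pr := by
    intro k
    induction k with
    | zero => exact integrable_const (lyap R D P f xs ⟨X0, stackedGrad f X0, 0, 0, 0, 0⟩)
    | succ k ih => exact (hstep k ih).1
  have hgeo := le_geometric_of_recursion (a := fun k => ∫ ω, V k ω ∂Pr) hρ0.le hρc
    (K := n * (R.cex * σsq + R.cey * σsq + R.w4 * (P.αx * r / (1 - P.αx * r * δ / 2)) * σrsq +
      R.w5 * (P.αy * r / (1 - P.αy * r * δ / 2)) * σrsq) * c₀) (by positivity)
    (integral_nonneg (h0 0)) fun k => by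
      refine (hstep k (hV k)).2.trans (le_of_eq ?_)
      rw [hs k, mul_assoc _ c₀]
  have hSm : ∀ k, StateMeasurable fun ω => iterate P f comp s X0 (fun j => ξ j ω) k := fun k =>
    stateMeasurable_iterate h.obj.continuous_stackedGrad hcomp.measurable s X0 k
      fun j _ => hξ.measurable j
  refine ⟨mean_convergence_of_le hw1 hc hc1 (fun k ω => h.obj.gap_nonneg _) (fun k => ?_)
    (fun k ω => (hle k ω).1) hV hgeo, ?_⟩
  · have hX := (hSm k).X
    have h1 : Measurable fun ω => wavg D (iterate P f comp s X0 (fun j => ξ j ω) k).X := by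
      unfold wavg
      fun_prop
    exact (h.obj.differentiable_avgObj.continuous.measurable.comp h1).sub_const _
  · simp only [rowsNormSq_eq]
    refine mean_convergence_of_le hw2 hc hc1 (fun k ω => sq_nonneg _) (fun k => ?_)
      (fun k ω => (hle k ω).2.1) hV hgeo
    exact (continuous_frob.measurable.comp (((hSm k).X.mix D.piR).mix D.TR)).pow_const 2

/-- With a single agent the step-size bounds force all gradients to be constant. -/
lemma Lmax_eq_zero_of_one_agent {D : NormData 1} {P : Params 1} {Ls : Fin 1 → ℝ≥0}
    (hD : D.Admissible P.R P.C P.γx P.γy) (hR : P.R ∈ Matrix.rowStochastic ℝ (Fin 1))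
    (hM : 0 < M) (hl : 0 < lamHat P) (hs : StepSizeBound D P (Lmax Ls) M Cc) :
    Lmax Ls = 0 := by
  have hR1 : P.R = 1 := by
    ext i j
    have h1 := Matrix.sum_row_of_mem_rowStochastic hR i
    rw [Fin.sum_univ_one] at h1
    rw [Subsingleton.elim j 0, h1, Subsingleton.elim i 0, Matrix.one_apply_eq]
  have haR : D.aR P = 0 := by simp [NormData.aR, inducedNorm, specNorm, hR1]
  have hbR : 0 < D.bR P := by
    have h1 : D.bR P = specNorm (1 : Matrix (Fin 1) (Fin 1) ℝ) := by
      rw [NormData.bR, inducedNorm, relaxed, hR1, sub_self, smul_zero, sub_zero, Matrix.mul_one,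
        Matrix.mul_nonsing_inv _ ((Matrix.isUnit_iff_isUnit_det _).1 hD.TR_unit)]
    rw [h1]
    exact zero_lt_one.trans_le (one_le_specNorm fun v => by rw [Matrix.one_mulVec])
  have hb := hs.b5b
  rw [show D.c32 P = 3 * D.aR P ^ 2 from rfl, haR] at hb
  have hc3 : 0 < √(D.c3 P) := Real.sqrt_pos.2 (mul_pos three_pos (pow_pos hbR 2))
  have hm := vecNorm_pos hD.uR_ne_zero
  have hu := vecNorm_pos hD.uC_ne_zero
  have hE : 0 < √(96 * D.eE M) := by
    have h1 : 0 < D.eE M := by unfold NormData.eE; positivity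
    positivity
  refine le_antisymm ?_ (Lmax_nonneg Ls)
  have h1 : 0 < √(D.c3 P) * √(96 * D.eE M) * vecNorm D.uC * lamHat P := by positivity
  refine nonpos_of_mul_nonpos_right (a := √(D.c3 P) * √(96 * D.eE M) * vecNorm D.uC * lamHat P)
    ?_ h1
  rw [zero_pow two_ne_zero, mul_zero, Real.sqrt_zero, zero_mul] at hb
  linarith

end Conclusion

end RCPP

theorem theorem1 {n : ℕ} [NeZero n] (E : Fin n → Fin n → Prop)
    (R C : Matrix (Fin n) (Fin n) ℝ) (hnet : RCPP.NetworkAssumption E R C) :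
    (∀ γmax : ℝ, 0 < γmax → γmax < 1 →
      ∃ D : RCPP.NormData n, 0 < ∑ i, D.uR i * D.uC i ∧
        ∀ γx γy : ℝ, 0 < γx → γx ≤ γmax → 0 < γy → γy ≤ γmax → D.Admissible R C γx γy) ∧
    ∀ (p : ℕ) (f : Fin n → RCPP.Dec p → ℝ) (L : Fin n → ℝ≥0) (μ : ℝ) (xs : RCPP.Dec p)
      (_ : RCPP.ObjectiveAssumption f L μ xs)
      (Ξ : Type*) [MeasurableSpace Ξ] (ν : Measure Ξ) [IsProbabilityMeasure ν]
      (comp : Ξ → RCPP.Dec p → RCPP.Dec p) (Cc σsq r δ σrsq : ℝ)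
      (_ : RCPP.CompressorAssumption ν comp Cc σsq r δ σrsq)
      (Ω : Type*) [MeasurableSpace Ω] (Pr : Measure Ω) [IsProbabilityMeasure Pr]
      (ξ : ℕ × Fin 2 → Ω → Fin n → Ξ) (_ : RCPP.SeedAssumption Pr ν ξ)
      (P : RCPP.Params n) (_ : P.R = R) (_ : P.C = C) (_ : ∀ i, 0 ≤ P.lam i)
      (_ : 0 < P.αx) (_ : P.αx ≤ 1 / r) (_ : 0 < P.αy) (_ : P.αy ≤ 1 / r)
      (_ : 0 < P.γx) (_ : 0 < P.γy)
      (D : RCPP.NormData n) (_ : D.Admissible R C P.γx P.γy)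
      (M : ℝ) (_ : 0 < M) (_ : M * RCPP.lamHat P ≤ RCPP.lamBar D P)
      (_ : RCPP.StepSizeBound D P (RCPP.Lmax L) M Cc)
      (_ : RCPP.GammaXBound D P M Cc r δ)
      (_ : RCPP.GammaYBound D P Cc r δ)
      (c c₀ : ℝ) (_ : RCPP.rhoTilde D P M μ r δ < c) (_ : c < 1) (_ : 0 < c₀)
      (s : ℕ → ℝ) (_ : ∀ k, s k ^ 2 = c₀ * c ^ k)
      (X0 : RCPP.Rows n p),
      let X : ℕ → Ω → RCPP.Rows n p :=
        fun k ω => (RCPP.iterate P f comp s X0 (fun j => ξ j ω) k).X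
      let gap : ℕ → Ω → ℝ :=
        fun k ω => RCPP.avgObj f (RCPP.wavg D (X k ω)) - RCPP.avgObj f xs
      let cons : ℕ → Ω → ℝ :=
        fun k ω => RCPP.rowsNormSq D.TR (RCPP.mix D.piR (X k ω))
      (∀ k, Integrable (gap k) Pr) ∧ (∀ k, Integrable (cons k) Pr) ∧
      Tendsto (fun k => ∫ ω, gap k ω ∂Pr) atTop (𝓝 0) ∧
      Tendsto (fun k => ∫ ω, cons k ω ∂Pr) atTop (𝓝 0) ∧
      (fun k => ∫ ω, gap k ω ∂Pr) =O[atTop] (fun k : ℕ => c ^ k) ∧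
      (fun k => ∫ ω, cons k ω ∂Pr) =O[atTop] (fun k : ℕ => c ^ k) := by
  refine ⟨fun γmax h0 h1 => RCPP.exists_admissible hnet h0 h1, ?_⟩
  intro p f L μ xs hf Ξ _ ν _ comp Cc σsq r δ σrsq hcomp Ω _ Pr _ ξ hξ P hPR hPC hlam hαx hαx1
    hαy hαy1 hγx hγy D hD M hM hMl hs hx hy c c₀ hρc hc1 hc₀ s hsk X0
  subst hPR hPC
  -- A vanishing largest step-size is excluded, since then the lower bound for `c` is at least `1`.
  have hl : 0 < RCPP.lamHat P := by
    refine (Real.iSup_nonneg hlam).lt_of_ne fun h0 => ?_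
    have h1 : 1 - M * RCPP.lamHat P * μ / 2 ≤ RCPP.rhoTilde D P M μ r δ := le_max_left _ _
    rw [show RCPP.lamHat P = 0 from h0.symm, mul_zero, zero_mul, zero_div, sub_zero] at h1
    linarith
  rcases Nat.lt_or_ge n 2 with hn | hn
  · obtain rfl : n = 1 := by
      have := NeZero.pos n
      omega
    have hL := RCPP.Lmax_eq_zero_of_one_agent hD hnet.rowStochastic hM hl hs
    have hgap : ∀ x, RCPP.avgObj f x - RCPP.avgObj f xs = 0 := hf.gap_eq_zero hL
    have hcons : ∀ X : RCPP.Rows 1 p, RCPP.rowsNormSq D.TR (RCPP.mix D.piR X) = 0 := by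
      intro X
      have h1 : RCPP.mix D.piR X = 0 := by
        funext i
        have h2 : D.uR 0 = 1 := by simpa using hD.uR_sum
        rw [RCPP.NormData.Admissible.mix_piR_apply, RCPP.wavg]
        simp [h2, Subsingleton.elim i 0]
      rw [h1, RCPP.rowsNormSq_eq, RCPP.mix_zero]
      simp [RCPP.frob]
    simp only [hgap, hcons, integral_zero]
    exact ⟨fun _ => integrable_zero _ _ _, fun _ => integrable_zero _ _ _, tendsto_const_nhds,
      tendsto_const_nhds, isBigO_zero _ _, isBigO_zero _ _⟩
  · obtain ⟨L', hLL', hvalid, hLl, hA⟩ := RCPP.exists_rates_valid hn hD μ (RCPP.Lmax_nonneg L) hl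
      hM hMl hcomp.Cc_nonneg hcomp.r_pos hcomp.δ_pos hcomp.δ_le hαx hαx1 hαy hαy1 hγx hγy hs hx hy
    have hreg : RCPP.Regime D P f L xs L' M Cc r δ μ :=
      { obj := hf
        Lmax_le := hLL'
        adm := hD
        rowStochastic := hnet.rowStochastic
        colStochastic := hnet.colStochastic
        lam_nonneg := hlam
        lamHat_le := hMl
        lamBar_le := hLl
        valid := hvalid
        A_le := hA
        r_pos := hcomp.r_pos
        δ_pos := hcomp.δ_pos
        δ_le := hcomp.δ_le
        αx_pos := hαx
        αx_le := (le_div_iff₀ hcomp.r_pos).1 hαx1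
        αy_pos := hαy
        αy_le := (le_div_iff₀ hcomp.r_pos).1 hαy1
        γx_pos := hγx
        γy_pos := hγy }
    obtain ⟨⟨h1, h2, h3⟩, h4, h5, h6⟩ := hreg.mean_convergence hcomp hξ hρc hc1 hc₀ hsk X0
    exact ⟨h1, h4, h2, h5, h3, h6⟩
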